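/- **Setting.** Indices $a,b,\dots=0,\dots,3$ are raised and lowered with $\eta=\mathrm{diag}(-1,1,1,1)$, and $\epsilon^{0123}=1$. Let $F$ be the graded manifold with coordinates of ghost degree $1$: $\xi^a,\ \rho_{ab}=-\rho_{ba},\ \kappa_a,\ \lambda$, and of ghost degree $0$: a tensor $W_{abcd}$ with the algebraic symmetries of the Weyl tensor, a tensor $C_{abc}$ with those of the Cotton tensor ($C_{abc}=-C_{acb}$, $C_{abc}+C_{bca}+C_{cab}=0$, $\eta^{ac}C_{abc}=0$), and the remaining independent on-shell covariant derivatives $W_{abcd|e_1\ldots e_k}$, $k\ge1$ (of Weyl type in $abcd$, symmetric in $e_1\ldots e_k$, with $W^{a}{}_{bcd|a}=0$ for $k=1$, the divergence $C_{bcd}$ being a separate coordinate, and, for $k\ge2$, with vanishing double divergences $W_{abcd|}{}^{ac}{}_{e_3\ldots e_k}=0$ and $W^*_{abcd|}{}^{ac}{}_{e_3\ldots e_k}=0$). Here $W^*_{abcd}=W_{ab}{}^{pk}\epsilon_{pkcd}$ and $C^*_{abc}=C_a{}^{pk}\epsilon_{pkbc}$. Equip $F$ with the presymplectic form $$\omega=d\rho_{ab}\,d\big(W^{abnm}\epsilon_{nmpk}\xi^p\xi^k\big)-2\,d\xi_a\,d\big(C^{a}{}_{bc}\epsilon^{bcpk}\xi_p\xi_k\big).$$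 Let $\bar F$ be the space of supermaps $\mathbb R^4[1]\to F$, $\psi^A(\theta)=\sum_l\frac1{l!}\psi^A_{\mu_1\ldots\mu_l}\theta^{\mu_1}\cdots\theta^{\mu_l}$, for which the matrix $e^a_\mu$ (the $\theta^\mu$-coefficient of $\xi^a(\theta)$) is invertible, with the induced form $\bar\omega=\int d^4\theta\,\omega_{AB}(\psi(\theta))\,d\psi^A(\theta)\,d\psi^B(\theta)$. The prolongation $\bar X$ of a vector field $X$ on $F$ is given by $\bar X\psi^A(\theta)=X^A(\psi(\theta))$. Put $\xi^{(4)}=\frac1{4!}\epsilon_{abcd}\xi^a\xi^b\xi^c\xi^d$, $\xi^{(3)}_d=\frac1{3!}\epsilon_{dabc}\xi^a\xi^b\xi^c$ and consider the following vector fields on $F$ (by their nonzero components; $\delta C$ stands for the component along $C$, and so on): * $X^{(4)}_a=\xi^{(4)}\partial/\partial\xi_a$, $\ X^{(3)}=\xi^{(3)}_a\,\partial/\partial\xi_a$; * $X^{(2ant)}_d$: $\delta\xi_a=\epsilon_{abcd}\xi^b\xi^c$, $\ \delta W_{abnm}=-\xi_dW^*_{abnm}$, $\ \delta C_{abc}=-2\xi_dC^*_{abc}+\tfrac12\xi_aC^*_{dbc}+\tfrac14(\xi_bC^*_{dac}-\xi_cC^*_{dab})+\tfrac14\xi^e(\eta_{ab}C^*_{dce}-\eta_{ac}C^*_{dbe})$;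 * $X^{(2trace)}_d$: $\delta\xi_a=2\xi_d\xi_a$, $\ \delta W=-4\xi_dW$, $\ \delta C=-6\xi_dC$; * $X^{(trace)}$: $\delta\xi_a=\xi_a$, $\ \delta W=-2W$, $\ \delta C=-3C$; * $Y^{(4)}_{ab}=\xi^{(4)}\partial/\partial\rho_{ab}$, $\ Y^{(3)}_l=\xi^{(3)}_d\,\partial/\partial\rho_{dl}$; * $Y^{(ant)}_d$: $\delta\rho_{ab}=\epsilon_{abcd}\xi^c$, $\ \delta C_{abc}=W_{dnma}\epsilon^{nm}{}_{bc}$; $\quad Y^{(trace)}_d$: $\delta\rho_{ab}=\xi_a\eta_{bd}-\xi_b\eta_{ad}$, $\ \delta C_{abc}=W_{adbc}$; * $Y^{(2ant)}_{ld}=\xi_lY^{(ant)}_d$, $\ Y^{(2trace)}_{ld}=\xi_lY^{(trace)}_d$; * $K_a=\partial/\partial\kappa_a$, $\ L=\partial/\partial\lambda$; * $Z^W_S$: $\delta W_{abcd}=S_{abcd|e}\,\xi^e$ for constant $S$ of Weyl type in $abcd$ with $S^{e}{}_{bcd|e}=0$; $\quad Z^C_S$: $\delta C_{abc}=S_{abc|e}\,\xi^e$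 for constant $S$ of Cotton type in $abc$ with $S_{ab}{}^{e}{}_{|e}=0$. **Proposition.** 1. All these vector fields lie in the kernel of $\omega$. 2. The form $\bar\omega$ is regular, i.e. it has constant (finite) rank on $\bar F$: there are $p,q$ such that at every point of $\bar F$ with values in any supercommutative real algebra $\Lambda$ the tangent module is the direct sum of the kernel of $\bar\omega$ and a free $\Lambda$-module with a homogeneous basis of $p$ even and $q$ odd vectors, on which $\bar\omega$ is nondegenerate (its Gram matrix is invertible). 3. At every such point the kernel of $\bar\omega$ is the $\Lambda$-span of the prolongations of the vector fields $\xi_{a_1}\cdots\xi_{a_r}X$ ($r\ge0$, $X$ any of the fields above), together with all directions along the remaining derivatives $W_{abcd|e_1\ldots e_k}$, $k\ge1$, which do not enter $\omega$. That is, the kernel distribution is generated by the prolongations of the kernel vector fields of $\omega$. -/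

import Mathlib

/-!
Superalgebras, the target graded manifold `F` of conformal gravity, its presymplectic form, and
the induced form on the space of supermaps from the odd four-space to `F`.

Graded manifolds are treated through their points with values in supercommutative algebras `Λ`.
A `Λ`-point of a (super)domain assigns to every coordinate an element of `Λ` of the same parity;
taking for `Λ` the algebra of functions on an open domain and for the point the tautological one
gives statements about functions, vector fields and forms on that domain, while `Λ = ℝ` gives the
points of the body.  Parity is the ghost degree modulo two.
-/

universe u

noncomputable section

namespace ConformalGravity

/-! ### Supercommutative algebras -/

/-- A supercommutative real algebra.  The grading by `ℤ/2` is given by the parity involution: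
`a` is even if `par a = a` and odd if `par a = -a`. -/
class SuperAlgebra (Λ : Type u) [Ring Λ] [Algebra ℝ Λ] where
  par : Λ →ₐ[ℝ] Λ
  par_par : ∀ a, par (par a) = a
  even_mul : ∀ a b, par a = a → a * b = b * a
  odd_mul : ∀ a b, par a = -a → par b = -b → a * b = -(b * a)

open SuperAlgebra (par par_par even_mul odd_mul)

/-- `Λ[θ]` for one new odd generator `θ`: the pair `(a, b)` stands for `a + b θ`. -/
def OddExt (Λ : Type u) : Type u := Λ × Λ

namespace OddExt

variable {Λ : Type u}

instance [AddCommGroup Λ] : AddCommGroup (OddExt Λ) := inferInstanceAs (AddCommGroup (Λ × Λ))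

instance {S : Type*} [Semiring S] [AddCommGroup Λ] [Module S Λ] : Module S (OddExt Λ) :=
  inferInstanceAs (Module S (Λ × Λ))

theorem ext' {x y : OddExt Λ} (h1 : x.1 = y.1) (h2 : x.2 = y.2) : x = y := Prod.ext h1 h2

section
variable [AddCommGroup Λ]
@[simp] theorem fst_add (x y : OddExt Λ) : (x + y).1 = x.1 + y.1 := rfl
@[simp] theorem snd_add (x y : OddExt Λ) : (x + y).2 = x.2 + y.2 := rfl
@[simp] theorem fst_neg (x : OddExt Λ) : (-x).1 = -x.1 := rfl
@[simp] theorem snd_neg (x : OddExt Λ) : (-x).2 = -x.2 := rfl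
@[simp] theorem fst_zero : (0 : OddExt Λ).1 = 0 := rfl
@[simp] theorem snd_zero : (0 : OddExt Λ).2 = 0 := rfl
@[simp] theorem fst_smul {S : Type*} [Semiring S] [Module S Λ] (c : S) (x : OddExt Λ) :
    (c • x).1 = c • x.1 := rfl
@[simp] theorem snd_smul {S : Type*} [Semiring S] [Module S Λ] (c : S) (x : OddExt Λ) :
    (c • x).2 = c • x.2 := rfl
end

variable [Ring Λ]

instance : One (OddExt Λ) := ⟨((1 : Λ), (0 : Λ))⟩

@[simp] theorem fst_one : (1 : OddExt Λ).1 = 1 := rfl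
@[simp] theorem snd_one : (1 : OddExt Λ).2 = 0 := rfl

variable [Algebra ℝ Λ] [SuperAlgebra Λ]

/-- `(a + b θ) (c + d θ) = a c + (a d + b (par c)) θ`, since `θ c = (par c) θ` and `θ θ = 0`. -/
instance : Mul (OddExt Λ) := ⟨fun x y => (x.1 * y.1, x.1 * y.2 + x.2 * par y.1)⟩

@[simp] theorem fst_mul (x y : OddExt Λ) : (x * y).1 = x.1 * y.1 := rfl
@[simp] theorem snd_mul (x y : OddExt Λ) : (x * y).2 = x.1 * y.2 + x.2 * par y.1 := rfl

instance : Ring (OddExt Λ) :=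
  { (inferInstance : AddCommGroup (OddExt Λ)), (inferInstance : Mul (OddExt Λ)),
    (inferInstance : One (OddExt Λ)) with
    left_distrib := fun x y z => ext' (by simp [mul_add]) (by simp [mul_add]; abel)
    right_distrib := fun x y z => ext' (by simp [add_mul]) (by simp [add_mul]; abel)
    zero_mul := fun x => ext' (by simp) (by simp)
    mul_zero := fun x => ext' (by simp) (by simp)
    mul_assoc := fun x y z => ext' (by simp [mul_assoc])
      (by simp [mul_assoc, mul_add, add_mul, add_assoc])
    one_mul := fun x => ext' (by simp) (by simp)
    mul_one := fun x => ext' (by simp) (by simp) }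

instance : Algebra ℝ (OddExt Λ) :=
  Algebra.ofModule
    (fun r x y => ext' (by simp) (by simp [smul_add]))
    (fun r x y => ext' (by simp) (by simp [smul_add]))

/-- Parity on `Λ[θ]`: the generator `θ` is odd. -/
def parFun (x : OddExt Λ) : OddExt Λ := (par x.1, -par x.2)

@[simp] theorem fst_parFun (x : OddExt Λ) : (parFun x).1 = par x.1 := rfl
@[simp] theorem snd_parFun (x : OddExt Λ) : (parFun x).2 = -par x.2 := rfl

theorem odd_mul_any {b : Λ} (hb : par b = -b) (c : Λ) : b * par c = c * b := by
  have h0 := even_mul (c + par c) b (by rw [map_add, par_par, add_comm])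
  have h1 := odd_mul (c - par c) b (by rw [map_sub, par_par]; abel) hb
  rw [add_mul, mul_add] at h0
  rw [sub_mul, mul_sub] at h1
  have h2 : (2 : ℝ) • (b * par c) = (2 : ℝ) • (c * b) := by
    rw [two_smul, two_smul]
    have h3 := congrArg₂ (· + ·) h0 h1
    beta_reduce at h3
    have e : c * b + c * b = c * b + par c * b + (c * b - par c * b) := by abel
    rw [e, h3]; abel
  exact smul_right_injective Λ (two_ne_zero : (2 : ℝ) ≠ 0) h2

instance : SuperAlgebra (OddExt Λ) where
  par :=
    AlgHom.ofLinearMap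
      { toFun := parFun
        map_add' := fun x y => ext' (by simp) (by simp; abel)
        map_smul' := fun r x => ext' (by simp) (by simp) }
      (ext' (by simp) (by simp))
      (fun x y => ext' (by simp) (by simp [par_par]; abel))
  par_par := fun x => ext' (by simp [par_par]) (by simp [par_par])
  even_mul := fun x y hx => by
    have h1 : par x.1 = x.1 := congrArg Prod.fst hx
    have h2 : -par x.2 = x.2 := congrArg Prod.snd hx
    have h2' : par x.2 = -x.2 := by rw [← h2, neg_neg, h2]
    refine ext' (even_mul _ _ h1) ?_
    simp only [snd_mul, h1, odd_mul_any h2', even_mul _ y.2 h1]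
    abel
  odd_mul := fun x y hx hy => by
    have h1 : par x.1 = -x.1 := congrArg Prod.fst hx
    have h2 : -par x.2 = -x.2 := congrArg Prod.snd hx
    have k1 : par y.1 = -y.1 := congrArg Prod.fst hy
    have k2 : -par y.2 = -y.2 := congrArg Prod.snd hy
    refine ext' (odd_mul _ _ h1 k1) ?_
    simp only [snd_mul, snd_neg, h1, k1, mul_neg, even_mul _ y.1 (neg_inj.mp h2),
      even_mul _ x.1 (neg_inj.mp k2)]
    abel

@[simp] theorem fst_par (x : OddExt Λ) : (par x).1 = par x.1 := rfl
@[simp] theorem snd_par (x : OddExt Λ) : (par x).2 = -par x.2 := rfl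

instance {S : Type*} [Semiring S] [Module S Λ] [IsScalarTower S Λ Λ] :
    IsScalarTower S (OddExt Λ) (OddExt Λ) :=
  ⟨fun c x y => ext' (by simp [smul_mul_assoc]) (by simp [smul_mul_assoc, smul_add])⟩

end OddExt

/-- `Λ[θ⁰, θ¹, θ², θ³]`: functions on the odd four-space with coefficients in `Λ`, written with the
coefficients on the left of the monomials in `θ`. -/
abbrev ThetaExt (Λ : Type u) : Type u := OddExt (OddExt (OddExt (OddExt Λ)))

/-- The coefficient of `θ^μ`. -/
def thetaCoeff {Λ : Type u} : Fin 4 → ThetaExt Λ → Λ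
  | 0, x => x.1.1.1.2
  | 1, x => x.1.1.2.1
  | 2, x => x.1.2.1.1
  | 3, x => x.2.1.1.1

/-- The Berezin integral over the odd four-space: the coefficient of `θ⁰ θ¹ θ² θ³`. -/
def berezin {Λ : Type u} (x : ThetaExt Λ) : Λ := x.2.2.2.2

/-! ### Tensors on Minkowski space

Tensor components carry lower indices; indices are raised with `η = diag(-1, 1, 1, 1)`. -/

def eta (a : Fin 4) : ℤ := if a = 0 then -1 else 1

/-- `ε^{abcd}`, with `ε^{0123} = 1`. -/
def epsUp (a b c d : Fin 4) : ℤ :=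
  Matrix.det (Matrix.of fun i j : Fin 4 => if ![a, b, c, d] i = j then (1 : ℤ) else 0)

/-- `ε_{abcd}`. -/
def epsLow (a b c d : Fin 4) : ℤ := eta a * eta b * eta c * eta d * epsUp a b c d

section Tensors
variable {R : Type*} [AddCommGroup R]

/-- Algebraic symmetries of the Weyl tensor `W_{abcd}`. -/
structure IsWeyl (T : Fin 4 → Fin 4 → Fin 4 → Fin 4 → R) : Prop where
  antisymm_left : ∀ a b c d, T b a c d = -T a b c d
  antisymm_right : ∀ a b c d, T a b d c = -T a b c d
  cyclic : ∀ a b c d, T a b c d + T a c d b + T a d b c = 0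
  traceless : ∀ b d, ∑ a, eta a • T a b a d = 0

/-- Algebraic symmetries of the Cotton tensor `C_{abc}`. -/
structure IsCotton (T : Fin 4 → Fin 4 → Fin 4 → R) : Prop where
  antisymm : ∀ a b c, T a c b = -T a b c
  cyclic : ∀ a b c, T a b c + T b c a + T c a b = 0
  traceless : ∀ b, ∑ a, eta a • T a b a = 0

/-- `T*_{abcd} = T_{ab}^{pk} ε_{pkcd}`. -/
def dual4 (T : Fin 4 → Fin 4 → Fin 4 → Fin 4 → R) (a b c d : Fin 4) : R :=
  ∑ p, ∑ k, (eta p * eta k * epsLow p k c d) • T a b p k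

/-- `T*_{abc} = T_a^{pk} ε_{pkbc}`. -/
def dual3 (T : Fin 4 → Fin 4 → Fin 4 → R) (a b c : Fin 4) : R :=
  ∑ p, ∑ k, (eta p * eta k * epsLow p k b c) • T a p k

end Tensors

/-! ### The target manifold `F` -/

/-- Labels of the coordinates on `F`: `ξ_a`, `ρ_{ab}`, `κ_a`, `λ` of ghost degree one, and, of ghost
degree zero, the Weyl tensor `W_{abcd}`, the Cotton tensor `C_{abc}`, and the remaining on-shell
covariant derivatives `W_{abcd|e_0 … e_k}` of order `k + 1`. -/
inductive Coord : Type
  | xi (a : Fin 4)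
  | rho (a b : Fin 4)
  | kappa (a : Fin 4)
  | lam
  | W (a b c d : Fin 4)
  | C (a b c : Fin 4)
  | H (k : ℕ) (a b c d : Fin 4) (e : Fin (k + 1) → Fin 4)

namespace Coord

def ghost : Coord → ℕ
  | xi _ => 1
  | rho _ _ => 1
  | kappa _ => 1
  | lam => 1
  | _ => 0

/-- The labels of derivatives of the Weyl tensor other than the Cotton tensor. -/
def IsHigher : Coord → Prop
  | H _ _ _ _ _ _ => True
  | _ => False

end Coord

/-- The linear relations between the (overcomplete) coordinates on `F`.  The derivatives of the Weyl
tensor are symmetric in the derivative indices; at first order the part given by the Cotton tensor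
`W^a_{bcd|a}` is split off; from second order on, the traces `W_{abcd|}^{ac…}` and
`W*_{abcd|}^{ac…}` are removed, which accounts for the Bach equation, the Bianchi identity and all
their differential consequences. -/
structure IsTensor {R : Type*} [AddCommGroup R] (v : Coord → R) : Prop where
  rho_antisymm : ∀ a b, v (.rho b a) = -v (.rho a b)
  weyl : IsWeyl fun a b c d => v (.W a b c d)
  cotton : IsCotton fun a b c => v (.C a b c)
  higher_weyl : ∀ k e, IsWeyl fun a b c d => v (.H k a b c d e)
  higher_symm : ∀ k a b c d e (τ : Equiv.Perm (Fin (k + 1))),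
    v (.H k a b c d (e ∘ τ)) = v (.H k a b c d e)
  first_div : ∀ b c d, ∑ a, eta a • v (.H 0 a b c d fun _ => a) = 0
  bach : ∀ k (e : Fin k → Fin 4) b d,
    ∑ a, ∑ c, (eta a * eta c) • v (.H (k + 1) a b c d (Fin.cons a (Fin.cons c e))) = 0
  bianchi : ∀ k (e : Fin k → Fin 4) b d,
    ∑ a, ∑ c, (eta a * eta c) •
      dual4 (fun a' b' c' d' => v (.H (k + 1) a' b' c' d' (Fin.cons a (Fin.cons c e)))) a b c d = 0

/-- `ψ` is an `R`-point of `F`. -/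
def IsPoint {R : Type u} [Ring R] [Algebra ℝ R] [SuperAlgebra R] (ψ : Coord → R) : Prop :=
  IsTensor ψ ∧ ∀ i, par (ψ i) = ((-1 : ℤ) ^ i.ghost) • ψ i

/-! A tangent vector at an `R`-point, `δ = ∑ δ^A ∂/∂ψ^A`, is a family `δ : Coord → R` satisfying the
same linear relations, with no condition on the parity. -/

section Omega
variable {R : Type*} [Ring R]

/-- For `β_{ab} = W_{abnm} ε^{nmpk} ξ_p ξ_k`: the derivative of `β_{ab}` along the vector `δ`, with
the components of `δ` on the left. -/
def betaL (ψ δ : Coord → R) (a b : Fin 4) : R :=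
  ∑ n, ∑ m, ∑ p, ∑ k, epsUp n m p k •
    (δ (.W a b n m) * ψ (.xi p) * ψ (.xi k)
      + (2 : ℕ) • (δ (.xi p) * ψ (.W a b n m) * ψ (.xi k)))

/-- The differential `dβ_{ab} = ε^{nmpk} (ξ_p ξ_k dW_{abnm} + 2 W_{abnm} ξ_k dξ_p)`, with the
differentials, on the right, replaced by the components of `δ`. -/
def betaR (ψ δ : Coord → R) (a b : Fin 4) : R :=
  ∑ n, ∑ m, ∑ p, ∑ k, epsUp n m p k •
    (ψ (.xi p) * ψ (.xi k) * δ (.W a b n m)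
      + (2 : ℕ) • (ψ (.W a b n m) * ψ (.xi k) * δ (.xi p)))

/-- The same as `betaL` for `γ_a = C_{abc} ε^{bcpk} ξ_p ξ_k`. -/
def gammaL (ψ δ : Coord → R) (a : Fin 4) : R :=
  ∑ b, ∑ c, ∑ p, ∑ k, epsUp b c p k •
    (δ (.C a b c) * ψ (.xi p) * ψ (.xi k)
      + (2 : ℕ) • (δ (.xi p) * ψ (.C a b c) * ψ (.xi k)))

/-- The same as `betaR` for `γ_a`. -/
def gammaR (ψ δ : Coord → R) (a : Fin 4) : R :=
  ∑ b, ∑ c, ∑ p, ∑ k, epsUp b c p k •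
    (ψ (.xi p) * ψ (.xi k) * δ (.C a b c)
      + (2 : ℕ) • (ψ (.C a b c) * ψ (.xi k) * δ (.xi p)))

/-- The presymplectic form `ω = dρ_{ab} dβ^{ab} - 2 dξ_a dγ^a` at the point `ψ`, as the expression
`∑ δ^A ω_{AB} δ'^B`, where `i_X ω = ∑ X^A ω_{AB} dψ^B`.  As `ρ` and `ξ` are odd, `dρ` and `dξ`
commute with everything, so that
`i_X ω = X(ρ_{ab}) dβ^{ab} + X(β^{ab}) dρ_{ab} - 2 (X(ξ_a) dγ^a + X(γ^a) dξ_a)`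
for `X` of either parity. -/
def omegaF (ψ δ δ' : Coord → R) : R :=
  (∑ a, ∑ b, (eta a * eta b) •
    (δ (.rho a b) * betaR ψ δ' a b + betaL ψ δ a b * δ' (.rho a b)))
  - (2 : ℕ) • ∑ a, eta a • (δ (.xi a) * gammaR ψ δ' a + gammaL ψ δ a * δ' (.xi a))

/-- The kernel of `ω` at the point `ψ` of `F`. -/
def kerOmega (ψ : Coord → R) : Set (Coord → R) :=
  {δ | IsTensor δ ∧ ∀ δ', IsTensor δ' → omegaF ψ δ δ' = 0}

theorem omegaF_add (ψ δ₁ δ₂ δ' : Coord → R) :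
    omegaF ψ (δ₁ + δ₂) δ' = omegaF ψ δ₁ δ' + omegaF ψ δ₂ δ' := by
  simp only [omegaF, betaL, gammaL, Pi.add_apply, add_mul, smul_add, Finset.sum_add_distrib]
  abel

theorem omegaF_smul {S : Type*} [Semiring S] [Module S R] [IsScalarTower S R R]
    (s : S) (ψ δ δ' : Coord → R) : omegaF ψ (s • δ) δ' = s • omegaF ψ δ δ' := by
  have hz : ∀ (n : ℤ) (x : R), n • s • x = s • n • x := fun n x => smul_comm n s x
  have hn : ∀ (n : ℕ) (x : R), n • s • x = s • n • x := fun n x => smul_comm n s x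
  simp only [omegaF, betaL, gammaL, Pi.smul_apply, smul_mul_assoc, hz, hn, ← smul_add,
    ← Finset.smul_sum, ← smul_sub]

end Omega

/-! ### The space of supermaps `F̄`

A `Λ`-point of the space of supermaps from the odd four-space to `F` is a `Λ[θ]`-point `ψ(θ)` of
`F`; the coefficients of the monomials in `θ` are the values of the coordinates on `F̄`. -/

/-- The frame `e_{aμ}`: the coefficient of `θ^μ` in `ξ_a(θ)`. -/
def frame {Λ : Type u} (ψ : Coord → ThetaExt Λ) : Matrix (Fin 4) (Fin 4) Λ :=
  Matrix.of fun a μ => thetaCoeff μ (ψ (.xi a))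

section Supermaps
variable (Λ : Type u) [Ring Λ] [Algebra ℝ Λ] [SuperAlgebra Λ]

/-- The `Λ`-points of `F̄`: supermaps with nondegenerate frame. -/
def FBar : Set (Coord → ThetaExt Λ) := {ψ | IsPoint ψ ∧ IsUnit (frame ψ)}

variable {Λ}

/-- `ω̄ = ∫ d⁴θ ω_{AB}(ψ(θ)) dψ^A(θ) dψ^B(θ)`. -/
def omegaBar (ψ δ δ' : Coord → ThetaExt Λ) : Λ := berezin (omegaF ψ δ δ')

end Supermaps

section TangentSpace
variable {S R : Type*} [Ring S] [AddCommGroup R] [Module S R]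

theorem IsWeyl.add {T U : Fin 4 → Fin 4 → Fin 4 → Fin 4 → R} (hT : IsWeyl T) (hU : IsWeyl U) :
    IsWeyl fun a b c d => T a b c d + U a b c d where
  antisymm_left a b c d := by rw [hT.antisymm_left, hU.antisymm_left]; abel
  antisymm_right a b c d := by rw [hT.antisymm_right, hU.antisymm_right]; abel
  cyclic a b c d := by
    have := congrArg₂ (· + ·) (hT.cyclic a b c d) (hU.cyclic a b c d)
    simp only [add_zero] at this
    rw [← this]; abel
  traceless b d := by
    simp only [smul_add, Finset.sum_add_distrib, hT.traceless, hU.traceless, add_zero]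

theorem IsWeyl.smul (s : S) {T : Fin 4 → Fin 4 → Fin 4 → Fin 4 → R} (hT : IsWeyl T) :
    IsWeyl fun a b c d => s • T a b c d where
  antisymm_left a b c d := by rw [hT.antisymm_left, smul_neg]
  antisymm_right a b c d := by rw [hT.antisymm_right, smul_neg]
  cyclic a b c d := by rw [← smul_add, ← smul_add, hT.cyclic, smul_zero]
  traceless b d := by
    simp only [smul_comm _ s, ← Finset.smul_sum, hT.traceless, smul_zero]

theorem IsWeyl.zero : IsWeyl fun _ _ _ _ => (0 : R) := by constructor <;> simp

theorem IsTensor.zero : IsTensor (0 : Coord → R) := by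
  constructor <;> intros <;> (try constructor) <;> simp [dual4]

theorem IsTensor.add {v w : Coord → R} (hv : IsTensor v) (hw : IsTensor w) :
    IsTensor (v + w) where
  rho_antisymm a b := by
    simp only [Pi.add_apply]; rw [hv.rho_antisymm, hw.rho_antisymm]; abel
  weyl := hv.weyl.add hw.weyl
  cotton :=
    { antisymm := fun a b c => by
        have h1 := hv.cotton.antisymm a b c
        have h2 := hw.cotton.antisymm a b c
        simp only [Pi.add_apply] at *; rw [h1, h2]; abel
      cyclic := fun a b c => by
        have := congrArg₂ (· + ·) (hv.cotton.cyclic a b c) (hw.cotton.cyclic a b c)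
        simp only [add_zero] at this
        rw [← this]; simp only [Pi.add_apply]; abel
      traceless := fun b => by
        simp only [Pi.add_apply, smul_add, Finset.sum_add_distrib, hv.cotton.traceless,
          hw.cotton.traceless, add_zero] }
  higher_weyl k e := (hv.higher_weyl k e).add (hw.higher_weyl k e)
  higher_symm k a b c d e τ := by
    simp only [Pi.add_apply]; rw [hv.higher_symm, hw.higher_symm]
  first_div b c d := by
    simp only [Pi.add_apply, smul_add, Finset.sum_add_distrib, hv.first_div, hw.first_div,
      add_zero]
  bach k e b d := by
    simp only [Pi.add_apply, smul_add, Finset.sum_add_distrib, hv.bach, hw.bach, add_zero]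
  bianchi k e b d := by
    have h1 := hv.bianchi k e b d
    have h2 := hw.bianchi k e b d
    simp only [dual4] at h1 h2
    simp only [dual4, Pi.add_apply, smul_add, Finset.sum_add_distrib, h1, h2, add_zero]

theorem IsTensor.smul (s : S) {v : Coord → R} (hv : IsTensor v) : IsTensor (s • v) where
  rho_antisymm a b := by simp only [Pi.smul_apply]; rw [hv.rho_antisymm, smul_neg]
  weyl := hv.weyl.smul s
  cotton :=
    { antisymm := fun a b c => by
        have h1 := hv.cotton.antisymm a b c
        simp only [Pi.smul_apply] at *; rw [h1, smul_neg]
      cyclic := fun a b c => by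
        have h1 := hv.cotton.cyclic a b c
        simp only [Pi.smul_apply, ← smul_add] at *; rw [h1, smul_zero]
      traceless := fun b => by
        simp only [Pi.smul_apply, smul_comm _ s, ← Finset.smul_sum, hv.cotton.traceless,
          smul_zero] }
  higher_weyl k e := (hv.higher_weyl k e).smul s
  higher_symm k a b c d e τ := by simp only [Pi.smul_apply]; rw [hv.higher_symm]
  first_div b c d := by
    simp only [Pi.smul_apply, smul_comm _ s, ← Finset.smul_sum, hv.first_div, smul_zero]
  bach k e b d := by
    simp only [Pi.smul_apply, smul_comm _ s, ← Finset.smul_sum, hv.bach, smul_zero]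
  bianchi k e b d := by
    have h1 := hv.bianchi k e b d
    simp only [dual4] at h1
    simp only [dual4, Pi.smul_apply, smul_comm _ s, ← Finset.smul_sum, h1, smul_zero]

end TangentSpace

section Supermaps
variable (Λ : Type u) [Ring Λ] [Algebra ℝ Λ] [SuperAlgebra Λ]

/-- The tangent module of `F̄` at a `Λ`-point. -/
def tangent : Submodule Λ (Coord → ThetaExt Λ) where
  carrier := {δ | IsTensor δ}
  add_mem' := IsTensor.add
  zero_mem' := IsTensor.zero
  smul_mem' := fun c _ h => IsTensor.smul c h

/-- The tangent vectors along the coordinates `W_{abcd|e_0 … e_k}`. -/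
def higherTangent : Submodule Λ (Coord → ThetaExt Λ) where
  carrier := {δ | IsTensor δ ∧ ∀ i : Coord, ¬i.IsHigher → δ i = 0}
  add_mem' := fun hx hy => ⟨hx.1.add hy.1, fun i hi => by
    rw [Pi.add_apply, hx.2 i hi, hy.2 i hi, add_zero]⟩
  zero_mem' := ⟨IsTensor.zero, fun _ _ => rfl⟩
  smul_mem' := fun c _ h => ⟨IsTensor.smul c h.1, fun i hi => by
    rw [Pi.smul_apply, h.2 i hi, smul_zero]⟩

variable {Λ}

/-- The kernel of `ω̄` at the `Λ`-point `ψ`. -/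
def kerOmegaBar (ψ : Coord → ThetaExt Λ) : Submodule Λ (Coord → ThetaExt Λ) where
  carrier := {δ | IsTensor δ ∧ ∀ δ', IsTensor δ' → omegaBar ψ δ δ' = 0}
  add_mem' := fun hx hy => ⟨hx.1.add hy.1, fun δ' h' => by
    have h1 := hx.2 δ' h'
    have h2 := hy.2 δ' h'
    simp only [omegaBar, berezin] at h1 h2
    simp only [omegaBar, berezin, omegaF_add, OddExt.snd_add, h1, h2, add_zero]⟩
  zero_mem' := ⟨IsTensor.zero, fun δ' _ => by
    have h := omegaF_smul (0 : ℕ) ψ 0 δ'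
    rw [zero_smul, zero_smul] at h
    simp only [omegaBar, h]; rfl⟩
  smul_mem' := fun c x hx => ⟨IsTensor.smul c hx.1, fun δ' h' => by
    have h1 := hx.2 δ' h'
    simp only [omegaBar, berezin] at h1
    simp only [omegaBar, berezin, omegaF_smul, OddExt.snd_smul, h1, smul_zero]⟩

/-- The tangent vector `δ` has parity `s` (modulo two): `δ^A` has parity `|ψ^A| + s`. -/
def HasParity (s : ℕ) (δ : Coord → ThetaExt Λ) : Prop :=
  ∀ i : Coord, par (δ i) = ((-1 : ℤ) ^ (i.ghost + s)) • δ i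

/-- `ω̄` has rank `p|q` at the `Λ`-point `ψ`: there are `p` even and `q` odd tangent vectors whose
Gram matrix with respect to `ω̄` is invertible and which span a complement of the kernel.
(Invertibility of the Gram matrix makes them linearly independent and their span disjoint from the
kernel.) -/
def HasRank (ψ : Coord → ThetaExt Λ) (p q : ℕ) : Prop :=
  ∃ v : Fin p ⊕ Fin q → Coord → ThetaExt Λ,
    (∀ i, IsTensor (v i)) ∧
    (∀ i, HasParity 0 (v (.inl i))) ∧ (∀ j, HasParity 1 (v (.inr j))) ∧
    IsUnit (Matrix.of fun i j => omegaBar ψ (v i) (v j)) ∧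
    Submodule.span Λ (Set.range v) ⊔ kerOmegaBar ψ = tangent Λ

end Supermaps

/-! ### Vector fields on `F` -/

/-- A vector field `∑ X^A(ψ) ∂/∂ψ^A` on `F`, through the values of its components at points. -/
def VectorField : Type (u + 1) :=
  ∀ (R : Type u) [Ring R] [Algebra ℝ R], (Coord → R) → (Coord → R)

/-- The prolongation of a vector field on `F` to `F̄`: its component along `ψ^A(θ)` is
`X^A(ψ(θ))`. -/
def VectorField.prolong (X : VectorField.{u}) {Λ : Type u} [Ring Λ] [Algebra ℝ Λ] [SuperAlgebra Λ]
    (ψ : Coord → ThetaExt Λ) : Coord → ThetaExt Λ := X (ThetaExt Λ) ψ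

/-- The vector field `ξ_{a_1} ⋯ ξ_{a_r} X`. -/
def VectorField.xiMul (s : List (Fin 4)) (X : VectorField.{u}) : VectorField.{u} :=
  fun R _ _ ψ i => (s.map fun a => ψ (.xi a)).prod * X R ψ i

section Fields
variable {R : Type*} [Ring R] [Algebra ℝ R]

/-- `ξ^a`. -/
def xiUp (ψ : Coord → R) (a : Fin 4) : R := eta a • ψ (.xi a)

/-- `ξ⁽⁴⁾ = (1/4!) ε_{abcd} ξ^a ξ^b ξ^c ξ^d`. -/
def xi4 (ψ : Coord → R) : R :=
  (1 / 24 : ℝ) • ∑ a, ∑ b, ∑ c, ∑ d,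
    epsLow a b c d • (xiUp ψ a * xiUp ψ b * xiUp ψ c * xiUp ψ d)

/-- `ξ⁽³⁾_d = (1/3!) ε_{dabc} ξ^a ξ^b ξ^c`. -/
def xi3 (ψ : Coord → R) (d : Fin 4) : R :=
  (1 / 6 : ℝ) • ∑ a, ∑ b, ∑ c, epsLow d a b c • (xiUp ψ a * xiUp ψ b * xiUp ψ c)

/-- The vector with given components along `ξ`, `ρ`, `W`, `C`, and no others. -/
def vec (x : Fin 4 → R) (r : Fin 4 → Fin 4 → R) (w : Fin 4 → Fin 4 → Fin 4 → Fin 4 → R)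
    (c : Fin 4 → Fin 4 → Fin 4 → R) : Coord → R
  | .xi a => x a
  | .rho a b => r a b
  | .W a b e d => w a b e d
  | .C a b d => c a b d
  | _ => 0

/-- Metric components `η_{ab}`. -/
def etaMat (a b : Fin 4) : ℤ := if a = b then eta a else 0

/-- `W_{abcd}` as a tensor at a point. -/
def weylAt (ψ : Coord → R) (a b c d : Fin 4) : R := ψ (.W a b c d)

/-- `C_{abc}` as a tensor at a point. -/
def cottonAt (ψ : Coord → R) (a b c : Fin 4) : R := ψ (.C a b c)

/-- `X⁽ᵗʳᵃᶜᵉ⁾ = ξ_a ∂/∂ξ_a - 2 W ∂/∂W - 3 C ∂/∂C`. -/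
def fieldXtrace (ψ : Coord → R) : Coord → R :=
  vec (fun a => ψ (.xi a)) 0 (fun a b c d => (-2 : ℤ) • weylAt ψ a b c d)
    (fun a b c => (-3 : ℤ) • cottonAt ψ a b c)

/-- `X⁽²ᵃⁿᵗ⁾_d`, with components `ε_{abcd} ξ^b ξ^c` along `ξ_a`, `-ξ_d W*_{abnm}` along `W_{abnm}`,
and along `C_{abc}`
`-2 ξ_d C*_{abc} + ½ ξ_a C*_{dbc} + ¼ (ξ_b C*_{dac} - ξ_c C*_{dab})
  + ¼ ξ^e (η_{ab} C*_{dce} - η_{ac} C*_{dbe})`. -/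
def fieldX2ant (d : Fin 4) (ψ : Coord → R) : Coord → R :=
  vec (fun a => ∑ b, ∑ c, epsLow a b c d • (xiUp ψ b * xiUp ψ c)) 0
    (fun a b n m => -(ψ (.xi d) * dual4 (weylAt ψ) a b n m))
    (fun a b c =>
      (-2 : ℝ) • (ψ (.xi d) * dual3 (cottonAt ψ) a b c)
      + (1 / 2 : ℝ) • (ψ (.xi a) * dual3 (cottonAt ψ) d b c)
      + (1 / 4 : ℝ) • (ψ (.xi b) * dual3 (cottonAt ψ) d a c
          - ψ (.xi c) * dual3 (cottonAt ψ) d a b)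
      + (1 / 4 : ℝ) • ∑ e,
          (etaMat a b • (xiUp ψ e * dual3 (cottonAt ψ) d c e)
            - etaMat a c • (xiUp ψ e * dual3 (cottonAt ψ) d b e)))

/-- `Y⁽ᵃⁿᵗ⁾_d = ε_{abcd} ξ^c ∂/∂ρ_{ab} + W_{dnma} ε^{nm}_{bc} ∂/∂C_{abc}`. -/
def fieldYant (d : Fin 4) (ψ : Coord → R) : Coord → R :=
  vec 0 (fun a b => ∑ c, epsLow a b c d • xiUp ψ c) 0
    (fun a b c => ∑ n, ∑ m, (eta b * eta c * epsUp n m b c) • weylAt ψ d n m a)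

/-- `Y⁽ᵗʳᵃᶜᵉ⁾_d`: components `ξ_a η_{bd} - ξ_b η_{ad}` along `ρ_{ab}` and `W_{adbc}` along
`C_{abc}`. -/
def fieldYtrace (d : Fin 4) (ψ : Coord → R) : Coord → R :=
  vec 0 (fun a b => etaMat b d • ψ (.xi a) - etaMat a d • ψ (.xi b)) 0
    (fun a b c => weylAt ψ a d b c)

end Fields

/-- Constant tensors `S_{abcd|e}` of Weyl type in `abcd` with `S^e_{bcd|e} = 0`. -/
def WeylDivFree : Type :=
  {S : Fin 4 → Fin 4 → Fin 4 → Fin 4 → Fin 4 → ℝ //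
    (∀ e, IsWeyl fun a b c d => S a b c d e) ∧ ∀ b c d, ∑ e, eta e • S e b c d e = 0}

/-- Constant tensors `S_{abc|e}` of Cotton type in `abc` with `S_{ab}^e_{|e} = 0`. -/
def CottonDivFree : Type :=
  {S : Fin 4 → Fin 4 → Fin 4 → Fin 4 → ℝ //
    (∀ e, IsCotton fun a b c => S a b c e) ∧ ∀ a b, ∑ e, eta e • S a b e e = 0}

/-- Labels of the kernel vector fields. -/
inductive KernelLabel : Type
  | X4 (a : Fin 4)
  | X3
  | X2ant (d : Fin 4)
  | X2trace (d : Fin 4)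
  | Xtrace
  | Y4 (a b : Fin 4)
  | Y3 (l : Fin 4)
  | Y2ant (l d : Fin 4)
  | Y2trace (l d : Fin 4)
  | Yant (d : Fin 4)
  | Ytrace (d : Fin 4)
  | K (a : Fin 4)
  | L
  | ZW (S : WeylDivFree)
  | ZC (S : CottonDivFree)

/-- The kernel vector fields of `ω`:
* along `ξ`: `ξ⁽⁴⁾ ∂/∂ξ_a`, `ξ⁽³⁾_a ∂/∂ξ_a`, `X⁽²ᵃⁿᵗ⁾_d`,
  `X⁽²ᵗʳᵃᶜᵉ⁾_d = 2 ξ_d ξ_a ∂/∂ξ_a - 4 ξ_d W ∂/∂W - 6 ξ_d C ∂/∂C`, `X⁽ᵗʳᵃᶜᵉ⁾`;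
* along `ρ`: `ξ⁽⁴⁾ ∂/∂ρ_{ab}`, `ξ⁽³⁾_d ∂/∂ρ_{dl}`, `ξ_l Y⁽ᵃⁿᵗ⁾_d`, `ξ_l Y⁽ᵗʳᵃᶜᵉ⁾_d`, `Y⁽ᵃⁿᵗ⁾_d`,
  `Y⁽ᵗʳᵃᶜᵉ⁾_d`;
* `∂/∂κ_a` and `∂/∂λ`;
* along `W` and `C` only: `S_{abcd|e} ξ^e ∂/∂W_{abcd}` and `S_{abc|e} ξ^e ∂/∂C_{abc}`. -/
def kernelField : KernelLabel → VectorField.{u}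
  | .X4 a => fun _ _ _ ψ => vec (fun b => if b = a then xi4 ψ else 0) 0 0 0
  | .X3 => fun _ _ _ ψ => vec (fun a => xi3 ψ a) 0 0 0
  | .X2ant d => fun _ _ _ ψ => fieldX2ant d ψ
  | .X2trace d => fun _ _ _ ψ => vec (fun a => (2 : ℤ) • (ψ (.xi d) * ψ (.xi a))) 0
      (fun a b c e => (-4 : ℤ) • (ψ (.xi d) * weylAt ψ a b c e))
      (fun a b c => (-6 : ℤ) • (ψ (.xi d) * cottonAt ψ a b c))
  | .Xtrace => fun _ _ _ ψ => fieldXtrace ψ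
  | .Y4 a b => fun _ _ _ ψ => vec 0
      (fun p q => (if p = a ∧ q = b then xi4 ψ else 0) - (if p = b ∧ q = a then xi4 ψ else 0)) 0 0
  | .Y3 l => fun _ _ _ ψ => vec 0
      (fun p q => (if q = l then xi3 ψ p else 0) - (if p = l then xi3 ψ q else 0)) 0 0
  | .Y2ant l d => fun _ _ _ ψ => fun i => ψ (.xi l) * fieldYant d ψ i
  | .Y2trace l d => fun _ _ _ ψ => fun i => ψ (.xi l) * fieldYtrace d ψ i
  | .Yant d => fun _ _ _ ψ => fieldYant d ψ
  | .Ytrace d => fun _ _ _ ψ => fieldYtrace d ψ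
  | .K a => fun _ _ _ _ i => match i with
    | .kappa b => if b = a then 1 else 0
    | _ => 0
  | .L => fun _ _ _ _ i => match i with
    | .lam => 1
    | _ => 0
  | .ZW S => fun _ _ _ ψ => vec 0 0 (fun a b c d => ∑ e, S.1 a b c d e • xiUp ψ e) 0
  | .ZC S => fun _ _ _ ψ => vec 0 0 0 (fun a b c => ∑ e, S.1 a b c e • xiUp ψ e)

end ConformalGravity

end

open ConformalGravity

/-!
A tangent vector at a supermap `ψ` is a tangent vector of `F` at the `Λ[θ]`-point `ψ(θ)`, and `ω̄` is
the Berezin integral of `ω`.  Tangent vectors can be multiplied by functions of `θ`, and the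
Berezin integral pairs `Λ[θ]` with itself nondegenerately, so that the kernel of `ω̄` at `ψ` is the
kernel of `ω` at `ψ(θ)` (`mem_kerOmegaBar_iff`).  That the listed vector fields lie in the kernel of
`ω` is a computation with components (`kernelField_mem`), and it remains to see that they generate
the kernel at the points of `F̄`.

An invertible frame means that `θ^a ↦ ξ_a(θ)` extends to an automorphism of `Λ[θ]` over `Λ`
(`exists_frame_equiv`).  Both `ω` and the kernel fields are natural in the algebra of values, so one
may assume `ξ_a = θ_a` (`exists_theta_gauge`).  Pairing a vector of the kernel with the constant
vectors along `W` and `C` gives linear equations with constant coefficients for its components along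
`ρ` and `ξ`.  Their solutions are the components of combinations of `Xtrace`, `X2ant`, `Yant` and
`Ytrace` over `Λ[θ]` (`exists_xi_coefficients`, `exists_rho_coefficients`).  After subtraction of
such a combination the vector has no components along `ξ` and `ρ`, and the vanishing of `ω` says that
its components along `W` and `C`, as two-forms in the last two indices, are annihilated by the symbol
`T ↦ T_{nm} ε^{nmpk} θ_p θ_k`.  The kernel of the symbol is generated over `Λ[θ]` by the forms
`S_{…nm|e} θ^e` with divergence-free `S` (`mem_divFreeSpan`); this depends on the tensor symmetries
only through the solvability of the divergence equation in the form of `HasCompletion` and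
`HasPartner`.  This gives the generators of the kernel (`kerOmegaBar_eq`).

For the rank one observes that, when `ξ_a = θ_a`, the pairing of vectors along the odd coordinates
`ξ`, `ρ` with vectors along the even coordinates `W`, `C` does not depend on the other components of
the supermap: it is the extension of scalars of a pairing of real vector spaces, invariant under the
parity.  A maximal pair of real dual families of homogeneous vectors (`exists_isDualFamily`,
`exists_flat_dual`), with the Berezinian of the automorphism as a density, therefore spans a
complement of the kernel at every supermap (`exists_decomposition`).  Its Gram matrix has the blocks
`*`, `1`, `±1` and `0`, and is invertible whatever the pairing of the vectors along the odd
coordinates is.  Since `ω̄` is even while `ω` pairs odd coordinates with even ones, one vector of each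
dual pair is even and the other one odd, whence the rank is `n|n` (`exists_hasRank`).
-/

set_option linter.unusedSectionVars false
set_option linter.unusedSimpArgs false

noncomputable section

namespace ConformalGravity

open ConformalGravity.SuperAlgebra (par par_par even_mul odd_mul)

/-! ### Homomorphisms of superalgebras and the exterior generators -/

/-- A homomorphism of real algebras that preserves the parity of elements. -/
def IsSuperHom {A B : Type*} [Ring A] [Algebra ℝ A] [SuperAlgebra A] [Ring B] [Algebra ℝ B]
    [SuperAlgebra B] (f : A →ₐ[ℝ] B) : Prop := ∀ a, par (f a) = f (par a)

/-- The real numbers, as a purely even superalgebra. -/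
instance : SuperAlgebra ℝ where
  par := AlgHom.id ℝ ℝ
  par_par _ := rfl
  even_mul a b _ := mul_comm a b
  odd_mul a b h _ := by
    have h' : a = -a := h
    have : a = 0 := by linarith
    simp [this]

@[simp] theorem par_real (r : ℝ) : par r = r := rfl

section Super
variable {A : Type*} [Ring A] [Algebra ℝ A] [SuperAlgebra A]

/-- An odd element is moved past an arbitrary one at the cost of the parity involution. -/
theorem odd_mul_eq {z : A} (hz : par z = -z) (a : A) : z * a = par a * z := by
  have := OddExt.odd_mul_any hz (par a)
  rwa [par_par] at this

theorem odd_mul_self {z : A} (hz : par z = -z) : z * z = 0 := by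
  have h := odd_mul z z hz hz
  have h2 : (2 : ℝ) • (z * z) = 0 := by rw [two_smul]; nth_rw 1 [h]; simp
  exact (smul_eq_zero.mp h2).resolve_left two_ne_zero

end Super

namespace OddExt

/-- The element `a + b θ`. -/
def mk {A : Type*} (a b : A) : OddExt A := (a, b)

@[simp] theorem fst_mk {A : Type*} (a b : A) : (mk a b).1 = a := rfl
@[simp] theorem snd_mk {A : Type*} (a b : A) : (mk a b).2 = b := rfl

@[simp] theorem fst_sum {A ι : Type*} [AddCommGroup A] (s : Finset ι) (f : ι → OddExt A) :
    (∑ k ∈ s, f k).1 = ∑ k ∈ s, (f k).1 :=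
  map_sum (⟨⟨fun x => x.1, rfl⟩, fun _ _ => rfl⟩ : OddExt A →+ A) _ _

@[simp] theorem snd_sum {A ι : Type*} [AddCommGroup A] (s : Finset ι) (f : ι → OddExt A) :
    (∑ k ∈ s, f k).2 = ∑ k ∈ s, (f k).2 :=
  map_sum (⟨⟨fun x => x.2, rfl⟩, fun _ _ => rfl⟩ : OddExt A →+ A) _ _

section Hom
variable {A B : Type*} [Ring A] [Algebra ℝ A] [SuperAlgebra A] [Ring B] [Algebra ℝ B]
  [SuperAlgebra B]

theorem algebraMap_eq (r : ℝ) :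
    algebraMap ℝ (OddExt A) r = mk (algebraMap ℝ A r) 0 := by
  rw [Algebra.algebraMap_eq_smul_one]
  exact ext' (by simp [Algebra.algebraMap_eq_smul_one]) (by simp)

/-- The inclusion of `A` in `A[θ]`. -/
def incl : A →ₐ[ℝ] OddExt A where
  toFun a := mk a 0
  map_one' := rfl
  map_mul' a b := ext' (by simp) (by simp)
  map_zero' := rfl
  map_add' a b := ext' (by simp) (by simp)
  commutes' r := (algebraMap_eq r).symm

@[simp] theorem fst_incl (a : A) : (incl a).1 = a := rfl
@[simp] theorem snd_incl (a : A) : (incl a).2 = 0 := rfl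

/-- The odd generator `θ` of `A[θ]`. -/
def gen : OddExt A := mk 0 1

@[simp] theorem fst_gen : (gen : OddExt A).1 = 0 := rfl
@[simp] theorem snd_gen : (gen : OddExt A).2 = 1 := rfl

theorem isSuperHom_incl : IsSuperHom (incl (A := A)) := fun _ => ext' rfl (by simp)

theorem par_gen : par (gen : OddExt A) = -gen := ext' (by simp) (by simp)

theorem eq_incl_add (x : OddExt A) : x = incl x.1 + incl x.2 * gen :=
  ext' (by simp) (by simp)

/-- The homomorphism `A[θ] → B` which extends `f` and sends `θ` to an odd element `z`. -/
def lift (f : A →ₐ[ℝ] B) (hf : IsSuperHom f) (z : B) (hz : par z = -z) : OddExt A →ₐ[ℝ] B where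
  toFun x := f x.1 + f x.2 * z
  map_one' := by simp
  map_mul' x y := by
    have h1 : z * f y.1 = f (par y.1) * z := by rw [odd_mul_eq hz, hf]
    have h2 : z * (f y.2 * z) = 0 := by
      rw [← mul_assoc, odd_mul_eq hz, mul_assoc, odd_mul_self hz, mul_zero]
    simp only [fst_mul, snd_mul, map_mul, map_add, add_mul, mul_add, mul_assoc, h1, h2]
    simp
    abel
  map_zero' := by simp
  map_add' x y := by simp [add_mul]; abel
  commutes' r := by rw [algebraMap_eq]; simp

theorem lift_apply (f : A →ₐ[ℝ] B) (hf : IsSuperHom f) (z : B) (hz : par z = -z) (x : OddExt A) :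
    lift f hf z hz x = f x.1 + f x.2 * z := rfl

theorem isSuperHom_lift (f : A →ₐ[ℝ] B) (hf : IsSuperHom f) (z : B) (hz : par z = -z) :
    IsSuperHom (lift f hf z hz) := fun x => by
  simp [lift_apply, hf _, hz]

/-- Coefficientwise application of an additive map. -/
def mapLin (f : A →ₗ[ℝ] B) : OddExt A →ₗ[ℝ] OddExt B where
  toFun x := mk (f x.1) (f x.2)
  map_add' x y := ext' (by simp) (by simp)
  map_smul' r x := ext' (by simp) (by simp)

@[simp] theorem fst_mapLin (f : A →ₗ[ℝ] B) (x : OddExt A) : (mapLin f x).1 = f x.1 := rfl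
@[simp] theorem snd_mapLin (f : A →ₗ[ℝ] B) (x : OddExt A) : (mapLin f x).2 = f x.2 := rfl

/-- Coefficientwise application of a homomorphism. -/
def map (f : A →ₐ[ℝ] B) (hf : IsSuperHom f) : OddExt A →ₐ[ℝ] OddExt B where
  toFun x := mk (f x.1) (f x.2)
  map_one' := ext' (by simp) (by simp)
  map_mul' x y := ext' (by simp) (by simp [hf _])
  map_zero' := ext' (by simp) (by simp)
  map_add' x y := ext' (by simp) (by simp)
  commutes' r := by rw [algebraMap_eq, algebraMap_eq]; exact ext' (by simp) (by simp)

@[simp] theorem fst_map (f : A →ₐ[ℝ] B) (hf : IsSuperHom f) (x : OddExt A) :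
    (map f hf x).1 = f x.1 := rfl
@[simp] theorem snd_map (f : A →ₐ[ℝ] B) (hf : IsSuperHom f) (x : OddExt A) :
    (map f hf x).2 = f x.2 := rfl

theorem isSuperHom_map (f : A →ₐ[ℝ] B) (hf : IsSuperHom f) : IsSuperHom (map f hf) :=
  fun x => ext' (by simp [hf _]) (by simp [hf _])

/-- If `m : A → B` is linear over the image of `j : B → A` acting on the right, then the same holds
for the coefficientwise extensions of `m` and `j`. -/
theorem mapLin_mul_map (m : A →ₗ[ℝ] B) (j : B →ₐ[ℝ] A) (hj : IsSuperHom j)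
    (h : ∀ a b, m (a * j b) = m a * b) (x : OddExt A) (y : OddExt B) :
    mapLin m (x * map j hj y) = mapLin m x * y :=
  ext' (by simp [h]) (by simp [h, hj _])

end Hom
end OddExt

section Theta
open OddExt
variable {Λ : Type*} [Ring Λ] [Algebra ℝ Λ] [SuperAlgebra Λ]

/-- The inclusion of the coefficients `Λ` in `Λ[θ⁰, θ¹, θ², θ³]`. -/
def coeffs : Λ →ₐ[ℝ] ThetaExt Λ := incl.comp (incl.comp (incl.comp incl))

/-- The generators `θ^μ`. -/
def theta : Fin 4 → ThetaExt Λ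
  | 0 => incl (incl (incl gen))
  | 1 => incl (incl gen)
  | 2 => incl gen
  | 3 => gen

theorem isSuperHom_coeffs : IsSuperHom (coeffs (Λ := Λ)) := fun a => by
  simp [coeffs, isSuperHom_incl _]

theorem par_theta (μ : Fin 4) : par (theta μ : ThetaExt Λ) = -theta μ := by
  fin_cases μ <;> simp [theta, isSuperHom_incl _, par_gen]

theorem smul_eq_coeffs_mul (c : Λ) (x : ThetaExt Λ) : c • x = coeffs c * x := by
  refine ext' (ext' (ext' (ext' ?_ ?_) (ext' ?_ ?_)) (ext' (ext' ?_ ?_) (ext' ?_ ?_)))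
    (ext' (ext' (ext' ?_ ?_) (ext' ?_ ?_)) (ext' (ext' ?_ ?_) (ext' ?_ ?_))) <;> simp [coeffs]

/-- Homomorphisms out of `Λ[θ]` are determined on `Λ` and the generators. -/
theorem thetaExt_hom_ext {B : Type*} [Ring B] [Algebra ℝ B] {s t : ThetaExt Λ →ₐ[ℝ] B}
    (h0 : ∀ c, s (coeffs c) = t (coeffs c)) (h : ∀ μ, s (theta μ) = t (theta μ)) : s = t := by
  have g0 := h 0
  have g1 := h 1
  have g2 := h 2
  have g3 := h 3
  simp only [theta, coeffs, AlgHom.comp_apply] at h0 g0 g1 g2 g3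
  have k1 : ∀ x : OddExt Λ, s (incl (incl (incl x))) = t (incl (incl (incl x))) := fun x => by
    rw [eq_incl_add x]; simp only [map_add, map_mul, h0, g0]
  have k2 : ∀ x : OddExt (OddExt Λ), s (incl (incl x)) = t (incl (incl x)) := fun x => by
    rw [eq_incl_add x]; simp only [map_add, map_mul, k1, g1]
  have k3 : ∀ x : OddExt (OddExt (OddExt Λ)), s (incl x) = t (incl x) := fun x => by
    rw [eq_incl_add x]; simp only [map_add, map_mul, k2, g2]
  ext x
  rw [eq_incl_add x]; simp only [map_add, map_mul, k3, g3]

/-- Substitution of odd elements for the generators. -/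
theorem exists_subst {B : Type*} [Ring B] [Algebra ℝ B] [SuperAlgebra B] (f : Λ →ₐ[ℝ] B)
    (hf : IsSuperHom f) (ξ : Fin 4 → B) (hξ : ∀ μ, par (ξ μ) = -ξ μ) :
    ∃ s : ThetaExt Λ →ₐ[ℝ] B, IsSuperHom s ∧ (∀ c, s (coeffs c) = f c) ∧
      ∀ μ, s (theta μ) = ξ μ := by
  refine ⟨lift _ (isSuperHom_lift _ (isSuperHom_lift _ (isSuperHom_lift f hf (ξ 0) (hξ 0)) (ξ 1)
    (hξ 1)) (ξ 2) (hξ 2)) (ξ 3) (hξ 3), isSuperHom_lift _ _ _ _, fun c => ?_, fun μ => ?_⟩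
  · simp [coeffs, lift_apply]
  · fin_cases μ <;> simp [theta, lift_apply]

/-- The scalars in a superalgebra. -/
def scalars : ℝ →ₐ[ℝ] Λ := Algebra.ofId ℝ Λ

@[simp] theorem scalars_apply (r : ℝ) : (scalars r : Λ) = algebraMap ℝ Λ r := rfl

theorem isSuperHom_scalars : IsSuperHom (scalars (Λ := Λ)) := fun r => by simp

/-- The inclusion of `ℝ[θ]` in `Λ[θ]`. -/
def ofReal : ThetaExt ℝ →ₐ[ℝ] ThetaExt Λ :=
  OddExt.map _ (isSuperHom_map _ (isSuperHom_map _ (isSuperHom_map scalars isSuperHom_scalars)))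

theorem isSuperHom_ofReal : IsSuperHom (ofReal (Λ := Λ)) := isSuperHom_map _ _

@[simp] theorem ofReal_theta (μ : Fin 4) : ofReal (theta μ) = (theta μ : ThetaExt Λ) := by
  fin_cases μ <;>
  · refine ext' (ext' (ext' (ext' ?_ ?_) (ext' ?_ ?_)) (ext' (ext' ?_ ?_) (ext' ?_ ?_)))
      (ext' (ext' (ext' ?_ ?_) (ext' ?_ ?_)) (ext' (ext' ?_ ?_) (ext' ?_ ?_))) <;>
    simp [ofReal, theta]

/-- Coefficientwise application of a real functional on `Λ`. -/
def mapCoef (φ : Λ →ₗ[ℝ] ℝ) : ThetaExt Λ →ₗ[ℝ] ThetaExt ℝ := mapLin (mapLin (mapLin (mapLin φ)))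

theorem mapCoef_mul_ofReal (φ : Λ →ₗ[ℝ] ℝ) (x : ThetaExt Λ) (y : ThetaExt ℝ) :
    mapCoef φ (x * ofReal y) = mapCoef φ x * y := by
  refine mapLin_mul_map _ _ _ (mapLin_mul_map _ _ _ (mapLin_mul_map _ _ _
    (mapLin_mul_map _ _ _ fun a r => ?_))) _ _
  rw [scalars_apply, ← Algebra.commutes, ← Algebra.smul_def, map_smul, smul_eq_mul, mul_comm]

theorem berezin_ofReal (x : ThetaExt ℝ) :
    berezin (ofReal x : ThetaExt Λ) = algebraMap ℝ Λ (berezin x) := by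
  simp [berezin, ofReal]

/-- A finite family in `Λ[θ]` is a combination of families in `ℝ[θ]` with coefficients in `Λ`; the
real families arise by applying real functionals to the coefficients, so that they satisfy all real
linear equations which hold for the given one. -/
theorem exists_real_expansion {ι : Type*} [Finite ι] (x : ι → ThetaExt Λ) :
    ∃ (n : ℕ) (b : Fin n → Λ) (φ : Fin n → Λ →ₗ[ℝ] ℝ),
      ∀ i, x i = ∑ k, b k • ofReal (mapCoef (φ k) (x i)) := by
  cases nonempty_fintype ι
  classical
  let comps : ThetaExt Λ → Finset Λ := fun x =>
    {x.1.1.1.1, x.1.1.1.2, x.1.1.2.1, x.1.1.2.2, x.1.2.1.1, x.1.2.1.2, x.1.2.2.1, x.1.2.2.2,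
      x.2.1.1.1, x.2.1.1.2, x.2.1.2.1, x.2.1.2.2, x.2.2.1.1, x.2.2.1.2, x.2.2.2.1, x.2.2.2.2}
  let B := Module.Basis.ofVectorSpace ℝ Λ
  let F := Finset.univ.biUnion fun i => (comps (x i)).biUnion fun a => (B.repr a).support
  let e := F.equivFin
  refine ⟨F.card, fun k => B (e.symm k), fun k => B.coord (e.symm k), fun i => ?_⟩
  have key : ∀ a ∈ comps (x i),
      a = ∑ k, B (e.symm k) * algebraMap ℝ Λ (B.coord (e.symm k) a) := by
    intro a ha
    have hsub : (B.repr a).support ⊆ F := by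
      intro t ht
      simp only [F, Finset.mem_biUnion, Finset.mem_univ, true_and]
      exact ⟨i, a, ha, ht⟩
    have h1 := B.linearCombination_repr a
    rw [Finsupp.linearCombination_apply, Finsupp.sum_of_support_subset _ hsub _ (by simp),
      ← Finset.sum_coe_sort, ← e.symm.sum_comp] at h1
    nth_rw 1 [← h1]
    refine Finset.sum_congr rfl fun k _ => ?_
    rw [← Algebra.commutes, ← Algebra.smul_def]; rfl
  refine ext' (ext' (ext' (ext' ?_ ?_) (ext' ?_ ?_)) (ext' (ext' ?_ ?_) (ext' ?_ ?_)))
    (ext' (ext' (ext' ?_ ?_) (ext' ?_ ?_)) (ext' (ext' ?_ ?_) (ext' ?_ ?_))) <;>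
  · simp only [fst_sum, snd_sum, fst_smul, snd_smul, smul_eq_mul, ofReal, mapCoef, fst_map, snd_map,
      fst_mapLin, snd_mapLin, scalars_apply]
    refine key _ ?_
    simp only [comps, Finset.mem_insert, true_or, or_true, Finset.mem_singleton]

end Theta

/-! ### The Berezin integral -/

section Berezin
open OddExt
variable {Λ : Type*} [Ring Λ] [Algebra ℝ Λ] [SuperAlgebra Λ]

/-- If the pairing `x, y ↦ β (x y)` on `A` is nondegenerate on the left, so is the pairing on `A[θ]`
in which `β` is applied to the coefficient of `θ`. -/
theorem OddExt.eq_zero_of_functional_mul_right {A : Type*} [Ring A] [Algebra ℝ A] [SuperAlgebra A]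
    {β : A → Λ} (hβ : ∀ x, (∀ y, β (x * y) = 0) → x = 0) (x : OddExt A)
    (h : ∀ y, β (x * y).2 = 0) : x = 0 := by
  refine ext' (hβ _ fun y => ?_) (hβ _ fun y => ?_)
  · simpa using h (mk 0 y)
  · simpa [par_par] using h (mk (par y) 0)

/-- If the pairing `y, x ↦ β (y x)` on `A` is nondegenerate on the right, so is the pairing on `A[θ]`
in which `β` is applied to the coefficient of `θ`. -/
theorem OddExt.eq_zero_of_functional_mul_left {A : Type*} [Ring A] [Algebra ℝ A] [SuperAlgebra A]
    {β : A → Λ} (hβ : ∀ x, (∀ y, β (y * x) = 0) → x = 0) (x : OddExt A)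
    (h : ∀ y, β (y * x).2 = 0) : x = 0 := by
  have h1 : x.2 = 0 := hβ _ fun y => by simpa using h (mk y 0)
  have h2 : par x.1 = 0 := hβ _ fun y => by simpa using h (mk 0 y)
  refine ext' ?_ h1
  rw [← par_par x.1, h2, map_zero]; rfl

/-- If all functionals on `A` are of the form `x ↦ β (x j)`, then all functionals on `A[θ]` arise in
this way from the coefficient of `θ`. -/
theorem OddExt.exists_representing {A : Type*} [Ring A] [Algebra ℝ A] [SuperAlgebra A]
    [Module Λ A] {β : A → Λ} (hadd : ∀ x y, β (x + y) = β x + β y)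
    (hβ : ∀ φ : A →ₗ[Λ] Λ, ∃ j, ∀ x, φ x = β (x * j))
    (φ : OddExt A →ₗ[Λ] Λ) : ∃ j, ∀ x, φ x = β (x * j).2 := by
  obtain ⟨j₁, h₁⟩ := hβ (φ ∘ₗ
    { toFun := fun a => mk a 0
      map_add' := fun _ _ => ext' (by simp) (by simp)
      map_smul' := fun _ _ => ext' (by simp) (by simp) })
  obtain ⟨j₂, h₂⟩ := hβ (φ ∘ₗ
    { toFun := fun a => mk 0 a
      map_add' := fun _ _ => ext' (by simp) (by simp)
      map_smul' := fun _ _ => ext' (by simp) (by simp) })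
  refine ⟨mk (par j₂) j₁, fun x => ?_⟩
  have e : x = mk x.1 0 + mk 0 x.2 := ext' (by simp) (by simp)
  have h3 := h₁ x.1
  have h4 := h₂ x.2
  simp only [LinearMap.comp_apply, LinearMap.coe_mk, AddHom.coe_mk] at h3 h4
  nth_rw 1 [e]
  rw [map_add, h3, h4]
  simp [hadd, par_par]

theorem eq_zero_of_berezin_mul_right (x : ThetaExt Λ) (h : ∀ y, berezin (x * y) = 0) : x = 0 := by
  have h1 := eq_zero_of_functional_mul_right (A := Λ) (β := (id : Λ → Λ))
    fun x hx => by have := hx 1; simp only [mul_one, one_mul, id_eq] at this; exact this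
  have h2 := eq_zero_of_functional_mul_right (β := fun x : OddExt Λ => x.2) h1
  have h3 := eq_zero_of_functional_mul_right (β := fun x : OddExt (OddExt Λ) => x.2.2) h2
  exact eq_zero_of_functional_mul_right (β := fun x : OddExt (OddExt (OddExt Λ)) => x.2.2.2) h3 x h

theorem eq_zero_of_berezin_mul_left (x : ThetaExt Λ) (h : ∀ y, berezin (y * x) = 0) : x = 0 := by
  have h1 := eq_zero_of_functional_mul_left (A := Λ) (β := (id : Λ → Λ))
    fun x hx => by have := hx 1; simp only [mul_one, one_mul, id_eq] at this; exact this
  have h2 := eq_zero_of_functional_mul_left (β := fun x : OddExt Λ => x.2) h1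
  have h3 := eq_zero_of_functional_mul_left (β := fun x : OddExt (OddExt Λ) => x.2.2) h2
  exact eq_zero_of_functional_mul_left (β := fun x : OddExt (OddExt (OddExt Λ)) => x.2.2.2) h3 x h

/-- Every `Λ`-linear functional on `Λ[θ]` has a density with respect to the Berezin integral. -/
theorem exists_berezin_representing (φ : ThetaExt Λ →ₗ[Λ] Λ) :
    ∃ j, ∀ x, φ x = berezin (x * j) := by
  have h1 := exists_representing (A := Λ) (β := (id : Λ → Λ)) (fun _ _ => rfl)
    fun φ => ⟨φ 1, fun x => by
      rw [id, ← smul_eq_mul x (φ 1), ← map_smul, smul_eq_mul, mul_one]⟩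
  have h2 := exists_representing (β := fun x : OddExt Λ => x.2) (fun _ _ => rfl) h1
  have h3 := exists_representing (β := fun x : OddExt (OddExt Λ) => x.2.2) (fun _ _ => rfl) h2
  exact exists_representing (β := fun x : OddExt (OddExt (OddExt Λ)) => x.2.2.2)
    (fun _ _ => rfl) h3 φ

@[simp] theorem berezin_add (x y : ThetaExt Λ) : berezin (x + y) = berezin x + berezin y := rfl
@[simp] theorem berezin_sub (x y : ThetaExt Λ) : berezin (x - y) = berezin x - berezin y := by
  simp only [sub_eq_add_neg]; rfl
@[simp] theorem berezin_zero : berezin (0 : ThetaExt Λ) = 0 := rfl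
theorem berezin_smul (c : Λ) (x : ThetaExt Λ) : berezin (c • x) = c * berezin x := rfl
theorem berezin_sum {ι : Type*} (s : Finset ι) (f : ι → ThetaExt Λ) :
    berezin (∑ k ∈ s, f k) = ∑ k ∈ s, berezin (f k) := by simp [berezin]

theorem berezin_par (x : ThetaExt Λ) : berezin (par x) = par (berezin x) := by simp [berezin]

/-- An automorphism of `Λ[θ]` over `Λ` changes the Berezin integral by an even invertible density
(the Berezinian of the change of variables). -/
theorem exists_berezinian (s : ThetaExt Λ ≃ₐ[ℝ] ThetaExt Λ) (hs : ∀ x, par (s x) = s (par x))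
    (hc : ∀ c, s (coeffs c) = coeffs c) :
    ∃ J J' : ThetaExt Λ, J' * J = 1 ∧ J * J' = 1 ∧ par J = J ∧ par J' = J' ∧
      ∀ x, berezin (s x) = berezin (x * J) := by
  have key : ∀ t : ThetaExt Λ ≃ₐ[ℝ] ThetaExt Λ, (∀ c, t (coeffs c) = coeffs c) →
      ∃ J, ∀ x, berezin (t x) = berezin (x * J) := fun t ht => by
    obtain ⟨J, hJ⟩ := exists_berezin_representing (Λ := Λ)
      { toFun := fun x => berezin (t x)
        map_add' := fun x y => by rw [map_add, berezin_add]
        map_smul' := fun c x => by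
          rw [smul_eq_coeffs_mul, map_mul, ht, ← smul_eq_coeffs_mul, berezin_smul]; rfl }
    exact ⟨J, hJ⟩
  obtain ⟨J, hJ⟩ := key s hc
  obtain ⟨J₁, hJ₁⟩ := key s.symm fun c => by rw [AlgEquiv.symm_apply_eq, hc]
  have h1 : s.symm J₁ * J = 1 := by
    rw [← sub_eq_zero]
    refine eq_zero_of_berezin_mul_left _ fun y => ?_
    have := hJ₁ (s y)
    rw [s.symm_apply_apply] at this
    rw [mul_sub, mul_one, berezin_sub, this, ← mul_assoc, ← hJ, map_mul, s.apply_symm_apply,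
      sub_self]
  have hpar : par J = J := by
    rw [← sub_eq_zero]
    refine eq_zero_of_berezin_mul_left _ fun y => ?_
    have h2 := berezin_par (par y * J)
    rw [map_mul, par_par, ← hJ, ← berezin_par, hs, par_par] at h2
    rw [mul_sub, berezin_sub, ← hJ, h2, sub_self]
  have h2 : J * s.symm J₁ = 1 := by rw [even_mul _ _ hpar, h1]
  refine ⟨J, s.symm J₁, h1, h2, hpar, ?_, hJ⟩
  have h3 : par (s.symm J₁) * J = 1 := by
    rw [← hpar, ← map_mul, h1, map_one]
  calc par (s.symm J₁) = par (s.symm J₁) * (J * s.symm J₁) := by rw [h2, mul_one]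
    _ = s.symm J₁ := by rw [← mul_assoc, h3, one_mul]

end Berezin

/-! ### The frame as a change of the odd variables -/

section Frame
open OddExt

/-- A multiplicative decreasing filtration of a superalgebra, stable under the parity. -/
structure IsFiltration {A : Type*} [Ring A] [Algebra ℝ A] [SuperAlgebra A]
    (f : ℕ → AddSubgroup A) : Prop where
  zero : ∀ a, a ∈ f 0
  anti : ∀ k, f (k + 1) ≤ f k
  mul : ∀ i j a b, a ∈ f i → b ∈ f j → a * b ∈ f (i + j)
  par_mem : ∀ k a, a ∈ f k → par a ∈ f k

section
variable {A : Type*} [Ring A] [Algebra ℝ A] [SuperAlgebra A]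

/-- The filtration of `A[θ]` in which `θ` has degree one. -/
def filtrationExt (f : ℕ → AddSubgroup A) (k : ℕ) : AddSubgroup (OddExt A) where
  carrier := {x | x.1 ∈ f k ∧ x.2 ∈ f (k - 1)}
  add_mem' hx hy := ⟨add_mem hx.1 hy.1, add_mem hx.2 hy.2⟩
  zero_mem' := ⟨zero_mem _, zero_mem _⟩
  neg_mem' hx := ⟨neg_mem hx.1, neg_mem hx.2⟩

theorem mem_filtrationExt {f : ℕ → AddSubgroup A} {k : ℕ} {x : OddExt A} :
    x ∈ filtrationExt f k ↔ x.1 ∈ f k ∧ x.2 ∈ f (k - 1) := Iff.rfl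

theorem IsFiltration.antitone {f : ℕ → AddSubgroup A} (hf : IsFiltration f) : Antitone f :=
  antitone_nat_of_succ_le hf.anti

theorem IsFiltration.ext {f : ℕ → AddSubgroup A} (hf : IsFiltration f) :
    IsFiltration (filtrationExt f) where
  zero x := ⟨hf.zero _, hf.zero _⟩
  anti k x hx := ⟨hf.anti k hx.1, hf.antitone (by omega) hx.2⟩
  mul i j x y hx hy := by
    refine ⟨hf.mul _ _ _ _ hx.1 hy.1, ?_⟩
    rw [snd_mul]
    exact add_mem (hf.antitone (by omega) (hf.mul _ _ _ _ hx.1 hy.2))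
      (hf.antitone (by omega) (hf.mul _ _ _ _ hx.2 (hf.par_mem _ _ hy.1)))
  par_mem k x hx := ⟨hf.par_mem _ _ hx.1, neg_mem (hf.par_mem _ _ hx.2)⟩

/-- If two homomorphisms `A[θ] → B` agree on `A` to leading order and their values on `θ` differ in
degree two, then they agree to leading order. -/
theorem map_sub_map_mem_filtration {B : Type*} [Ring B] [Algebra ℝ B] [SuperAlgebra B]
    {f : ℕ → AddSubgroup A} {F : ℕ → AddSubgroup B} (hF : IsFiltration F) (s t : OddExt A →ₐ[ℝ] B)
    (h : ∀ k a, a ∈ f k → s (incl a) - t (incl a) ∈ F (k + 1) ∧ t (incl a) ∈ F k)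
    (hgen : s gen - t gen ∈ F 2) (hgen' : t gen ∈ F 1)
    (k : ℕ) (x : OddExt A) (hx : x ∈ filtrationExt f k) : s x - t x ∈ F (k + 1) ∧ t x ∈ F k := by
  have hs : s gen ∈ F 1 := by
    have := add_mem (hF.anti 1 hgen) hgen'
    rwa [sub_add_cancel] at this
  obtain ⟨h1, h2⟩ := h _ _ hx.1
  obtain ⟨h3, h4⟩ := h _ _ hx.2
  rw [eq_incl_add x]
  simp only [map_add, map_mul]
  refine ⟨?_, add_mem h2 (hF.antitone (by omega) (hF.mul _ _ _ _ h4 hgen'))⟩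
  have e : s (incl x.1) + s (incl x.2) * s gen - (t (incl x.1) + t (incl x.2) * t gen)
      = (s (incl x.1) - t (incl x.1)) + ((s (incl x.2) - t (incl x.2)) * s gen
        + t (incl x.2) * (s gen - t gen)) := by
    rw [sub_mul, mul_sub]; abel
  rw [e]
  exact add_mem h1 (add_mem (hF.antitone (by omega) (hF.mul _ _ _ _ h3 hs))
    (hF.antitone (by omega) (hF.mul _ _ _ _ h4 hgen)))

end

variable {Λ : Type*} [Ring Λ] [Algebra ℝ Λ] [SuperAlgebra Λ]

/-- The filtration of `Λ` in which all elements have degree zero. -/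
def trivialFiltration (Λ : Type*) [Ring Λ] : ℕ → AddSubgroup Λ
  | 0 => ⊤
  | _ + 1 => ⊥

theorem isFiltration_trivial : IsFiltration (trivialFiltration Λ) where
  zero a := AddSubgroup.mem_top a
  anti k := bot_le
  mul i j a b ha hb := by
    cases i with
    | succ i =>
      have : a = 0 := ha
      rw [this, zero_mul]; exact zero_mem _
    | zero =>
      cases j with
      | succ j =>
        have : b = 0 := hb
        rw [this, mul_zero]; exact zero_mem _
      | zero => exact AddSubgroup.mem_top _
  par_mem k a ha := by
    cases k with
    | zero => exact AddSubgroup.mem_top _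
    | succ k =>
      have : a = 0 := ha
      rw [this, map_zero]; exact zero_mem _

/-- The filtration of `Λ[θ]` by the degree in `θ`. -/
def thetaFiltration (Λ : Type*) [Ring Λ] [Algebra ℝ Λ] [SuperAlgebra Λ] :
    ℕ → AddSubgroup (ThetaExt Λ) :=
  filtrationExt (filtrationExt (filtrationExt (filtrationExt (trivialFiltration Λ))))

theorem isFiltration_theta : IsFiltration (thetaFiltration Λ) :=
  isFiltration_trivial.ext.ext.ext.ext

theorem thetaFiltration_five {x : ThetaExt Λ} (hx : x ∈ thetaFiltration Λ 5) : x = 0 := by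
  simp only [thetaFiltration, mem_filtrationExt, trivialFiltration, AddSubgroup.mem_bot] at hx
  obtain ⟨⟨⟨⟨_, _⟩, _, _⟩, ⟨_, _⟩, _, _⟩, ⟨⟨_, _⟩, _, _⟩, ⟨_, _⟩, _, _⟩ := hx
  refine ext' (ext' (ext' (ext' ?_ ?_) (ext' ?_ ?_)) (ext' (ext' ?_ ?_) (ext' ?_ ?_)))
    (ext' (ext' (ext' ?_ ?_) (ext' ?_ ?_)) (ext' (ext' ?_ ?_) (ext' ?_ ?_))) <;> assumption

theorem theta_mem_filtration (μ : Fin 4) : (theta μ : ThetaExt Λ) ∈ thetaFiltration Λ 1 := by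
  fin_cases μ <;> simp [thetaFiltration, mem_filtrationExt, trivialFiltration, theta]

theorem mem_thetaFiltration_two {x : ThetaExt Λ} (h0 : x.1.1.1.1 = 0)
    (h1 : ∀ μ, thetaCoeff μ x = 0) : x ∈ thetaFiltration Λ 2 := by
  have k0 := h1 0
  have k1 := h1 1
  have k2 := h1 2
  have k3 := h1 3
  simp only [thetaCoeff] at k0 k1 k2 k3
  simp [thetaFiltration, mem_filtrationExt, trivialFiltration, h0, k0, k1, k2, k3]

/-- A substitution which changes the generators in degree at least two only is bijective, because
it differs from the identity by a map which raises the degree. -/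
theorem bijective_of_unipotent (s : ThetaExt Λ →ₐ[ℝ] ThetaExt Λ)
    (hc : ∀ c, s (coeffs c) = coeffs c)
    (h : ∀ μ, s (theta μ) - theta μ ∈ thetaFiltration Λ 2) : Function.Bijective s := by
  have hF := isFiltration_theta (Λ := Λ)
  have raise : ∀ k x, x ∈ thetaFiltration Λ k → s x - x ∈ thetaFiltration Λ (k + 1) := by
    have base : ∀ k (a : Λ), a ∈ trivialFiltration Λ k →
        s (coeffs a) - coeffs a ∈ thetaFiltration Λ (k + 1) ∧
          coeffs a ∈ thetaFiltration Λ k := fun k a ha => by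
      rw [hc, sub_self]
      refine ⟨zero_mem _, ?_⟩
      simp [thetaFiltration, mem_filtrationExt, coeffs, ha]
    have l1 := map_sub_map_mem_filtration hF (s.comp (incl.comp (incl.comp incl)))
      (incl.comp (incl.comp incl)) base (h 0) (theta_mem_filtration 0)
    have l2 := map_sub_map_mem_filtration hF (s.comp (incl.comp incl)) (incl.comp incl) l1 (h 1)
      (theta_mem_filtration 1)
    have l3 := map_sub_map_mem_filtration hF (s.comp incl) incl l2 (h 2) (theta_mem_filtration 2)
    exact fun k x hx => (map_sub_map_mem_filtration hF s (AlgHom.id ℝ _) l3 (h 3)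
      (theta_mem_filtration 3) k x hx).1
  constructor
  · rw [injective_iff_map_eq_zero]
    intro x hx
    have hk : ∀ k, x ∈ thetaFiltration Λ k := fun k => by
      induction k with
      | zero => exact hF.zero x
      | succ k ih =>
        have := raise k x ih
        rwa [hx, zero_sub, neg_mem_iff] at this
    exact thetaFiltration_five (hk 5)
  · have hk : ∀ d x, x ∈ thetaFiltration Λ (5 - d) → ∃ y, s y = x := fun d => by
      induction d with
      | zero => exact fun x hx => ⟨0, by rw [map_zero, thetaFiltration_five hx]⟩
      | succ d ih =>
        intro x hx
        obtain ⟨y, hy⟩ := ih (s x - x) (hF.antitone (by omega) (raise _ x hx))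
        exact ⟨x - y, by rw [map_sub, hy]; abel⟩
    exact fun x => hk 5 x (hF.zero x)

/-- The elements `ξ_a(θ)` with invertible frame are the images of the generators under an
automorphism of `Λ[θ]`: a translation, followed by a linear map, followed by a unipotent
substitution. -/
theorem exists_frame_equiv (ξ : Fin 4 → ThetaExt Λ) (hξ : ∀ a, par (ξ a) = -ξ a)
    (hu : IsUnit (Matrix.of fun a μ => thetaCoeff μ (ξ a))) :
    ∃ s : ThetaExt Λ ≃ₐ[ℝ] ThetaExt Λ, (∀ x, par (s x) = s (par x)) ∧
      (∀ c, s (coeffs c) = coeffs c) ∧ ∀ a, s (theta a) = ξ a := by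
  obtain ⟨⟨e, f, hef, hfe⟩, he⟩ := hu
  simp only at he
  have hcoef : ∀ μ (x : ThetaExt Λ), thetaCoeff μ (par x) = -par (thetaCoeff μ x) := fun μ x => by
    fin_cases μ <;> simp [thetaCoeff]
  have epar : ∀ a μ, par (e a μ) = e a μ := fun a μ => by
    have := hcoef μ (ξ a)
    rw [hξ] at this
    have h2 : thetaCoeff μ (-ξ a) = -thetaCoeff μ (ξ a) := by fin_cases μ <;> rfl
    rw [h2, neg_inj] at this
    rw [he]; exact this.symm
  have fpar : ∀ μ a, par (f μ a) = f μ a := by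
    have h1 : f.map par * e = 1 := by
      have h2 : (f * e).map par = f.map par * e.map par := Matrix.map_mul
      rw [hfe] at h2
      have h3 : e.map par = e := Matrix.ext epar
      rw [h3] at h2
      rw [← h2]
      exact Matrix.map_one _ (map_zero _) (map_one _)
    have h4 : f.map par = f := by
      calc f.map par = f.map par * (e * f) := by rw [hef, mul_one]
        _ = f := by rw [← mul_assoc, h1, one_mul]
    intro μ a
    exact congrFun (congrFun h4 μ) a
  set c : Fin 4 → Λ := fun a => (ξ a).1.1.1.1 with hcdef
  have cpar : ∀ a, par (c a) = -c a := fun a => by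
    have := congrArg (fun x : ThetaExt Λ => x.1.1.1.1) (hξ a)
    simpa using this
  have cc : ∀ x : Λ, par (coeffs x) = coeffs (par x) := isSuperHom_coeffs
  -- the translation and its inverse
  have htr : ∀ c' : Fin 4 → Λ, (∀ a, par (c' a) = -c' a) →
      ∀ a, par (theta a + coeffs (c' a)) = -(theta a + coeffs (c' a)) := fun c' hc' a => by
    rw [map_add, par_theta, cc, hc', map_neg]; abel
  obtain ⟨t, ht, ht0, ht1⟩ := exists_subst (coeffs (Λ := Λ)) isSuperHom_coeffs _ (htr c cpar)
  obtain ⟨t', ht', ht'0, ht'1⟩ := exists_subst (coeffs (Λ := Λ)) isSuperHom_coeffs _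
    (htr (fun a => -c a) fun a => by rw [map_neg, cpar])
  -- the linear map and its inverse
  have hlin : ∀ m : Matrix (Fin 4) (Fin 4) Λ, (∀ a b, par (m a b) = m a b) →
      ∀ a, par (∑ μ, coeffs (m a μ) * theta μ : ThetaExt Λ)
        = -∑ μ, coeffs (m a μ) * theta μ := fun m hm a => by
    simp only [map_sum, map_mul, cc, hm, par_theta, mul_neg, Finset.sum_neg_distrib]
  obtain ⟨l, hl, hl0, hl1⟩ := exists_subst (coeffs (Λ := Λ)) isSuperHom_coeffs _ (hlin e epar)
  obtain ⟨l', hl', hl'0, hl'1⟩ := exists_subst (coeffs (Λ := Λ)) isSuperHom_coeffs _ (hlin f fpar)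
  -- the unipotent substitution
  set z : Fin 4 → ThetaExt Λ := fun μ => ∑ a, coeffs (f μ a) * (ξ a - coeffs (c a)) with hz
  obtain ⟨v, hv, hv0, hv1⟩ := exists_subst (coeffs (Λ := Λ)) isSuperHom_coeffs z fun μ => by
    simp only [hz, map_sum, map_mul, map_sub, cc, fpar, hξ, cpar, map_neg]
    rw [← Finset.sum_neg_distrib]
    refine Finset.sum_congr rfl fun a _ => ?_
    rw [← mul_neg]; congr 1; abel
  have hsum : ∀ (m n : Matrix (Fin 4) (Fin 4) Λ) (w : Fin 4 → ThetaExt Λ) a, m * n = 1 →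
      ∑ μ, coeffs (m a μ) * ∑ b, coeffs (n μ b) * w b = w a := fun m n w a hmn => by
    simp only [Finset.mul_sum, ← mul_assoc, ← map_mul]
    rw [Finset.sum_comm]
    simp only [← Finset.sum_mul, ← map_sum]
    have : ∀ b, ∑ μ, m a μ * n μ b = (1 : Matrix (Fin 4) (Fin 4) Λ) a b := fun b => by
      rw [← hmn, Matrix.mul_apply]
    simp only [this, Matrix.one_apply]
    simp [Finset.sum_ite_eq]
  have bt : Function.Bijective t := by
    have h1 : t.comp t' = AlgHom.id ℝ _ := thetaExt_hom_ext (by simp [ht0, ht'0])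
      (fun μ => by simp [ht1, ht'1, ht0])
    have h2 : t'.comp t = AlgHom.id ℝ _ := thetaExt_hom_ext (by simp [ht0, ht'0])
      (fun μ => by simp [ht1, ht'1, ht'0])
    exact ⟨Function.LeftInverse.injective (g := t') fun x => DFunLike.congr_fun h2 x,
      Function.RightInverse.surjective (g := t') fun x => DFunLike.congr_fun h1 x⟩
  have bl : Function.Bijective l := by
    have h1 : l.comp l' = AlgHom.id ℝ _ := thetaExt_hom_ext (by simp [hl0, hl'0])
      (fun μ => by
        simp only [AlgHom.comp_apply, hl'1, map_sum, map_mul, hl0, hl1, AlgHom.id_apply]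
        exact hsum f e _ μ hfe)
    have h2 : l'.comp l = AlgHom.id ℝ _ := thetaExt_hom_ext (by simp [hl0, hl'0])
      (fun μ => by
        simp only [AlgHom.comp_apply, hl1, map_sum, map_mul, hl'0, hl'1, AlgHom.id_apply]
        exact hsum e f _ μ hef)
    exact ⟨Function.LeftInverse.injective (g := l') fun x => DFunLike.congr_fun h2 x,
      Function.RightInverse.surjective (g := l') fun x => DFunLike.congr_fun h1 x⟩
  have bv : Function.Bijective v := by
    refine bijective_of_unipotent v hv0 fun μ => ?_
    have e1 : v (theta μ) - theta μ
        = ∑ a, coeffs (f μ a) * (ξ a - coeffs (c a) - ∑ ν, coeffs (e a ν) * theta ν) := by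
      simp only [mul_sub, Finset.sum_sub_distrib]
      rw [hsum f e theta μ hfe, hv1, hz]
      simp only [mul_sub, Finset.sum_sub_distrib]
    rw [e1]
    refine AddSubgroup.sum_mem _ fun a _ => ?_
    have h2 : ξ a - coeffs (c a) - ∑ ν, coeffs (e a ν) * theta ν ∈ thetaFiltration Λ 2 := by
      refine mem_thetaFiltration_two ?_ fun μ => ?_
      · simp [hcdef, coeffs, theta, Fin.sum_univ_four, sub_eq_add_neg]
      · fin_cases μ <;> simp [he, coeffs, theta, Fin.sum_univ_four, sub_eq_add_neg, thetaCoeff]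
    have := isFiltration_theta.mul 0 2 _ _ (isFiltration_theta.zero (coeffs (f μ a))) h2
    rwa [zero_add] at this
  have bvlt : Function.Bijective ((v.comp l).comp t) := (bv.comp bl).comp bt
  refine ⟨AlgEquiv.ofBijective ((v.comp l).comp t) bvlt, fun x => ?_, fun c => ?_, fun a => ?_⟩
  · change par (v (l (t x))) = v (l (t (par x)))
    rw [hv, hl, ht]
  · change v (l (t (coeffs c))) = _
    rw [ht0, hl0, hv0]
  · change v (l (t (theta a))) = _
    simp only [ht1, map_add, hl0, hl1, hv0, map_sum, map_mul, hv1, hz]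
    rw [hsum e f _ a hef]
    abel

end Frame

/-! ### Tensors and the presymplectic form under linear maps and homomorphisms -/

section TensorMap
variable {R R' : Type*} [AddCommGroup R] [AddCommGroup R']

theorem IsWeyl.map (f : R →+ R') {T : Fin 4 → Fin 4 → Fin 4 → Fin 4 → R} (hT : IsWeyl T) :
    IsWeyl fun a b c d => f (T a b c d) where
  antisymm_left a b c d := by rw [hT.antisymm_left, map_neg]
  antisymm_right a b c d := by rw [hT.antisymm_right, map_neg]
  cyclic a b c d := by rw [← map_add, ← map_add, hT.cyclic, map_zero]
  traceless b d := by simp only [← map_zsmul, ← map_sum, hT.traceless, map_zero]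

theorem IsCotton.map (f : R →+ R') {T : Fin 4 → Fin 4 → Fin 4 → R} (hT : IsCotton T) :
    IsCotton fun a b c => f (T a b c) where
  antisymm a b c := by rw [hT.antisymm, map_neg]
  cyclic a b c := by rw [← map_add, ← map_add, hT.cyclic, map_zero]
  traceless b := by simp only [← map_zsmul, ← map_sum, hT.traceless, map_zero]

theorem IsTensor.map (f : R →+ R') {v : Coord → R} (hv : IsTensor v) :
    IsTensor fun i => f (v i) where
  rho_antisymm a b := by rw [hv.rho_antisymm, map_neg]
  weyl := hv.weyl.map f
  cotton := hv.cotton.map f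
  higher_weyl k e := (hv.higher_weyl k e).map f
  higher_symm k a b c d e τ := by rw [hv.higher_symm]
  first_div b c d := by simp only [← map_zsmul, ← map_sum, hv.first_div, map_zero]
  bach k e b d := by simp only [← map_zsmul, ← map_sum, hv.bach, map_zero]
  bianchi k e b d := by
    have h := hv.bianchi k e b d
    simp only [dual4] at h
    simp only [dual4, ← map_zsmul, ← map_sum, h, map_zero]

theorem IsCotton.zero : IsCotton fun _ _ _ => (0 : R) := by constructor <;> simp

theorem IsCotton.add {T U : Fin 4 → Fin 4 → Fin 4 → R} (hT : IsCotton T) (hU : IsCotton U) :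
    IsCotton fun a b c => T a b c + U a b c where
  antisymm a b c := by rw [hT.antisymm, hU.antisymm]; abel
  cyclic a b c := by
    have := congrArg₂ (· + ·) (hT.cyclic a b c) (hU.cyclic a b c)
    simp only [add_zero] at this
    rw [← this]; abel
  traceless b := by
    simp only [smul_add, Finset.sum_add_distrib, hT.traceless, hU.traceless, add_zero]

end TensorMap

theorem isTensor_vec {R : Type*} [Ring R] [Algebra ℝ R] {x : Fin 4 → R} {r : Fin 4 → Fin 4 → R}
    {w : Fin 4 → Fin 4 → Fin 4 → Fin 4 → R} {c : Fin 4 → Fin 4 → Fin 4 → R}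
    (hr : ∀ a b, r b a = -r a b) (hw : IsWeyl w) (hc : IsCotton c) : IsTensor (vec x r w c) where
  rho_antisymm := hr
  weyl := hw
  cotton := hc
  higher_weyl _ _ := IsWeyl.zero
  higher_symm _ _ _ _ _ _ _ := rfl
  first_div _ _ _ := by simp [vec]
  bach _ _ _ _ := by simp [vec]
  bianchi _ _ _ _ := by simp [vec, dual4]

section OmegaMap
variable {R R' : Type*} [Ring R] [Ring R']

theorem omegaF_map (f : R →+* R') (ψ δ δ' : Coord → R) :
    omegaF (fun i => f (ψ i)) (fun i => f (δ i)) (fun i => f (δ' i)) = f (omegaF ψ δ δ') := by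
  simp only [omegaF, betaL, betaR, gammaL, gammaR, map_sub, map_add, map_sum, map_mul, map_zsmul,
    map_nsmul]

theorem omegaF_mul_right (ψ δ δ' : Coord → R) (y : R) :
    omegaF ψ δ (fun i => δ' i * y) = omegaF ψ δ δ' * y := by
  simp only [omegaF, betaR, gammaR, sub_mul, add_mul, Finset.sum_mul, Finset.mul_sum,
    smul_mul_assoc, mul_smul_comm, smul_add, mul_add, mul_assoc, add_assoc]

end OmegaMap

section KerOmega
variable {R : Type*} [Ring R]

/-- The kernel of `ω` at a point, as a left module over the functions. -/
def kerOmegaModule (ψ : Coord → R) : Submodule R (Coord → R) where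
  carrier := kerOmega ψ
  add_mem' hx hy := ⟨hx.1.add hy.1, fun δ' h' => by
    rw [omegaF_add, hx.2 δ' h', hy.2 δ' h', add_zero]⟩
  zero_mem' := ⟨IsTensor.zero, fun δ' _ => by
    have h := omegaF_smul (0 : ℕ) ψ 0 δ'
    rwa [zero_smul, zero_smul] at h⟩
  smul_mem' c x hx := ⟨IsTensor.smul c hx.1, fun δ' h' => by
    rw [omegaF_smul, hx.2 δ' h', smul_zero]⟩

theorem mem_kerOmegaModule {ψ δ : Coord → R} : δ ∈ kerOmegaModule ψ ↔ δ ∈ kerOmega ψ := Iff.rfl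

end KerOmega

section
variable {Λ : Type u} [Ring Λ] [Algebra ℝ Λ] [SuperAlgebra Λ]

/-- The Berezin integral being nondegenerate, the kernel of `ω̄` at a supermap is the kernel of `ω`
at that supermap, regarded as a `Λ[θ]`-point of `F`. -/
theorem mem_kerOmegaBar_iff {ψ δ : Coord → ThetaExt Λ} :
    δ ∈ kerOmegaBar ψ ↔ δ ∈ kerOmega ψ := by
  refine ⟨fun h => ⟨h.1, fun δ' hδ' => ?_⟩, fun h => ⟨h.1, fun δ' hδ' => ?_⟩⟩
  · refine eq_zero_of_berezin_mul_right _ fun y => ?_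
    rw [← omegaF_mul_right]
    exact h.2 _ (hδ'.map (AddMonoidHom.mulRight y))
  · rw [omegaBar, h.2 δ' hδ', berezin_zero]

theorem IsPoint.map {R R' : Type u} [Ring R] [Algebra ℝ R] [SuperAlgebra R] [Ring R'] [Algebra ℝ R']
    [SuperAlgebra R'] (f : R →ₐ[ℝ] R') (hf : IsSuperHom f) {ψ : Coord → R} (h : IsPoint ψ) :
    IsPoint fun i => f (ψ i) :=
  ⟨h.1.map (f : R →+ R'), fun i => by rw [hf, h.2, map_zsmul]⟩

theorem mem_kerOmega_equiv {R R' : Type*} [Ring R] [Algebra ℝ R] [Ring R'] [Algebra ℝ R']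
    (s : R ≃ₐ[ℝ] R') {ψ δ : Coord → R} (h : δ ∈ kerOmega ψ) :
    (fun i => s (δ i)) ∈ kerOmega fun i => s (ψ i) := by
  refine ⟨h.1.map (s : R →+ R'), fun δ' hδ' => ?_⟩
  have h1 := h.2 _ (hδ'.map (s.symm : R' →+ R))
  have h2 := omegaF_map (s : R →+* R') ψ δ fun i => s.symm (δ' i)
  simp only [RingHom.coe_coe, AlgEquiv.apply_symm_apply] at h2
  rw [h2]
  simp only [AddMonoidHom.coe_coe] at h1
  rw [h1, map_zero]

/-- The kernel vector fields are natural in the algebra of values. -/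
theorem kernelField_map {R R' : Type u} [Ring R] [Algebra ℝ R] [Ring R'] [Algebra ℝ R']
    (f : R →ₐ[ℝ] R') (α : KernelLabel) (ψ : Coord → R) :
    kernelField α R' (fun i => f (ψ i)) = fun i => f (kernelField α R ψ i) := by
  funext i
  cases α <;> cases i <;>
    simp only [kernelField, vec, fieldX2ant, fieldXtrace, fieldYant, fieldYtrace, xi3, xi4, xiUp,
      weylAt, cottonAt, dual3, dual4, Pi.zero_apply, map_zero, map_one, map_add, map_sub, map_neg,
      map_mul, map_sum, map_zsmul, map_smul, apply_ite f]

end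

/-! ### The Levi-Civita symbol -/

/-- The Levi-Civita symbol as a normalized Vandermonde product. -/
theorem epsUp_eq (a b c d : Fin 4) : epsUp a b c d =
    ((b : ℤ) - a) * (c - a) * (d - a) * (c - b) * (d - b) * (d - c) / 12 := by
  simp only [epsUp, Matrix.det_succ_row_zero, Fin.sum_univ_succ]
  simp [Fin.succAbove]
  fin_cases a <;> fin_cases b <;> fin_cases c <;> fin_cases d <;> rfl

theorem sum_epsUp {M : Type*} [AddCommGroup M] (g : Fin 4 → Fin 4 → Fin 4 → Fin 4 → M) :
    ∑ n, ∑ m, ∑ p, ∑ k, epsUp n m p k • g n m p k =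
      g 0 1 2 3 - g 0 1 3 2 - g 0 2 1 3 + g 0 2 3 1 + g 0 3 1 2 - g 0 3 2 1
      - g 1 0 2 3 + g 1 0 3 2 + g 1 2 0 3 - g 1 2 3 0 - g 1 3 0 2 + g 1 3 2 0
      + g 2 0 1 3 - g 2 0 3 1 - g 2 1 0 3 + g 2 1 3 0 + g 2 3 0 1 - g 2 3 1 0
      - g 3 0 1 2 + g 3 0 2 1 + g 3 1 0 2 - g 3 1 2 0 - g 3 2 0 1 + g 3 2 1 0 := by
  simp [Fin.sum_univ_four, epsUp_eq]
  abel

/-! ### Components of Weyl and Cotton tensors -/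

section Components
variable {M : Type*} [AddCommGroup M] [Module ℝ M]

theorem eq_zero_of_eq_neg {x : M} (h : x = -x) : x = 0 := by
  have h2 : (2 : ℝ) • x = 0 := by rw [two_smul]; nth_rw 1 [h]; simp
  exact (smul_eq_zero.mp h2).resolve_left two_ne_zero

/-- Reduction rules for the components of a skew-symmetric matrix. -/
theorem antisymm_rules {T : Fin 4 → Fin 4 → M} (h : ∀ a b, T b a = -T a b) :
    T 0 0 = 0 ∧ T 1 1 = 0 ∧ T 2 2 = 0 ∧ T 3 3 = 0 ∧ T 1 0 = -T 0 1 ∧ T 2 0 = -T 0 2 ∧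
      T 3 0 = -T 0 3 ∧ T 2 1 = -T 1 2 ∧ T 3 1 = -T 1 3 ∧ T 3 2 = -T 2 3 :=
  ⟨eq_zero_of_eq_neg (h 0 0), eq_zero_of_eq_neg (h 1 1), eq_zero_of_eq_neg (h 2 2),
    eq_zero_of_eq_neg (h 3 3), h 0 1, h 0 2, h 0 3, h 1 2, h 1 3, h 2 3⟩

theorem IsWeyl.pair_symm {T : Fin 4 → Fin 4 → Fin 4 → Fin 4 → M} (hT : IsWeyl T) (a b c d) :
    T c d a b = T a b c d := by
  have f1 := hT.antisymm_left a b c d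
  have f2 := hT.antisymm_left c d a b
  have f3 : T c a b d = T a c d b :=
    by rw [hT.antisymm_left a c, hT.antisymm_right a c d b, neg_neg]
  have f4 := hT.antisymm_left b c d a
  have f5 := hT.antisymm_left a d b c
  have f6 : T d b c a = T b d a c :=
    by rw [hT.antisymm_left b d, hT.antisymm_right b d a c, neg_neg]
  have h1 := hT.cyclic a b c d
  have h2 := hT.cyclic b c d a
  have h3 := hT.cyclic c d a b
  have h4 := hT.cyclic d a b c
  rw [f1] at h2
  rw [f3, f4] at h3
  rw [f5, f6, f2] at h4
  linear_combination (norm := module) (1 / 2 : ℝ) • h3 - (1 / 2 : ℝ) • h4 - (1 / 2 : ℝ) • h1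
    + (1 / 2 : ℝ) • h2

/-- Reduction of the components of a Weyl tensor to ten independent ones: the electric part
`T_{0i0j}` and the magnetic part `T_{0ijk}`. -/
theorem IsWeyl.rules {T : Fin 4 → Fin 4 → Fin 4 → Fin 4 → M} (hT : IsWeyl T) :
    (∀ c d, T 0 0 c d = 0 ∧ T 1 1 c d = 0 ∧ T 2 2 c d = 0 ∧ T 3 3 c d = 0 ∧
      T 1 0 c d = -T 0 1 c d ∧ T 2 0 c d = -T 0 2 c d ∧ T 3 0 c d = -T 0 3 c d ∧
      T 2 1 c d = -T 1 2 c d ∧ T 3 1 c d = -T 1 3 c d ∧ T 3 2 c d = -T 2 3 c d) ∧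
    (∀ a b, T a b 0 0 = 0 ∧ T a b 1 1 = 0 ∧ T a b 2 2 = 0 ∧ T a b 3 3 = 0 ∧
      T a b 1 0 = -T a b 0 1 ∧ T a b 2 0 = -T a b 0 2 ∧ T a b 3 0 = -T a b 0 3 ∧
      T a b 2 1 = -T a b 1 2 ∧ T a b 3 1 = -T a b 1 3 ∧ T a b 3 2 = -T a b 2 3) ∧
    (T 0 2 0 1 = T 0 1 0 2 ∧ T 0 3 0 1 = T 0 1 0 3 ∧ T 0 3 0 2 = T 0 2 0 3 ∧
      T 0 3 0 3 = -T 0 1 0 1 - T 0 2 0 2) ∧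
    (T 0 2 2 3 = -T 0 1 1 3 ∧ T 0 3 2 3 = T 0 1 1 2 ∧ T 0 3 1 3 = -T 0 2 1 2 ∧
      T 0 3 1 2 = T 0 2 1 3 - T 0 1 2 3) ∧
    (T 2 3 0 1 = T 0 1 2 3 ∧ T 1 3 0 1 = T 0 1 1 3 ∧ T 1 2 0 1 = T 0 1 1 2 ∧
      T 2 3 0 2 = -T 0 1 1 3 ∧ T 1 3 0 2 = T 0 2 1 3 ∧ T 1 2 0 2 = T 0 2 1 2 ∧
      T 2 3 0 3 = T 0 1 1 2 ∧ T 1 3 0 3 = -T 0 2 1 2 ∧ T 1 2 0 3 = T 0 2 1 3 - T 0 1 2 3) ∧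
    (T 2 3 2 3 = -T 0 1 0 1 ∧ T 1 3 1 3 = -T 0 2 0 2 ∧ T 1 2 1 2 = T 0 1 0 1 + T 0 2 0 2 ∧
      T 2 3 1 3 = T 0 1 0 2 ∧ T 1 3 2 3 = T 0 1 0 2 ∧ T 2 3 1 2 = -T 0 1 0 3 ∧
      T 1 2 2 3 = -T 0 1 0 3 ∧ T 1 3 1 2 = T 0 2 0 3 ∧ T 1 2 1 3 = T 0 2 0 3) := by
  have L := fun c d => antisymm_rules (T := fun a b => T a b c d) fun a b =>
    hT.antisymm_left a b c d
  have Rr := fun a b => antisymm_rules (T := fun c d => T a b c d) fun c d =>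
    hT.antisymm_right a b c d
  have P := hT.pair_symm
  have t00 := hT.traceless 0 0
  have t01 := hT.traceless 0 1
  have t02 := hT.traceless 0 2
  have t03 := hT.traceless 0 3
  have t11 := hT.traceless 1 1
  have t22 := hT.traceless 2 2
  have t33 := hT.traceless 3 3
  have t12 := hT.traceless 1 2
  have t13 := hT.traceless 1 3
  have t23 := hT.traceless 2 3
  have c0 := hT.cyclic 0 1 2 3
  have p1 := P 0 1 0 2
  have p2 := P 0 1 0 3
  have p3 := P 0 2 0 3
  have p4 := P 1 2 1 3
  have p5 := P 1 2 2 3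
  have p6 := P 1 3 2 3
  have q1 := P 0 1 1 2
  have q2 := P 0 1 1 3
  have q3 := P 0 1 2 3
  have q4 := P 0 2 1 2
  have q5 := P 0 2 1 3
  have q6 := P 0 2 2 3
  have q7 := P 0 3 1 2
  have q8 := P 0 3 1 3
  have q9 := P 0 3 2 3
  simp [Fin.sum_univ_four, eta, L, Rr] at t00 t01 t02 t03 t11 t12 t13 t22 t23 t33 c0
  refine ⟨L, Rr, ?_⟩
  clear L Rr P hT
  refine ⟨⟨?_, ?_, ?_, ?_⟩, ⟨?_, ?_, ?_, ?_⟩, ⟨?_, ?_, ?_, ?_, ?_, ?_, ?_, ?_, ?_⟩,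
    ⟨?_, ?_, ?_, ?_, ?_, ?_, ?_, ?_, ?_⟩⟩
  on_goal 18 => linear_combination (norm := module) (1 / 2 : ℝ) • t22 + (1 / 2 : ℝ) • t33
    - (1 / 2 : ℝ) • t11 + (1 / 2 : ℝ) • t00
  on_goal 18 => linear_combination (norm := module) (1 / 2 : ℝ) • t11 + (1 / 2 : ℝ) • t33
    - (1 / 2 : ℝ) • t22 + (1 / 2 : ℝ) • t00
  on_goal 18 => linear_combination (norm := module) (1 / 2 : ℝ) • t11 + (1 / 2 : ℝ) • t22
    - (1 / 2 : ℝ) • t33 - (1 / 2 : ℝ) • t00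
  all_goals grind

/-- Reduction of the components of a Cotton tensor to sixteen independent ones. -/
theorem IsCotton.rules {T : Fin 4 → Fin 4 → Fin 4 → M} (hT : IsCotton T) :
    (∀ a, T a 0 0 = 0 ∧ T a 1 1 = 0 ∧ T a 2 2 = 0 ∧ T a 3 3 = 0 ∧
      T a 1 0 = -T a 0 1 ∧ T a 2 0 = -T a 0 2 ∧ T a 3 0 = -T a 0 3 ∧
      T a 2 1 = -T a 1 2 ∧ T a 3 1 = -T a 1 3 ∧ T a 3 2 = -T a 2 3) ∧
    (T 0 1 2 = T 1 0 2 - T 2 0 1 ∧ T 0 1 3 = T 1 0 3 - T 3 0 1 ∧ T 0 2 3 = T 2 0 3 - T 3 0 2 ∧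
      T 1 2 3 = T 2 1 3 - T 3 1 2) ∧
    (T 3 0 3 = -T 1 0 1 - T 2 0 2 ∧ T 3 1 3 = -T 0 0 1 - T 2 1 2 ∧ T 3 2 3 = T 1 1 2 - T 0 0 2 ∧
      T 2 2 3 = T 0 0 3 - T 1 1 3) := by
  have Rr := fun a => antisymm_rules (T := fun c d => T a c d) fun c d => hT.antisymm a c d
  have t0 := hT.traceless 0
  have t1 := hT.traceless 1
  have t2 := hT.traceless 2
  have t3 := hT.traceless 3
  have c0 := hT.cyclic 0 1 2
  have c1 := hT.cyclic 0 1 3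
  have c2 := hT.cyclic 0 2 3
  have c3 := hT.cyclic 1 2 3
  simp [Fin.sum_univ_four, eta, Rr] at t0 t1 t2 t3 c0 c1 c2 c3
  refine ⟨Rr, ?_⟩
  clear Rr hT
  refine ⟨⟨?_, ?_, ?_, ?_⟩, ?_, ?_, ?_, ?_⟩ <;> grind

end Components

/-! ### The presymplectic form in terms of two-forms in `ξ` -/

section TwoForms
variable {R : Type*} [Ring R]

/-- `T_{nm} ε^{nmpk} ξ_p ξ_k`, with the components of `T` on the right. -/
def xiHodge (ψ : Coord → R) (T : Fin 4 → Fin 4 → R) : R :=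
  ∑ n, ∑ m, ∑ p, ∑ k, epsUp n m p k • (ψ (.xi p) * ψ (.xi k) * T n m)

/-- `2 T_{nm} ε^{nmpk} ξ_k`, the derivative of `T_{nm} ε^{nmpk} ξ_p ξ_k` along `ξ_p`. -/
def xiContr (ψ : Coord → R) (T : Fin 4 → Fin 4 → R) (p : Fin 4) : R :=
  ∑ n, ∑ m, ∑ k, epsUp n m p k • (2 : ℕ) • (T n m * ψ (.xi k))

theorem sum_comm_three {ι M : Type*} [Fintype ι] [AddCommMonoid M] (f : ι → ι → ι → M) :
    ∑ n, ∑ m, ∑ p, f n m p = ∑ p, ∑ n, ∑ m, f n m p := by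
  rw [Finset.sum_comm (f := fun p n => ∑ m, f n m p)]
  exact Finset.sum_congr rfl fun n _ => Finset.sum_comm

theorem betaR_eq (ψ δ : Coord → R) (a b : Fin 4) :
    betaR ψ δ a b = xiHodge ψ (fun n m => δ (.W a b n m))
      + ∑ p, xiContr ψ (fun n m => ψ (.W a b n m)) p * δ (.xi p) := by
  simp only [betaR, xiHodge, xiContr, smul_add, Finset.sum_add_distrib, Finset.sum_mul,
    smul_mul_assoc]
  rw [sum_comm_three (f := fun n m p => ∑ k, epsUp n m p k • (2 : ℕ) •
    (ψ (.W a b n m) * ψ (.xi k) * δ (.xi p)))]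

theorem gammaR_eq (ψ δ : Coord → R) (a : Fin 4) :
    gammaR ψ δ a = xiHodge ψ (fun n m => δ (.C a n m))
      + ∑ p, xiContr ψ (fun n m => ψ (.C a n m)) p * δ (.xi p) := by
  simp only [gammaR, xiHodge, xiContr, smul_add, Finset.sum_add_distrib, Finset.sum_mul,
    smul_mul_assoc]
  rw [sum_comm_three (f := fun n m p => ∑ k, epsUp n m p k • (2 : ℕ) •
    (ψ (.C a n m) * ψ (.xi k) * δ (.xi p)))]

end TwoForms

section Points
variable {R : Type u} [Ring R] [Algebra ℝ R] [SuperAlgebra R] {ψ : Coord → R}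

theorem IsPoint.par_xi (h : IsPoint ψ) (a : Fin 4) : par (ψ (.xi a)) = -ψ (.xi a) := by
  simpa [Coord.ghost] using h.2 (.xi a)

theorem IsPoint.xi_mul_xi (h : IsPoint ψ) (a b : Fin 4) :
    ψ (.xi b) * ψ (.xi a) = -(ψ (.xi a) * ψ (.xi b)) :=
  odd_mul _ _ (h.par_xi b) (h.par_xi a)

theorem IsPoint.xi_sq (h : IsPoint ψ) (a : Fin 4) : ψ (.xi a) * ψ (.xi a) = 0 :=
  odd_mul_self (h.par_xi a)

theorem IsPoint.mul_W (h : IsPoint ψ) (a b c d : Fin 4) (y : R) :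
    y * ψ (.W a b c d) = ψ (.W a b c d) * y :=
  (even_mul _ _ (by simpa [Coord.ghost] using h.2 (.W a b c d))).symm

theorem IsPoint.mul_C (h : IsPoint ψ) (a b c : Fin 4) (y : R) :
    y * ψ (.C a b c) = ψ (.C a b c) * y :=
  (even_mul _ _ (by simpa [Coord.ghost] using h.2 (.C a b c))).symm

theorem IsPoint.xi_xi_comm (h : IsPoint ψ) (p k : Fin 4) (y : R) :
    y * ψ (.xi p) * ψ (.xi k) = ψ (.xi p) * ψ (.xi k) * y := by
  rw [mul_assoc]
  refine (even_mul _ _ ?_).symm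
  rw [map_mul, h.par_xi, h.par_xi, neg_mul_neg]

/-- Rules which bring products of the `ξ_a` into normal order. -/
theorem IsPoint.xi_rules (h : IsPoint ψ) :
    (∀ a, ψ (.xi a) * ψ (.xi a) = 0 ∧ ∀ y, ψ (.xi a) * (ψ (.xi a) * y) = 0) ∧
    (ψ (.xi 1) * ψ (.xi 0) = -(ψ (.xi 0) * ψ (.xi 1)) ∧
      ψ (.xi 2) * ψ (.xi 0) = -(ψ (.xi 0) * ψ (.xi 2)) ∧
      ψ (.xi 3) * ψ (.xi 0) = -(ψ (.xi 0) * ψ (.xi 3)) ∧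
      ψ (.xi 2) * ψ (.xi 1) = -(ψ (.xi 1) * ψ (.xi 2)) ∧
      ψ (.xi 3) * ψ (.xi 1) = -(ψ (.xi 1) * ψ (.xi 3)) ∧
      ψ (.xi 3) * ψ (.xi 2) = -(ψ (.xi 2) * ψ (.xi 3))) ∧
    ∀ y, ψ (.xi 1) * (ψ (.xi 0) * y) = -(ψ (.xi 0) * (ψ (.xi 1) * y)) ∧
      ψ (.xi 2) * (ψ (.xi 0) * y) = -(ψ (.xi 0) * (ψ (.xi 2) * y)) ∧
      ψ (.xi 3) * (ψ (.xi 0) * y) = -(ψ (.xi 0) * (ψ (.xi 3) * y)) ∧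
      ψ (.xi 2) * (ψ (.xi 1) * y) = -(ψ (.xi 1) * (ψ (.xi 2) * y)) ∧
      ψ (.xi 3) * (ψ (.xi 1) * y) = -(ψ (.xi 1) * (ψ (.xi 3) * y)) ∧
      ψ (.xi 3) * (ψ (.xi 2) * y) = -(ψ (.xi 2) * (ψ (.xi 3) * y)) := by
  have hx := h.xi_mul_xi
  have key : ∀ a b y, ψ (.xi b) * (ψ (.xi a) * y) = -(ψ (.xi a) * (ψ (.xi b) * y)) :=
    fun a b y => by rw [← mul_assoc, hx, neg_mul, mul_assoc]
  exact ⟨fun a => ⟨h.xi_sq a, fun y => by rw [← mul_assoc, h.xi_sq, zero_mul]⟩,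
    ⟨hx _ _, hx _ _, hx _ _, hx _ _, hx _ _, hx _ _⟩,
    fun y => ⟨key _ _ y, key _ _ y, key _ _ y, key _ _ y, key _ _ y, key _ _ y⟩⟩

theorem xiHodge_eq (h : IsPoint ψ) {T : Fin 4 → Fin 4 → R} (hT : ∀ a b, T b a = -T a b) :
    xiHodge ψ T = (4 : ℝ) • (ψ (.xi 2) * ψ (.xi 3) * T 0 1 - ψ (.xi 1) * ψ (.xi 3) * T 0 2
      + ψ (.xi 1) * ψ (.xi 2) * T 0 3 + ψ (.xi 0) * ψ (.xi 3) * T 1 2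
      - ψ (.xi 0) * ψ (.xi 2) * T 1 3 + ψ (.xi 0) * ψ (.xi 1) * T 2 3) := by
  rw [xiHodge, sum_epsUp]
  simp only [antisymm_rules hT, h.xi_rules, neg_mul, mul_neg, neg_neg]
  module

theorem xiContr_eq {T : Fin 4 → Fin 4 → R} (hT : ∀ a b, T b a = -T a b) :
    xiContr ψ T 0 = (4 : ℝ) • (T 1 2 * ψ (.xi 3) - T 1 3 * ψ (.xi 2) + T 2 3 * ψ (.xi 1)) ∧
    xiContr ψ T 1 = (4 : ℝ) • (-(T 0 2 * ψ (.xi 3)) + T 0 3 * ψ (.xi 2) - T 2 3 * ψ (.xi 0)) ∧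
    xiContr ψ T 2 = (4 : ℝ) • (T 0 1 * ψ (.xi 3) - T 0 3 * ψ (.xi 1) + T 1 3 * ψ (.xi 0)) ∧
    xiContr ψ T 3 = (4 : ℝ) • (-(T 0 1 * ψ (.xi 2)) + T 0 2 * ψ (.xi 1) - T 1 2 * ψ (.xi 0)) := by
  refine ⟨?_, ?_, ?_, ?_⟩ <;>
  · simp [xiContr, Fin.sum_univ_four, epsUp_eq, antisymm_rules hT, -nsmul_eq_mul]
    module

theorem betaL_eq (h : IsPoint ψ) (δ : Coord → R) (a b : Fin 4) :
    betaL ψ δ a b = xiHodge ψ (fun n m => δ (.W a b n m))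
      + ∑ p, δ (.xi p) * xiContr ψ (fun n m => ψ (.W a b n m)) p := by
  simp only [betaL, xiHodge, xiContr, smul_add, Finset.sum_add_distrib, Finset.mul_sum,
    mul_smul_comm, h.xi_xi_comm, mul_assoc]
  rw [sum_comm_three (f := fun n m p => ∑ k, epsUp n m p k • (2 : ℕ) •
    (δ (.xi p) * (ψ (.W a b n m) * ψ (.xi k))))]

theorem gammaL_eq (h : IsPoint ψ) (δ : Coord → R) (a : Fin 4) :
    gammaL ψ δ a = xiHodge ψ (fun n m => δ (.C a n m))
      + ∑ p, δ (.xi p) * xiContr ψ (fun n m => ψ (.C a n m)) p := by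
  simp only [gammaL, xiHodge, xiContr, smul_add, Finset.sum_add_distrib, Finset.mul_sum,
    mul_smul_comm, h.xi_xi_comm, mul_assoc]
  rw [sum_comm_three (f := fun n m p => ∑ k, epsUp n m p k • (2 : ℕ) •
    (δ (.xi p) * (ψ (.C a n m) * ψ (.xi k))))]

/-- A vector lies in the kernel of `ω` if its contraction with `ω` has vanishing components along
`dρ`, `dξ`, `dW` and `dC`. -/
theorem mem_kerOmega_of (h : IsPoint ψ) {δ : Coord → R} (hδ : IsTensor δ)
    (hρ : ∀ a b, xiHodge ψ (fun n m => δ (.W a b n m))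
      + ∑ p, δ (.xi p) * xiContr ψ (fun n m => ψ (.W a b n m)) p = 0)
    (hξ : ∀ p, (∑ a, ∑ b, (eta a * eta b) •
        (δ (.rho a b) * xiContr ψ (fun n m => ψ (.W a b n m)) p))
      - (2 : ℕ) • ((∑ a, eta a • (δ (.xi a) * xiContr ψ (fun n m => ψ (.C a n m)) p))
        + eta p • (xiHodge ψ (fun n m => δ (.C p n m))
          + ∑ q, δ (.xi q) * xiContr ψ (fun n m => ψ (.C p n m)) q)) = 0)
    (hW : ∀ w : Fin 4 → Fin 4 → Fin 4 → Fin 4 → R, IsWeyl w →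
      ∑ a, ∑ b, (eta a * eta b) • (δ (.rho a b) * xiHodge ψ (w a b)) = 0)
    (hC : ∀ c : Fin 4 → Fin 4 → Fin 4 → R, IsCotton c →
      ∑ a, eta a • (δ (.xi a) * xiHodge ψ (c a)) = 0) : δ ∈ kerOmega ψ := by
  refine ⟨hδ, fun δ' hδ' => ?_⟩
  have e1 := hW _ hδ'.weyl
  have e2 := hC _ hδ'.cotton
  have e3 : ∑ p, ((∑ a, ∑ b, (eta a * eta b) •
        (δ (.rho a b) * xiContr ψ (fun n m => ψ (.W a b n m)) p))
      - (2 : ℕ) • ((∑ a, eta a • (δ (.xi a) * xiContr ψ (fun n m => ψ (.C a n m)) p))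
        + eta p • (xiHodge ψ (fun n m => δ (.C p n m))
          + ∑ q, δ (.xi q) * xiContr ψ (fun n m => ψ (.C p n m)) q))) * δ' (.xi p) = 0 :=
    Finset.sum_eq_zero fun p _ => by rw [hξ, zero_mul]
  simp only [omegaF, betaR_eq, gammaR_eq, betaL_eq h, gammaL_eq h, hρ, zero_mul, add_zero]
  simp only [mul_add, smul_add, Finset.sum_add_distrib, e1, e2, zero_add]
  rw [← e3]
  simp only [sub_mul, Finset.sum_sub_distrib, smul_mul_assoc, add_mul, Finset.sum_mul,
    Finset.mul_sum, smul_add, Finset.sum_add_distrib, Finset.smul_sum, mul_assoc]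
  congr 1
  · exact sum_comm_three _
  · congr 1
    rw [Finset.sum_comm]

end Points

/-! ### The dilatation `Xtrace` lies in the kernel of `ω` -/

section KernelFields
variable {R : Type u} [Ring R] [Algebra ℝ R] [SuperAlgebra R] {ψ : Coord → R}

theorem IsPoint.W_rules (h : IsPoint ψ) (e a b c d : Fin 4) :
    ψ (.xi e) * ψ (.W a b c d) = ψ (.W a b c d) * ψ (.xi e) ∧
      ∀ y, ψ (.xi e) * (ψ (.W a b c d) * y) = ψ (.W a b c d) * (ψ (.xi e) * y) :=
  ⟨h.mul_W _ _ _ _ _, fun y => by rw [← mul_assoc, h.mul_W, mul_assoc]⟩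

theorem IsPoint.C_rules (h : IsPoint ψ) (e a b c : Fin 4) :
    ψ (.xi e) * ψ (.C a b c) = ψ (.C a b c) * ψ (.xi e) ∧
      ∀ y, ψ (.xi e) * (ψ (.C a b c) * y) = ψ (.C a b c) * (ψ (.xi e) * y) :=
  ⟨h.mul_C _ _ _ _, fun y => by rw [← mul_assoc, h.mul_C, mul_assoc]⟩

theorem xi3_eq (h : IsPoint ψ) :
    xi3 ψ 0 = -(ψ (.xi 1) * (ψ (.xi 2) * ψ (.xi 3))) ∧
    xi3 ψ 1 = -(ψ (.xi 0) * (ψ (.xi 2) * ψ (.xi 3))) ∧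
    xi3 ψ 2 = ψ (.xi 0) * (ψ (.xi 1) * ψ (.xi 3)) ∧
    xi3 ψ 3 = -(ψ (.xi 0) * (ψ (.xi 1) * ψ (.xi 2))) := by
  refine ⟨?_, ?_, ?_, ?_⟩ <;>
  · simp [xi3, Fin.sum_univ_four, epsLow, epsUp_eq, eta, xiUp, mul_assoc, h.xi_rules]
    module

theorem xi4_eq (h : IsPoint ψ) :
    xi4 ψ = ψ (.xi 0) * (ψ (.xi 1) * (ψ (.xi 2) * ψ (.xi 3))) := by
  simp [xi4, Fin.sum_univ_four, epsLow, epsUp_eq, eta, xiUp, mul_assoc, h.xi_rules]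
  module

theorem hodgeW_eq (h : IsPoint ψ) (a b : Fin 4) : xiHodge ψ (fun n m => ψ (.W a b n m)) =
    (4 : ℝ) • (ψ (.xi 2) * ψ (.xi 3) * ψ (.W a b 0 1) - ψ (.xi 1) * ψ (.xi 3) * ψ (.W a b 0 2)
      + ψ (.xi 1) * ψ (.xi 2) * ψ (.W a b 0 3) + ψ (.xi 0) * ψ (.xi 3) * ψ (.W a b 1 2)
      - ψ (.xi 0) * ψ (.xi 2) * ψ (.W a b 1 3) + ψ (.xi 0) * ψ (.xi 1) * ψ (.W a b 2 3)) :=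
  xiHodge_eq h fun c d => h.1.weyl.antisymm_right a b c d

theorem contrW_eq (h : IsPoint ψ) (a b : Fin 4) :
    xiContr ψ (fun n m => ψ (.W a b n m)) 0 =
      (4 : ℝ) • (ψ (.W a b 1 2) * ψ (.xi 3) - ψ (.W a b 1 3) * ψ (.xi 2) + ψ (.W a b 2 3) *
        ψ (.xi 1)) ∧
    xiContr ψ (fun n m => ψ (.W a b n m)) 1 =
      (4 : ℝ) • (-(ψ (.W a b 0 2) * ψ (.xi 3)) + ψ (.W a b 0 3) * ψ (.xi 2) - ψ (.W a b 2 3) *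
        ψ (.xi 0)) ∧
    xiContr ψ (fun n m => ψ (.W a b n m)) 2 =
      (4 : ℝ) • (ψ (.W a b 0 1) * ψ (.xi 3) - ψ (.W a b 0 3) * ψ (.xi 1) + ψ (.W a b 1 3) *
        ψ (.xi 0)) ∧
    xiContr ψ (fun n m => ψ (.W a b n m)) 3 =
      (4 : ℝ) • (-(ψ (.W a b 0 1) * ψ (.xi 2)) + ψ (.W a b 0 2) * ψ (.xi 1) - ψ (.W a b 1 2) *
        ψ (.xi 0)) :=
  xiContr_eq fun c d => h.1.weyl.antisymm_right a b c d

theorem hodgeC_eq (h : IsPoint ψ) (a : Fin 4) : xiHodge ψ (fun n m => ψ (.C a n m)) =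
    (4 : ℝ) • (ψ (.xi 2) * ψ (.xi 3) * ψ (.C a 0 1) - ψ (.xi 1) * ψ (.xi 3) * ψ (.C a 0 2)
      + ψ (.xi 1) * ψ (.xi 2) * ψ (.C a 0 3) + ψ (.xi 0) * ψ (.xi 3) * ψ (.C a 1 2)
      - ψ (.xi 0) * ψ (.xi 2) * ψ (.C a 1 3) + ψ (.xi 0) * ψ (.xi 1) * ψ (.C a 2 3)) :=
  xiHodge_eq h fun c d => h.1.cotton.antisymm a c d

theorem contrC_eq (h : IsPoint ψ) (a : Fin 4) :
    xiContr ψ (fun n m => ψ (.C a n m)) 0 =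
      (4 : ℝ) • (ψ (.C a 1 2) * ψ (.xi 3) - ψ (.C a 1 3) * ψ (.xi 2) + ψ (.C a 2 3) * ψ (.xi 1)) ∧
    xiContr ψ (fun n m => ψ (.C a n m)) 1 =
      (4 : ℝ) • (-(ψ (.C a 0 2) * ψ (.xi 3)) + ψ (.C a 0 3) * ψ (.xi 2) - ψ (.C a 2 3) *
        ψ (.xi 0)) ∧
    xiContr ψ (fun n m => ψ (.C a n m)) 2 =
      (4 : ℝ) • (ψ (.C a 0 1) * ψ (.xi 3) - ψ (.C a 0 3) * ψ (.xi 1) + ψ (.C a 1 3) * ψ (.xi 0)) ∧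
    xiContr ψ (fun n m => ψ (.C a n m)) 3 =
      (4 : ℝ) • (-(ψ (.C a 0 1) * ψ (.xi 2)) + ψ (.C a 0 2) * ψ (.xi 1) - ψ (.C a 1 2) *
        ψ (.xi 0)) :=
  xiContr_eq fun c d => h.1.cotton.antisymm a c d

theorem xiHodge_smul (n : ℤ) (ψ : Coord → R) (T : Fin 4 → Fin 4 → R) :
    xiHodge ψ (fun a b => n • T a b) = n • xiHodge ψ T := by
  simp only [xiHodge, Finset.smul_sum, mul_smul_comm, smul_comm n]

theorem xiHodge_zero (ψ : Coord → R) : xiHodge ψ (fun _ _ => 0) = 0 := by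
  simp [xiHodge]

theorem fieldXtrace_mem (h : IsPoint ψ) : fieldXtrace ψ ∈ kerOmega ψ := by
  refine mem_kerOmega_of h ?_ ?_ ?_ ?_ ?_
  · exact isTensor_vec (by simp) (h.1.weyl.smul (-2 : ℤ)) (IsTensor.smul (-3 : ℤ) h.1).cotton
  · intro a b
    simp only [fieldXtrace, vec, weylAt, xiHodge_smul, Fin.sum_univ_four, contrW_eq h, hodgeW_eq h,
      mul_smul_comm, mul_add, mul_sub, mul_neg, h.W_rules, h.xi_rules, mul_assoc]
    module
  · intro p
    simp only [fieldXtrace, vec, cottonAt, xiHodge_smul, hodgeC_eq h]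
    fin_cases p <;>
    · simp [Fin.sum_univ_four, contrC_eq h, mul_add, mul_sub, add_mul, sub_mul, h.C_rules,
          h.xi_rules,
        mul_assoc, eta, -nsmul_eq_mul, -zsmul_eq_mul, h.1.cotton.rules]
      module
  · intro w _; simp [fieldXtrace, vec]
  · intro c hc
    have hc' := fun a => xiHodge_eq h (T := c a) (fun n m => hc.antisymm a n m)
    simp [fieldXtrace, vec, hc', Fin.sum_univ_four, mul_add, mul_sub, mul_assoc, h.xi_rules, eta,
      hc.rules]
    module

end KernelFields

/-! ### Duals of Weyl and Cotton tensors -/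

section Duals
variable {M : Type*} [AddCommGroup M] [Module ℝ M]

theorem dual_eq {T : Fin 4 → Fin 4 → M} (hT : ∀ a b, T b a = -T a b) {D : Fin 4 → Fin 4 → M}
    (hD : ∀ c d, D c d = ∑ p, ∑ k, (eta p * eta k * epsLow p k c d) • T p k) :
    (D 0 0 = 0 ∧ D 1 1 = 0 ∧ D 2 2 = 0 ∧ D 3 3 = 0) ∧
    (D 0 1 = (-2 : ℤ) • T 2 3 ∧ D 0 2 = (2 : ℤ) • T 1 3 ∧ D 0 3 = (-2 : ℤ) • T 1 2 ∧
      D 1 2 = (2 : ℤ) • T 0 3 ∧ D 1 3 = (-2 : ℤ) • T 0 2 ∧ D 2 3 = (2 : ℤ) • T 0 1) ∧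
    (D 1 0 = (2 : ℤ) • T 2 3 ∧ D 2 0 = (-2 : ℤ) • T 1 3 ∧ D 3 0 = (2 : ℤ) • T 1 2 ∧
      D 2 1 = (-2 : ℤ) • T 0 3 ∧ D 3 1 = (2 : ℤ) • T 0 2 ∧ D 3 2 = (-2 : ℤ) • T 0 1) := by
  refine ⟨⟨?_, ?_, ?_, ?_⟩, ⟨?_, ?_, ?_, ?_, ?_, ?_⟩, ?_, ?_, ?_, ?_, ?_, ?_⟩ <;>
  · simp [hD, Fin.sum_univ_four, epsLow, epsUp_eq, eta, antisymm_rules hT, -zsmul_eq_mul]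
    try module

theorem dual4_eq {T : Fin 4 → Fin 4 → Fin 4 → Fin 4 → M} (hT : IsWeyl T) (a b : Fin 4) :
    (dual4 T a b 0 0 = 0 ∧ dual4 T a b 1 1 = 0 ∧ dual4 T a b 2 2 = 0 ∧ dual4 T a b 3 3 = 0) ∧
    (dual4 T a b 0 1 = (-2 : ℤ) • T a b 2 3 ∧ dual4 T a b 0 2 = (2 : ℤ) • T a b 1 3 ∧
      dual4 T a b 0 3 = (-2 : ℤ) • T a b 1 2 ∧
      dual4 T a b 1 2 = (2 : ℤ) • T a b 0 3 ∧ dual4 T a b 1 3 = (-2 : ℤ) • T a b 0 2 ∧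
        dual4 T a b 2 3 = (2 : ℤ) • T a b 0 1) ∧
    (dual4 T a b 1 0 = (2 : ℤ) • T a b 2 3 ∧ dual4 T a b 2 0 = (-2 : ℤ) • T a b 1 3 ∧
      dual4 T a b 3 0 = (2 : ℤ) • T a b 1 2 ∧
      dual4 T a b 2 1 = (-2 : ℤ) • T a b 0 3 ∧ dual4 T a b 3 1 = (2 : ℤ) • T a b 0 2 ∧
        dual4 T a b 3 2 = (-2 : ℤ) • T a b 0 1) :=
  dual_eq (T := T a b) (fun c d => hT.antisymm_right a b c d) (D := dual4 T a b) fun _ _ => rfl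

theorem dual3_eq {T : Fin 4 → Fin 4 → Fin 4 → M} (hT : IsCotton T) (a : Fin 4) :
    (dual3 T a 0 0 = 0 ∧ dual3 T a 1 1 = 0 ∧ dual3 T a 2 2 = 0 ∧ dual3 T a 3 3 = 0) ∧
    (dual3 T a 0 1 = (-2 : ℤ) • T a 2 3 ∧ dual3 T a 0 2 = (2 : ℤ) • T a 1 3 ∧
      dual3 T a 0 3 = (-2 : ℤ) • T a 1 2 ∧
      dual3 T a 1 2 = (2 : ℤ) • T a 0 3 ∧ dual3 T a 1 3 = (-2 : ℤ) • T a 0 2 ∧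
        dual3 T a 2 3 = (2 : ℤ) • T a 0 1) ∧
    (dual3 T a 1 0 = (2 : ℤ) • T a 2 3 ∧ dual3 T a 2 0 = (-2 : ℤ) • T a 1 3 ∧
      dual3 T a 3 0 = (2 : ℤ) • T a 1 2 ∧
      dual3 T a 2 1 = (-2 : ℤ) • T a 0 3 ∧ dual3 T a 3 1 = (2 : ℤ) • T a 0 2 ∧
        dual3 T a 3 2 = (-2 : ℤ) • T a 0 1) :=
  dual_eq (T := T a) (fun c d => hT.antisymm a c d) (D := dual3 T a) fun _ _ => rfl

theorem IsWeyl.dual4 {T : Fin 4 → Fin 4 → Fin 4 → Fin 4 → M} (hT : IsWeyl T) :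
    IsWeyl (dual4 T) where
  antisymm_left a b c d := by
    simp only [ConformalGravity.dual4, hT.antisymm_left a b, smul_neg, Finset.sum_neg_distrib]
  antisymm_right a b c d := by
    fin_cases c <;> fin_cases d <;> simp [dual4_eq hT, -zsmul_eq_mul]
  cyclic a b c d := by
    fin_cases a <;> fin_cases b <;> simp only [Fin.reduceFinMk, Fin.zero_eta, Fin.mk_one] <;>
      fin_cases c <;> fin_cases d <;>
      simp [dual4_eq hT, hT.rules, -zsmul_eq_mul] <;> module
  traceless b d := by
    fin_cases b <;> fin_cases d <;>
      simp [Fin.sum_univ_four, eta, dual4_eq hT, hT.rules, -zsmul_eq_mul] <;> module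

theorem IsCotton.dual3 {T : Fin 4 → Fin 4 → Fin 4 → M} (hT : IsCotton T) :
    IsCotton (dual3 T) where
  antisymm a b c := by
    fin_cases b <;> fin_cases c <;> simp [dual3_eq hT, -zsmul_eq_mul]
  cyclic a b c := by
    fin_cases a <;> fin_cases b <;> fin_cases c <;>
      simp [dual3_eq hT, hT.rules, -zsmul_eq_mul] <;> module
  traceless b := by
    fin_cases b <;>
      simp [Fin.sum_univ_four, eta, dual3_eq hT, hT.rules, -zsmul_eq_mul] <;> module

end Duals

/-! ### Kernel fields along `ξ` and `ρ` of high degree, and along `κ` and `λ` -/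

section KernelFields
variable {R : Type u} [Ring R] [Algebra ℝ R] [SuperAlgebra R] {ψ : Coord → R}

theorem fieldX4_mem (h : IsPoint ψ) (a : Fin 4) : kernelField (.X4 a) R ψ ∈ kerOmega ψ := by
  refine mem_kerOmega_of h ?_ ?_ ?_ ?_ ?_
  · exact isTensor_vec (by simp) IsWeyl.zero IsCotton.zero
  · intro b c
    fin_cases a <;>
    simp [kernelField, vec, xiHodge_zero, xi4_eq h, Fin.sum_univ_four, contrW_eq h, mul_add,
      mul_sub,
      h.W_rules, h.xi_rules, mul_assoc]
  · intro p
    fin_cases a <;> fin_cases p <;>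
    simp [kernelField, vec, xiHodge_zero, xi4_eq h, Fin.sum_univ_four, contrC_eq h, mul_add,
      mul_sub,
      h.C_rules, h.xi_rules, mul_assoc, eta]
  · intro w _; simp [kernelField, vec]
  · intro c hc
    have hc' := fun a => xiHodge_eq h (T := c a) (fun n m => hc.antisymm a n m)
    fin_cases a <;>
    simp [kernelField, vec, xi4_eq h, hc', Fin.sum_univ_four, mul_add, mul_sub, mul_assoc,
      h.xi_rules, eta]

theorem fieldX3_mem (h : IsPoint ψ) : kernelField .X3 R ψ ∈ kerOmega ψ := by
  refine mem_kerOmega_of h ?_ ?_ ?_ ?_ ?_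
  · exact isTensor_vec (by simp) IsWeyl.zero IsCotton.zero
  · intro b c
    simp [kernelField, vec, xiHodge_zero, xi3_eq h, Fin.sum_univ_four, contrW_eq h, mul_add,
      mul_sub,
      h.W_rules, h.xi_rules, mul_assoc]
  · intro p
    fin_cases p <;>
    simp [kernelField, vec, xiHodge_zero, xi3_eq h, Fin.sum_univ_four, contrC_eq h, mul_add,
      mul_sub,
      h.C_rules, h.xi_rules, mul_assoc, eta, h.1.cotton.rules, add_mul, sub_mul] <;> module
  · intro w _; simp [kernelField, vec]
  · intro c hc
    have hc' := fun a => xiHodge_eq h (T := c a) (fun n m => hc.antisymm a n m)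
    simp [kernelField, vec, xi3_eq h, hc', Fin.sum_univ_four, mul_add, mul_sub, mul_assoc,
      h.xi_rules, eta]

theorem fieldX2trace_mem (h : IsPoint ψ) (d : Fin 4) :
    kernelField (.X2trace d) R ψ ∈ kerOmega ψ := by
  have e : kernelField (.X2trace d) R ψ = ψ (.xi d) • (algebraMap ℝ R 2) • fieldXtrace ψ := by
    funext i
    cases i <;> simp only [kernelField, vec, fieldXtrace, Pi.smul_apply, smul_eq_mul,
      ← Algebra.smul_def, mul_smul_comm, Pi.zero_apply, mul_zero, smul_zero] <;> module
  rw [e, ← mem_kerOmegaModule]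
  exact Submodule.smul_mem _ _ (Submodule.smul_mem _ _ (fieldXtrace_mem h))

theorem fieldY4_mem (h : IsPoint ψ) (a b : Fin 4) : kernelField (.Y4 a b) R ψ ∈ kerOmega ψ := by
  have hx : ∀ (u : Fin 4) (P Q : Prop) [Decidable P] [Decidable Q] (y : R),
      ((if P then xi4 ψ else 0) - (if Q then xi4 ψ else 0)) * (ψ (.xi u) * y) = 0 := by
    intro u P Q _ _ y
    rw [xi4_eq h]
    fin_cases u <;> split_ifs <;> simp [mul_assoc, h.xi_rules]
  refine mem_kerOmega_of h ?_ ?_ ?_ ?_ ?_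
  · refine isTensor_vec (fun p q => ?_) IsWeyl.zero IsCotton.zero
    simp only [and_comm (a := q = a), and_comm (a := q = b), neg_sub]
  · intro b c
    simp [kernelField, vec, xiHodge_zero]
  · intro p
    have hx' : ∀ (u : Fin 4) (P Q : Prop) [Decidable P] [Decidable Q] a b c d,
      ((if P then xi4 ψ else 0) - (if Q then xi4 ψ else 0)) * (ψ (.W a b c d) * ψ (.xi u)) = 0 := by
      intro u P Q _ _ a b c d
      rw [← h.mul_W, hx]
    simp only [kernelField, vec, Pi.zero_apply, xiHodge_zero, xiContr, Finset.mul_sum,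
      mul_smul_comm,
      hx', smul_zero, Finset.sum_const_zero, zero_mul, add_zero, sub_zero]
  · intro w _
    simp only [kernelField, vec, xiHodge, Finset.mul_sum, mul_smul_comm, mul_assoc, hx, smul_zero,
      Finset.sum_const_zero]
  · intro c hc; simp [kernelField, vec]

theorem fieldK_mem (a : Fin 4) : kernelField (.K a) R ψ ∈ kerOmega ψ := by
  refine ⟨?_, fun δ' _ => by simp [kernelField, omegaF, betaL, gammaL]⟩
  constructor <;> intros <;> (try constructor) <;> simp [dual4, kernelField]

theorem fieldL_mem : kernelField .L R ψ ∈ kerOmega ψ := by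
  refine ⟨?_, fun δ' _ => by simp [kernelField, omegaF, betaL, gammaL]⟩
  constructor <;> intros <;> (try constructor) <;> simp [dual4, kernelField]

end KernelFields

/-! ### Divergence-free fields along `W` and `C`, and the fields `Y3` and `Ytrace` -/

section KernelFields
variable {R : Type u} [Ring R] [Algebra ℝ R] [SuperAlgebra R] {ψ : Coord → R}

/-- The divergence of a family of two-forms is what survives in `T_{nm|e} ε^{nmpk} ξ_p ξ_k ξ^e`. -/
theorem xiHodge_divFree (h : IsPoint ψ) {T : Fin 4 → Fin 4 → Fin 4 → ℝ}
    (hT : ∀ n m e, T m n e = -T n m e) (hd : ∀ m, ∑ e, eta e • T e m e = 0) :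
    xiHodge ψ (fun n m => ∑ e, T n m e • xiUp ψ e) = 0 := by
  rw [xiHodge_eq h fun n m => by simp only [hT n m, neg_smul, Finset.sum_neg_distrib]]
  have hR := fun e => antisymm_rules fun n m => hT n m e
  have d0 := hd 0
  have d1 := hd 1
  have d2 := hd 2
  have d3 := hd 3
  simp [Fin.sum_univ_four, eta, hR] at d0 d1 d2 d3
  simp [Fin.sum_univ_four, xiUp, eta, mul_add, mul_assoc, h.xi_rules]
  linear_combination (norm := module)
    (-4 * d0) • (ψ (.xi 1) * (ψ (.xi 2) * ψ (.xi 3)))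
    + (4 * d1) • (ψ (.xi 0) * (ψ (.xi 2) * ψ (.xi 3)))
    - (4 * d2) • (ψ (.xi 0) * (ψ (.xi 1) * ψ (.xi 3)))
    + (4 * d3) • (ψ (.xi 0) * (ψ (.xi 1) * ψ (.xi 2)))

theorem fieldZW_mem (h : IsPoint ψ) (S : WeylDivFree) : kernelField (.ZW S) R ψ ∈ kerOmega ψ := by
  obtain ⟨S, hS, hd⟩ := S
  have hw : IsWeyl fun a b c d => ∑ e, S a b c d e • xiUp ψ e := by
    simp only [Fin.sum_univ_four]
    have hs := fun e => (hS e).map (LinearMap.toSpanSingleton ℝ R (xiUp ψ e)).toAddMonoidHom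
    exact (((hs 0).add (hs 1)).add (hs 2)).add (hs 3)
  refine mem_kerOmega_of h (isTensor_vec (by simp) hw IsCotton.zero) ?_ ?_ ?_ ?_
  · intro a b
    have hP := fun c d (e : Fin 4) => (hS e).pair_symm a b c d
    have e := xiHodge_divFree h (T := fun n m e => S a b n m e)
      (fun n m e => (hS e).antisymm_right a b n m) fun m => by simpa only [hP] using hd m a b
    simpa [kernelField, vec] using e
  · intro p
    simp [kernelField, vec, xiHodge_zero]
  · intro w _; simp [kernelField, vec]
  · intro w _; simp [kernelField, vec]

theorem fieldZC_mem (h : IsPoint ψ) (S : CottonDivFree) : kernelField (.ZC S) R ψ ∈ kerOmega ψ := by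
  obtain ⟨S, hS, hd⟩ := S
  have hc : IsCotton fun a b c => ∑ e, S a b c e • xiUp ψ e := by
    simp only [Fin.sum_univ_four]
    have hs := fun e => (hS e).map (LinearMap.toSpanSingleton ℝ R (xiUp ψ e)).toAddMonoidHom
    exact (((hs 0).add (hs 1)).add (hs 2)).add (hs 3)
  refine mem_kerOmega_of h (isTensor_vec (by simp) IsWeyl.zero hc) ?_ ?_ ?_ ?_
  · intro a b
    simp [kernelField, vec, xiHodge_zero]
  · intro p
    have e := xiHodge_divFree h (T := fun n m e => S p n m e)
      (fun n m e => (hS e).antisymm p n m) fun m => by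
        rw [← neg_eq_zero, ← hd p m, ← Finset.sum_neg_distrib]
        exact Finset.sum_congr rfl fun e _ => by rw [(hS e).antisymm p e m, smul_neg]
    simp [kernelField, vec, e]
  · intro w _; simp [kernelField, vec]
  · intro w _; simp [kernelField, vec]

theorem sum_antisymm {r t : Fin 4 → Fin 4 → R} (hr : ∀ a b, r b a = -r a b)
    (ht : ∀ a b, t b a = -t a b) :
    ∑ a, ∑ b, (eta a * eta b) • (r a b * t a b) =
      (2 : ℝ) • (-(r 0 1 * t 0 1) - r 0 2 * t 0 2 - r 0 3 * t 0 3 + r 1 2 * t 1 2 + r 1 3 * t 1 3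
        + r 2 3 * t 2 3) := by
  simp [Fin.sum_univ_four, eta, antisymm_rules hr, antisymm_rules ht]
  module

theorem contrW_antisymm (h : IsPoint ψ) (p a b : Fin 4) :
    xiContr ψ (fun n m => ψ (.W b a n m)) p = -xiContr ψ (fun n m => ψ (.W a b n m)) p := by
  simp only [xiContr, h.1.weyl.antisymm_left a b, neg_mul, smul_neg, Finset.sum_neg_distrib]

theorem hodge_antisymm {w : Fin 4 → Fin 4 → Fin 4 → Fin 4 → R} (hw : IsWeyl w) (a b : Fin 4) :
    xiHodge ψ (w b a) = -xiHodge ψ (w a b) := by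
  simp only [xiHodge, hw.antisymm_left a b, mul_neg, smul_neg, Finset.sum_neg_distrib]

set_option maxHeartbeats 2000000 in
theorem fieldY3_mem (h : IsPoint ψ) (l : Fin 4) : kernelField (.Y3 l) R ψ ∈ kerOmega ψ := by
  refine mem_kerOmega_of h ?_ ?_ ?_ ?_ ?_
  · exact isTensor_vec (fun p q => by abel) IsWeyl.zero IsCotton.zero
  · intro b c
    simp [kernelField, vec, xiHodge_zero]
  · intro p
    simp only [kernelField, vec, xiHodge_zero, Pi.zero_apply]
    rw [sum_antisymm (fun p q => by abel) (contrW_antisymm h p)]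
    fin_cases l <;> fin_cases p <;>
    simp [xi3_eq h, Fin.sum_univ_four, contrW_eq h, mul_add, mul_sub,
      h.W_rules, h.xi_rules, mul_assoc, eta, h.1.weyl.rules, add_mul, sub_mul, -nsmul_eq_mul,
        -zsmul_eq_mul] <;> module
  · intro w hw
    have hw' := fun a b => xiHodge_eq h (T := w a b) (fun n m => hw.antisymm_right a b n m)
    simp only [kernelField, vec]
    rw [sum_antisymm (fun p q => by abel) (hodge_antisymm hw)]
    fin_cases l <;>
    simp [kernelField, vec, xi3_eq h, hw', Fin.sum_univ_four, mul_add, mul_sub, mul_assoc,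
      h.xi_rules, eta]
  · intro c hc; simp [kernelField, vec]

/-- A Weyl tensor with its second index fixed is a Cotton tensor. -/
theorem isCotton_of_isWeyl {M : Type*} [AddCommGroup M] [Module ℝ M]
    {T : Fin 4 → Fin 4 → Fin 4 → Fin 4 → M} (hT : IsWeyl T)
    (d : Fin 4) : IsCotton fun a b c => T a d b c where
  antisymm a b c := hT.antisymm_right a d b c
  cyclic a b c := by
    have := hT.cyclic d a b c
    rw [hT.antisymm_left a d, hT.antisymm_left b d, hT.antisymm_left c d] at this
    rw [← neg_eq_zero, ← this]; abel
  traceless b := by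
    have := hT.traceless d b
    rw [← neg_eq_zero, ← this, ← Finset.sum_neg_distrib]
    exact Finset.sum_congr rfl fun a _ => by rw [hT.antisymm_right a d b a, smul_neg]

set_option maxHeartbeats 2000000 in
theorem fieldYtrace_mem (h : IsPoint ψ) (d : Fin 4) : kernelField (.Ytrace d) R ψ ∈ kerOmega ψ := by
  refine mem_kerOmega_of h ?_ ?_ ?_ ?_ ?_
  · exact isTensor_vec (fun p q => by abel) IsWeyl.zero (isCotton_of_isWeyl h.1.weyl d)
  · intro b c
    simp [kernelField, vec, fieldYtrace, xiHodge_zero]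
  · intro p
    simp only [kernelField, vec, fieldYtrace, weylAt, hodgeW_eq h, Pi.zero_apply]
    rw [sum_antisymm (fun p q => by abel) (contrW_antisymm h p)]
    simp only [etaMat]
    fin_cases d <;> fin_cases p <;>
    simp [Fin.sum_univ_four, contrW_eq h, mul_add, mul_sub,
      h.W_rules, h.xi_rules, mul_assoc, eta, h.1.weyl.rules, add_mul, sub_mul, -nsmul_eq_mul,
        -zsmul_eq_mul] <;> module
  · intro w hw
    have hw' := fun a b => xiHodge_eq h (T := w a b) (fun n m => hw.antisymm_right a b n m)
    simp only [kernelField, vec, fieldYtrace]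
    rw [sum_antisymm (fun p q => by abel) (hodge_antisymm hw)]
    simp only [hw', etaMat]
    fin_cases d <;>
    simp [Fin.sum_univ_four, mul_add, mul_sub, add_mul, sub_mul, mul_assoc, h.xi_rules, eta,
      hw.rules, -nsmul_eq_mul, -zsmul_eq_mul] <;> module
  · intro c hc; simp [kernelField, vec, fieldYtrace]

end KernelFields

/-! ### The field `Yant` lies in the kernel of `ω` -/

section KernelFields
variable {R : Type u} [Ring R] [Algebra ℝ R] [SuperAlgebra R] {ψ : Coord → R}

theorem sum_epsLow_xiUp (ψ : Coord → R) :
    (∑ c, epsLow 0 1 c 0 • xiUp ψ c) = 0 ∧ (∑ c, epsLow 0 2 c 0 • xiUp ψ c) = 0 ∧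
    (∑ c, epsLow 0 3 c 0 • xiUp ψ c) = 0 ∧ (∑ c, epsLow 1 2 c 0 • xiUp ψ c) = ψ (.xi 3) ∧
    (∑ c, epsLow 1 3 c 0 • xiUp ψ c) = -ψ (.xi 2) ∧ (∑ c, epsLow 2 3 c 0 • xiUp ψ c) = ψ (.xi 1) ∧
    (∑ c, epsLow 0 1 c 1 • xiUp ψ c) = 0 ∧ (∑ c, epsLow 0 2 c 1 • xiUp ψ c) = -ψ (.xi 3) ∧
    (∑ c, epsLow 0 3 c 1 • xiUp ψ c) = ψ (.xi 2) ∧ (∑ c, epsLow 1 2 c 1 • xiUp ψ c) = 0 ∧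
    (∑ c, epsLow 1 3 c 1 • xiUp ψ c) = 0 ∧ (∑ c, epsLow 2 3 c 1 • xiUp ψ c) = ψ (.xi 0) ∧
    (∑ c, epsLow 0 1 c 2 • xiUp ψ c) = ψ (.xi 3) ∧ (∑ c, epsLow 0 2 c 2 • xiUp ψ c) = 0 ∧
    (∑ c, epsLow 0 3 c 2 • xiUp ψ c) = -ψ (.xi 1) ∧ (∑ c, epsLow 1 2 c 2 • xiUp ψ c) = 0 ∧
    (∑ c, epsLow 1 3 c 2 • xiUp ψ c) = -ψ (.xi 0) ∧ (∑ c, epsLow 2 3 c 2 • xiUp ψ c) = 0 ∧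
    (∑ c, epsLow 0 1 c 3 • xiUp ψ c) = -ψ (.xi 2) ∧ (∑ c, epsLow 0 2 c 3 • xiUp ψ c) = ψ (.xi 1) ∧
    (∑ c, epsLow 0 3 c 3 • xiUp ψ c) = 0 ∧ (∑ c, epsLow 1 2 c 3 • xiUp ψ c) = ψ (.xi 0) ∧
    (∑ c, epsLow 1 3 c 3 • xiUp ψ c) = 0 ∧ (∑ c, epsLow 2 3 c 3 • xiUp ψ c) = 0 := by
  refine ⟨?_, ?_, ?_, ?_, ?_, ?_, ?_, ?_, ?_, ?_, ?_, ?_, ?_, ?_, ?_, ?_, ?_, ?_, ?_, ?_, ?_, ?_,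
    ?_, ?_⟩ <;>
  simp [Fin.sum_univ_four, epsLow, epsUp_eq, xiUp, eta]

theorem sum_epsLow_antisymm {R : Type*} [Ring R] (ψ : Coord → R) (a b d : Fin 4) :
    ∑ c, epsLow b a c d • xiUp ψ c = -∑ c, epsLow a b c d • xiUp ψ c := by
  rw [← Finset.sum_neg_distrib]
  refine Finset.sum_congr rfl fun c _ => ?_
  rw [← neg_smul]
  congr 1
  simp only [epsLow, epsUp_eq]
  fin_cases a <;> fin_cases b <;> fin_cases c <;> fin_cases d <;> rfl

/-- The component of `Yant` along `C` is half of a component of the dual of `W`, by the cyclic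
identity. -/
theorem sum_eps_weyl {T : Fin 4 → Fin 4 → Fin 4 → Fin 4 → R} (hT : IsWeyl T) (a b c d : Fin 4) :
    ∑ n, ∑ m, (eta b * eta c * epsUp n m b c) • T d n m a = (1 / 2 : ℝ) • dual4 T a d b c := by
  have heta : ∀ a, eta a * eta a = 1 := by decide
  have h1 : ∑ n, ∑ m, (eta b * eta c * epsUp n m b c) • T d n m a =
      ∑ n, ∑ m, (eta b * eta c * epsUp n m b c) • -T d m n a := by
    rw [Finset.sum_comm]
    refine Finset.sum_congr rfl fun n _ => Finset.sum_congr rfl fun m _ => ?_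
    rw [smul_neg, ← neg_smul]
    congr 1
    simp only [epsUp_eq]
    fin_cases n <;> fin_cases m <;> fin_cases b <;> fin_cases c <;> rfl
  have h2 : dual4 T a d b c = ∑ n, ∑ m, (eta b * eta c * epsUp n m b c) • T d n m a
      + ∑ n, ∑ m, (eta b * eta c * epsUp n m b c) • -T d m n a := by
    simp only [dual4, ← Finset.sum_add_distrib, ← smul_add]
    refine Finset.sum_congr rfl fun n _ => Finset.sum_congr rfl fun m _ => ?_
    have h3 := hT.cyclic d a n m
    have h4 : T a d n m = T d n m a + -T d m n a := by
      rw [hT.antisymm_left d a, hT.antisymm_right d m a n]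
      linear_combination (norm := module) (-1 : ℝ) • h3
    rw [h4, epsLow]
    congr 1
    linear_combination (eta m * eta m * eta b * eta c * epsUp n m b c) * heta n
      + (eta b * eta c * epsUp n m b c) * heta m
  rw [h2, ← h1]
  module

set_option maxHeartbeats 2000000 in
theorem fieldYant_mem (h : IsPoint ψ) (d : Fin 4) : kernelField (.Yant d) R ψ ∈ kerOmega ψ := by
  have hr := fun a b => sum_epsLow_antisymm ψ a b d
  refine mem_kerOmega_of h ?_ ?_ ?_ ?_ ?_
  · refine isTensor_vec hr IsWeyl.zero ?_
    simp only [sum_eps_weyl (T := weylAt ψ) h.1.weyl]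
    exact (isCotton_of_isWeyl h.1.weyl.dual4 d).map
      (LinearMap.lsmul ℝ R (1 / 2 : ℝ)).toAddMonoidHom
  · intro b c
    simp [kernelField, vec, fieldYant, xiHodge_zero]
  · intro p
    simp only [kernelField, vec, fieldYant, sum_eps_weyl (T := weylAt ψ) h.1.weyl, Pi.zero_apply]
    rw [sum_antisymm hr (contrW_antisymm h p), xiHodge_eq h fun n m => by
      rw [(IsWeyl.dual4 (T := weylAt ψ) h.1.weyl).antisymm_right p d n m, smul_neg]]
    have D := dual4_eq (T := weylAt ψ) h.1.weyl
    fin_cases d <;> simp [sum_epsLow_xiUp ψ, D, -nsmul_eq_mul, -zsmul_eq_mul] <;> fin_cases p <;>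
    simp [contrW_eq h, mul_add, mul_sub, weylAt,
      h.W_rules, h.xi_rules, mul_assoc, eta, h.1.weyl.rules, add_mul, sub_mul,
      -nsmul_eq_mul, -zsmul_eq_mul] <;> module
  · intro w hw
    have hw' := fun a b => xiHodge_eq h (T := w a b) (fun n m => hw.antisymm_right a b n m)
    simp only [kernelField, vec, fieldYant]
    rw [sum_antisymm hr (hodge_antisymm hw)]
    fin_cases d <;> simp [sum_epsLow_xiUp ψ, hw', -nsmul_eq_mul, -zsmul_eq_mul] <;>
    simp [mul_add, mul_sub, mul_assoc, h.xi_rules, hw.rules, -nsmul_eq_mul, -zsmul_eq_mul] <;>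
      module
  · intro c hc; simp [kernelField, vec, fieldYant]

end KernelFields

/-! ### The field `X2ant` lies in the kernel of `ω` -/

section KernelFields
variable {R : Type u} [Ring R] [Algebra ℝ R] [SuperAlgebra R] {ψ : Coord → R}

/-- The component of `X⁽²ᵃⁿᵗ⁾_d` along `C` is a Cotton tensor. -/
theorem isCotton_fieldX2ant (x : Fin 4 → R) {U : Fin 4 → Fin 4 → Fin 4 → R} (hU : IsCotton U)
    (d : Fin 4) : IsCotton fun a b c =>
      (-2 : ℝ) • (x d * U a b c) + (1 / 2 : ℝ) • (x a * U d b c)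
      + (1 / 4 : ℝ) • (x b * U d a c - x c * U d a b)
      + (1 / 4 : ℝ) • ∑ e, (etaMat a b • ((eta e • x e) * U d c e)
            - etaMat a c • ((eta e • x e) * U d b e)) where
  antisymm a b c := by
    simp only [hU.antisymm _ b c, Finset.sum_sub_distrib, mul_neg]
    module
  cyclic a b c := by
    have e1 : ∀ a b, etaMat b a = etaMat a b := by decide
    have e2 := hU.cyclic a b c
    have e3 : U a b c = - U b c a - U c a b := by rw [← sub_eq_zero, ← e2]; abel
    simp only [Finset.sum_sub_distrib, ← Finset.smul_sum, e1 a b, e1 b c, e1 a c, e3,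
      hU.antisymm d a b,
      hU.antisymm d b c, hU.antisymm d a c, mul_neg, mul_sub]
    module
  traceless b := by
    have e2 : ∑ a, eta a • ((-2 : ℝ) • (x d * U a b a)) = 0 := by
      simp only [smul_comm _ (-2 : ℝ), ← mul_smul_comm, ← Finset.smul_sum, ← Finset.mul_sum,
        hU.traceless, mul_zero, smul_zero]
    simp only [add_assoc, smul_add (eta _) ((-2 : ℝ) • _)]
    rw [Finset.sum_add_distrib, e2, zero_add]
    have hd := antisymm_rules fun b c => hU.antisymm d b c
    fin_cases b <;>
    simp [Fin.sum_univ_four, hd, eta, etaMat] <;> module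

theorem sum_epsLow_xiUp_xiUp (h : IsPoint ψ) :
    (∑ b, ∑ c, epsLow 0 b c 0 • (xiUp ψ b * xiUp ψ c)) = 0 ∧
    (∑ b, ∑ c, epsLow 1 b c 0 • (xiUp ψ b * xiUp ψ c)) = (2 : ℝ) • (ψ (.xi 2) * ψ (.xi 3)) ∧
    (∑ b, ∑ c, epsLow 2 b c 0 • (xiUp ψ b * xiUp ψ c)) = (-2 : ℝ) • (ψ (.xi 1) * ψ (.xi 3)) ∧
    (∑ b, ∑ c, epsLow 3 b c 0 • (xiUp ψ b * xiUp ψ c)) = (2 : ℝ) • (ψ (.xi 1) * ψ (.xi 2)) ∧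
    (∑ b, ∑ c, epsLow 0 b c 1 • (xiUp ψ b * xiUp ψ c)) = (-2 : ℝ) • (ψ (.xi 2) * ψ (.xi 3)) ∧
    (∑ b, ∑ c, epsLow 1 b c 1 • (xiUp ψ b * xiUp ψ c)) = 0 ∧
    (∑ b, ∑ c, epsLow 2 b c 1 • (xiUp ψ b * xiUp ψ c)) = (-2 : ℝ) • (ψ (.xi 0) * ψ (.xi 3)) ∧
    (∑ b, ∑ c, epsLow 3 b c 1 • (xiUp ψ b * xiUp ψ c)) = (2 : ℝ) • (ψ (.xi 0) * ψ (.xi 2)) ∧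
    (∑ b, ∑ c, epsLow 0 b c 2 • (xiUp ψ b * xiUp ψ c)) = (2 : ℝ) • (ψ (.xi 1) * ψ (.xi 3)) ∧
    (∑ b, ∑ c, epsLow 1 b c 2 • (xiUp ψ b * xiUp ψ c)) = (2 : ℝ) • (ψ (.xi 0) * ψ (.xi 3)) ∧
    (∑ b, ∑ c, epsLow 2 b c 2 • (xiUp ψ b * xiUp ψ c)) = 0 ∧
    (∑ b, ∑ c, epsLow 3 b c 2 • (xiUp ψ b * xiUp ψ c)) = (-2 : ℝ) • (ψ (.xi 0) * ψ (.xi 1)) ∧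
    (∑ b, ∑ c, epsLow 0 b c 3 • (xiUp ψ b * xiUp ψ c)) = (-2 : ℝ) • (ψ (.xi 1) * ψ (.xi 2)) ∧
    (∑ b, ∑ c, epsLow 1 b c 3 • (xiUp ψ b * xiUp ψ c)) = (-2 : ℝ) • (ψ (.xi 0) * ψ (.xi 2)) ∧
    (∑ b, ∑ c, epsLow 2 b c 3 • (xiUp ψ b * xiUp ψ c)) = (2 : ℝ) • (ψ (.xi 0) * ψ (.xi 1)) ∧
    (∑ b, ∑ c, epsLow 3 b c 3 • (xiUp ψ b * xiUp ψ c)) = 0 := by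
  refine ⟨?_, ?_, ?_, ?_, ?_, ?_, ?_, ?_, ?_, ?_, ?_, ?_, ?_, ?_, ?_, ?_⟩ <;>
  simp [Fin.sum_univ_four, epsLow, epsUp_eq, xiUp, eta, h.xi_rules] <;> module


set_option maxHeartbeats 2000000 in
theorem fieldX2ant_mem (h : IsPoint ψ) (d : Fin 4) : kernelField (.X2ant d) R ψ ∈ kerOmega ψ := by
  have hU := IsCotton.dual3 (T := cottonAt ψ) h.1.cotton
  have hC := isCotton_fieldX2ant (fun a => ψ (.xi a)) hU d
  have D4 := dual4_eq (T := weylAt ψ) h.1.weyl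
  have D3 := dual3_eq (T := cottonAt ψ) h.1.cotton
  have hW := ((IsWeyl.dual4 (T := weylAt ψ) h.1.weyl).map (AddMonoidHom.mulLeft (ψ (.xi d)))).smul
    (-1 : ℤ)
  have hW' : IsWeyl fun a b n m => -(ψ (.xi d) * dual4 (weylAt ψ) a b n m) := by
    simpa using hW
  refine mem_kerOmega_of h (isTensor_vec (by simp) hW' hC) ?_ ?_ ?_ ?_
  · intro a b
    simp only [kernelField, vec, fieldX2ant]
    rw [xiHodge_eq h (hW'.antisymm_right a b)]
    rw [Fin.sum_univ_four]
    fin_cases d <;> simp [sum_epsLow_xiUp_xiUp h, D4, -nsmul_eq_mul, -zsmul_eq_mul] <;>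
    simp [contrW_eq h, mul_add, mul_sub, weylAt, h.W_rules, h.xi_rules, mul_assoc,
      -nsmul_eq_mul, -zsmul_eq_mul] <;> module
  · intro p
    rw [xiHodge_eq h (T := fun n m => kernelField (.X2ant d) R ψ (.C p n m)) (hC.antisymm p)]
    simp only [kernelField, vec, fieldX2ant, Pi.zero_apply, zero_mul, smul_zero,
      Finset.sum_const_zero, zero_sub]
    have hx := sum_epsLow_xiUp_xiUp h
    obtain ⟨x, hx'⟩ : ∃ x : Fin 4 → Fin 4 → R, ∀ a d,
      ∑ b, ∑ c, epsLow a b c d • (xiUp ψ b * xiUp ψ c) = x a d := ⟨_, fun _ _ => rfl⟩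
    simp only [hx'] at hx ⊢
    clear hx' hW hW' D4
    fin_cases d <;> simp [Fin.sum_univ_four, hx, etaMat, xiUp, -nsmul_eq_mul, -zsmul_eq_mul] <;>
    fin_cases p <;>
    simp [contrC_eq h, D3, eta, cottonAt, mul_add, mul_sub, add_mul, sub_mul, h.C_rules, h.xi_rules,
      mul_assoc, h.1.cotton.rules, -nsmul_eq_mul, -zsmul_eq_mul] <;> module
  · intro w _; simp [kernelField, vec, fieldX2ant]
  · intro c hc
    have hc' := fun a => xiHodge_eq h (T := c a) (fun n m => hc.antisymm a n m)
    simp only [kernelField, vec, fieldX2ant]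
    rw [Fin.sum_univ_four]
    fin_cases d <;> simp [sum_epsLow_xiUp_xiUp h, hc', eta, -nsmul_eq_mul, -zsmul_eq_mul] <;>
    simp [mul_add, mul_sub, mul_assoc, h.xi_rules, hc.rules, -nsmul_eq_mul, -zsmul_eq_mul] <;>
      module

end KernelFields

/-! ### The kernel vector fields lie in the kernel of `ω` -/

theorem kernelField_mem (α : KernelLabel) {R : Type u} [Ring R] [Algebra ℝ R] [SuperAlgebra R]
    {ψ : Coord → R} (h : IsPoint ψ) : kernelField α R ψ ∈ kerOmega ψ := by
  cases α with
  | X4 a => exact fieldX4_mem h a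
  | X3 => exact fieldX3_mem h
  | X2ant d => exact fieldX2ant_mem h d
  | X2trace d => exact fieldX2trace_mem h d
  | Xtrace => exact fieldXtrace_mem h
  | Y4 a b => exact fieldY4_mem h a b
  | Y3 l => exact fieldY3_mem h l
  | Y2ant l d => exact (kerOmegaModule ψ).smul_mem (ψ (.xi l)) (fieldYant_mem h d)
  | Y2trace l d => exact (kerOmegaModule ψ).smul_mem (ψ (.xi l)) (fieldYtrace_mem h d)
  | Yant d => exact fieldYant_mem h d
  | Ytrace d => exact fieldYtrace_mem h d
  | K a => exact fieldK_mem a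
  | L => exact fieldL_mem
  | ZW S => exact fieldZW_mem h S
  | ZC S => exact fieldZC_mem h S

/-! ### The components along `ξ` of a vector in the kernel -/

theorem IsCotton.of_int {R : Type*} [Ring R] {T : Fin 4 → Fin 4 → Fin 4 → ℤ} (hT : IsCotton T) :
    IsCotton fun a b c => (T a b c : R) := hT.map (Int.castAddHom R)

/-- The Cotton tensor with components `T_{abc} = T_{bac} = 1` and their consequences, for pairwise
different indices `a`, `b`, `c`. -/
def cottonMixed (a b c x y z : Fin 4) : ℤ :=
  (if x = a ∧ y = b ∧ z = c then 1 else 0) - (if x = a ∧ y = c ∧ z = b then 1 else 0)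
    + (if x = b ∧ y = a ∧ z = c then 1 else 0) - (if x = b ∧ y = c ∧ z = a then 1 else 0)

/-- The Cotton tensor with components `T_{aab} = η_a` and `T_{ccb} = -η_c` and their consequences,
for pairwise different indices `a`, `b`, `c`. -/
def cottonTrace (a b c x y z : Fin 4) : ℤ :=
  eta a * ((if x = a ∧ y = a ∧ z = b then 1 else 0) - (if x = a ∧ y = b ∧ z = a then 1 else 0))
    - eta c * ((if x = c ∧ y = c ∧ z = b then 1 else 0) - (if x = c ∧ y = b ∧ z = c then 1 else 0))

theorem isCotton_cottonMixed : ∀ a b c : Fin 4, a ≠ b → a ≠ c → b ≠ c →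
    IsCotton (cottonMixed a b c) := fun a b c hab hac hbc =>
  ⟨by revert a b c; decide, by revert a b c; decide, by revert a b c; decide⟩

theorem isCotton_cottonTrace : ∀ a b c : Fin 4, a ≠ b → a ≠ c → b ≠ c →
    IsCotton (cottonTrace a b c) := fun a b c hab hac hbc =>
  ⟨by revert a b c; decide, by revert a b c; decide, by revert a b c; decide⟩

section
variable {R : Type u} [Ring R] [Algebra ℝ R] [SuperAlgebra R] {ψ : Coord → R}

/-- The contraction of `x_a ∂/∂ξ_a` with `ω` vanishes on the constant vectors along `C`. -/
def IsCottonNull (ψ : Coord → R) (x : Fin 4 → R) : Prop :=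
  ∀ c : Fin 4 → Fin 4 → Fin 4 → ℝ, IsCotton c →
    ∑ a, eta a • (x a * xiHodge ψ fun n m => algebraMap ℝ R (c a n m)) = 0

/-- The contraction of `ρ_{ab} ∂/∂ρ_{ab}` with `ω` vanishes on the constant vectors along `W`. -/
def IsWeylNull (ψ : Coord → R) (ρ : Fin 4 → Fin 4 → R) : Prop :=
  ∀ w : Fin 4 → Fin 4 → Fin 4 → Fin 4 → ℝ, IsWeyl w → ∑ a, ∑ b,
    (eta a * eta b) • (ρ a b * xiHodge ψ fun n m => algebraMap ℝ R (w a b n m)) = 0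

theorem isCottonNull_of_omegaF {δ : Coord → R}
    (h : ∀ c : Fin 4 → Fin 4 → Fin 4 → ℝ, IsCotton c →
      omegaF ψ δ (vec 0 0 0 fun a n m => algebraMap ℝ R (c a n m)) = 0) :
    IsCottonNull ψ fun a => δ (.xi a) := fun c hc => by
  have h1 := h c hc
  simp only [omegaF, betaR_eq, gammaR_eq, vec, Pi.zero_apply, mul_zero, Finset.sum_const_zero,
    add_zero, xiHodge_zero, smul_zero, zero_sub, neg_eq_zero] at h1
  rw [← Nat.cast_smul_eq_nsmul ℝ] at h1
  exact (smul_eq_zero.mp h1).resolve_left (by norm_num)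

theorem isWeylNull_of_omegaF {δ : Coord → R}
    (h : ∀ w : Fin 4 → Fin 4 → Fin 4 → Fin 4 → ℝ, IsWeyl w →
      omegaF ψ δ (vec 0 0 (fun a b n m => algebraMap ℝ R (w a b n m)) 0) = 0) :
    IsWeylNull ψ fun a b => δ (.rho a b) := fun w hw => by
  simpa only [omegaF, betaR_eq, gammaR_eq, vec, Pi.zero_apply, mul_zero, Finset.sum_const_zero,
    add_zero, xiHodge_zero, smul_zero, sub_zero] using h w hw

set_option maxHeartbeats 1000000 in
/-- The vanishing of the contraction on the tensors `cottonTrace` and `cottonMixed`. -/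
theorem xi_relations (hψ : IsPoint ψ) {x : Fin 4 → R} (hx : IsCottonNull ψ x)
    (a b c d : Fin 4) (hab : a ≠ b) (had : a ≠ d) (hbd : b ≠ d) (hac : a ≠ c) (hbc : b ≠ c)
    (hdc : d ≠ c) :
    x a * (ψ (.xi b) * ψ (.xi c)) = -(x b * (ψ (.xi a) * ψ (.xi c))) ∧
    eta a • (x a * (ψ (.xi a) * ψ (.xi c))) = eta b • (x b * (ψ (.xi b) * ψ (.xi c))) := by
  have c1 := (isCotton_cottonMixed a b d hab had hbd).of_int (R := R)
  have c2 := (isCotton_cottonTrace a d b had hab hbd.symm).of_int (R := R)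
  have h1 := hx _ (isCotton_cottonMixed a b d hab had hbd).of_int
  have h2 := hx _ (isCotton_cottonTrace a d b had hab hbd.symm).of_int
  simp only [map_intCast] at h1 h2
  simp only [xiHodge_eq hψ (c1.antisymm _)] at h1
  simp only [xiHodge_eq hψ (c2.antisymm _)] at h2
  rw [Fin.sum_univ_four] at h1 h2
  clear c1 c2 hx
  constructor
  · clear h1
    fin_cases a <;> fin_cases b <;> simp at hab <;>
    fin_cases d <;> simp at had hbd <;> fin_cases c <;> simp at hac hbc hdc <;>
    · simp [cottonTrace, eta, hψ.xi_rules] at h2 ⊢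
      first
      | linear_combination (norm := module) (1 / 4 : ℝ) • h2
      | linear_combination (norm := module) (-1 / 4 : ℝ) • h2
  · clear h2
    fin_cases a <;> fin_cases b <;> simp at hab <;>
    fin_cases d <;> simp at had hbd <;> fin_cases c <;> simp at hac hbc hdc <;>
    · simp [cottonMixed, eta, hψ.xi_rules] at h1 ⊢
      first
      | linear_combination (norm := module) (1 / 4 : ℝ) • h1
      | linear_combination (norm := module) (-1 / 4 : ℝ) • h1
end

section
variable {Λ : Type u} [Ring Λ] [Algebra ℝ Λ] [SuperAlgebra Λ]

theorem thetaExt_ext_iff (x y : ThetaExt Λ) : x = y ↔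
  (x.1.1.1.1 = y.1.1.1.1 ∧ x.1.1.1.2 = y.1.1.1.2 ∧ x.1.1.2.1 = y.1.1.2.1 ∧ x.1.1.2.2 = y.1.1.2.2 ∧
   x.1.2.1.1 = y.1.2.1.1 ∧ x.1.2.1.2 = y.1.2.1.2 ∧ x.1.2.2.1 = y.1.2.2.1 ∧ x.1.2.2.2 = y.1.2.2.2) ∧
  (x.2.1.1.1 = y.2.1.1.1 ∧ x.2.1.1.2 = y.2.1.1.2 ∧ x.2.1.2.1 = y.2.1.2.1 ∧ x.2.1.2.2 = y.2.1.2.2 ∧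
   x.2.2.1.1 = y.2.2.1.1 ∧ x.2.2.1.2 = y.2.2.1.2 ∧ x.2.2.2.1 = y.2.2.2.1 ∧ x.2.2.2.2 = y.2.2.2.2) :=
     by
  refine ⟨fun h => by subst h; simp, fun h => ?_⟩
  obtain ⟨⟨h1,h2,h3,h4,h5,h6,h7,h8⟩,k1,k2,k3,k4,k5,k6,k7,k8⟩ := h
  exact OddExt.ext' (OddExt.ext' (OddExt.ext' (OddExt.ext' h1 h2) (OddExt.ext' h3 h4))
    (OddExt.ext' (OddExt.ext' h5 h6) (OddExt.ext' h7 h8)))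
    (OddExt.ext' (OddExt.ext' (OddExt.ext' k1 k2) (OddExt.ext' k3 k4))
    (OddExt.ext' (OddExt.ext' k5 k6) (OddExt.ext' k7 k8)))

set_option maxHeartbeats 1000000 in
/-- If `ξ_a = θ_a`, components along `ξ` whose contraction with `ω` vanishes on the constant vectors
along `C` are those of a combination of the fields `Xtrace` and `X2ant`. -/
theorem exists_xi_coefficients {ψ : Coord → ThetaExt Λ} (hψ : IsPoint ψ)
    (hθ : ∀ a, ψ (.xi a) = theta a) {x : Fin 4 → ThetaExt Λ} (hx : IsCottonNull ψ x) :
    ∃ (t : ThetaExt Λ) (p : Fin 4 → ThetaExt Λ), ∀ a, x a = t * theta a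
      + ∑ d, p d * ∑ b, ∑ c, epsLow a b c d • (xiUp ψ b * xiUp ψ c) := by
  have hr := xi_relations hψ hx
  have hE := sum_epsLow_xiUp_xiUp hψ
  simp only [hθ] at hr hE
  have h1 := hr 1 0 2 3 (by decide) (by decide) (by decide) (by decide) (by decide) (by decide)
  have h2 := hr 1 0 3 2 (by decide) (by decide) (by decide) (by decide) (by decide) (by decide)
  have h3 := hr 2 0 1 3 (by decide) (by decide) (by decide) (by decide) (by decide) (by decide)
  have h4 := hr 2 0 3 1 (by decide) (by decide) (by decide) (by decide) (by decide) (by decide)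
  have h5 := hr 2 1 0 3 (by decide) (by decide) (by decide) (by decide) (by decide) (by decide)
  have h6 := hr 2 1 3 0 (by decide) (by decide) (by decide) (by decide) (by decide) (by decide)
  have h7 := hr 3 0 1 2 (by decide) (by decide) (by decide) (by decide) (by decide) (by decide)
  have h8 := hr 3 0 2 1 (by decide) (by decide) (by decide) (by decide) (by decide) (by decide)
  have h9 := hr 3 1 0 2 (by decide) (by decide) (by decide) (by decide) (by decide) (by decide)
  have h10 := hr 3 1 2 0 (by decide) (by decide) (by decide) (by decide) (by decide) (by decide)
  have h11 := hr 3 2 0 1 (by decide) (by decide) (by decide) (by decide) (by decide) (by decide)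
  have h12 := hr 3 2 1 0 (by decide) (by decide) (by decide) (by decide) (by decide) (by decide)
  clear hr
  simp [thetaExt_ext_iff, theta, eta] at h1 h2 h3 h4 h5 h6 h7 h8 h9 h10 h11 h12
  simp only [neg_eq_iff_eq_neg, eq_comm (a :=
    (0 : Λ)), neg_eq_zero] at h1 h2 h3 h4 h5 h6 h7 h8 h9 h10 h11 h12
  -- A solution of the linear equations for the coefficients of the monomials in `θ`.
  refine ⟨.mk (.mk (.mk (.mk ((x 0).1.1.1.2) ((x 1).1.1.2.2)) (.mk (-(x 0).1.1.2.2) 0))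
    (.mk (.mk (-(x 0).1.2.1.2) 0) (.mk 0 ((x 3).2.2.2.2))))
    (.mk (.mk (.mk (-(x 0).2.1.1.2) 0) (.mk 0 (-(x 2).2.2.2.2))) (.mk (.mk 0 ((x 1).2.2.2.2))
    (.mk (-(x 0).2.2.2.2) 0))),
    ![.mk (.mk (.mk (.mk ((1 / 2 : ℝ) • (x 1).2.2.1.1) ((-1/3 : ℝ) • (x 0).2.2.2.1 +
    (1/6 : ℝ) • (x 1).2.2.1.2 - (1/6 : ℝ) • (x 2).2.1.2.2 +
    (1/6 : ℝ) • (x 3).1.2.2.2)) (.mk ((1 / 2 : ℝ) • (x 1).2.2.2.1) 0))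
    (.mk (.mk ((1 / 2 : ℝ) • (x 2).2.2.2.1) 0) 0)) (.mk (.mk (.mk ((1 / 2 : ℝ) • (x 3).2.2.2.1) 0)
    0) 0),
    .mk (.mk (.mk (.mk ((-1 / 2 : ℝ) • (x 0).2.2.1.1) ((-1 / 2 : ℝ) • (x 0).2.2.1.2))
      (.mk ((-1/6 : ℝ) • (x 0).2.2.2.1 + (1/3 : ℝ) • (x 1).2.2.1.2 + (1/6 : ℝ) • (x 2).2.1.2.2 -
      (1/6 : ℝ) • (x 3).1.2.2.2) 0)) (.mk (.mk ((1 / 2 : ℝ) • (x 2).2.2.1.2) 0) 0))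
      (.mk (.mk (.mk ((1 / 2 : ℝ) • (x 3).2.2.1.2) 0) 0) 0),
    .mk (.mk (.mk (.mk ((1 / 2 : ℝ) • (x 0).2.1.2.1) ((1 / 2 : ℝ) • (x 0).2.1.2.2))
      (.mk ((-1 / 2 : ℝ) • (x 1).2.1.2.2) 0)) (.mk (.mk ((-1/6 : ℝ) • (x 0).2.2.2.1 -
      (1/6 : ℝ) • (x 1).2.2.1.2 - (1/3 : ℝ) • (x 2).2.1.2.2 - (1/6 : ℝ) • (x 3).1.2.2.2) 0) 0))
      (.mk (.mk (.mk ((-1 / 2 : ℝ) • (x 3).2.1.2.2) 0) 0) 0),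
    .mk (.mk (.mk (.mk ((-1 / 2 : ℝ) • (x 0).1.2.2.1) ((-1 / 2 : ℝ) • (x 0).1.2.2.2))
      (.mk ((1 / 2 : ℝ) • (x 1).1.2.2.2) 0)) (.mk (.mk ((1 / 2 : ℝ) • (x 2).1.2.2.2) 0) 0))
      (.mk (.mk (.mk ((-1/6 : ℝ) • (x 0).2.2.2.1 - (1/6 : ℝ) • (x 1).2.2.1.2 +
      (1/6 : ℝ) • (x 2).2.1.2.2 + (1/3 : ℝ) • (x 3).1.2.2.2) 0) 0) 0)], fun a => ?_⟩
  rw [Fin.sum_univ_four]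
  fin_cases a <;> simp only [Fin.reduceFinMk, Fin.zero_eta, Fin.mk_one, hE] <;>
  simp [thetaExt_ext_iff, theta, h1, h2, h3, h4, h5, h6, h7, h8, h9, h10, h11, h12] <;>
  and_intros <;> module

end

/-! ### Electric and magnetic parts of Weyl tensors -/

/-- The components of the two-form `dx⁰ ∧ dxᵐ`, the spatial directions being numbered from zero. -/
def elForm (m : Fin 3) (a b : Fin 4) : ℤ :=
  (if a = 0 ∧ b = m.succ then 1 else 0) - (if b = 0 ∧ a = m.succ then 1 else 0)

/-- The components of the two-form dual in space to `dxᵐ`. -/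
def mgForm (m : Fin 3) (a b : Fin 4) : ℤ :=
  (if a = (m + 1).succ ∧ b = (m + 2).succ then 1 else 0)
    - (if b = (m + 1).succ ∧ a = (m + 2).succ then 1 else 0)

theorem elForm_antisymm (m : Fin 3) (a b : Fin 4) : elForm m b a = -elForm m a b := by
  simp [elForm]

theorem mgForm_antisymm (m : Fin 3) (a b : Fin 4) : mgForm m b a = -mgForm m a b := by
  simp [mgForm]

/-- The tensor with the symmetries of the Weyl tensor with electric part `E` and magnetic part
`B`. -/
def weylOf {M : Type*} [AddCommGroup M] (E B : Fin 3 → Fin 3 → M) (a b c d : Fin 4) : M :=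
  ∑ m, ∑ n, ((elForm m a b * elForm n c d - mgForm m a b * mgForm n c d) • E m n
    + (elForm m a b * mgForm n c d + mgForm m a b * elForm n c d) • B m n)

section
variable {M : Type*} [AddCommGroup M] [Module ℝ M]

/-- Symmetric traceless matrices. -/
def IsSymTraceless (E : Fin 3 → Fin 3 → M) : Prop :=
  (E 1 0 = E 0 1 ∧ E 2 0 = E 0 2 ∧ E 2 1 = E 1 2) ∧ E 2 2 = -E 0 0 - E 1 1

theorem weylOf_antisymm_left (E B : Fin 3 → Fin 3 → M) (a b c d : Fin 4) :
    weylOf E B b a c d = -weylOf E B a b c d := by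
  simp only [weylOf, ← Finset.sum_neg_distrib, ← neg_smul, neg_add, elForm_antisymm _ a b,
    mgForm_antisymm _ a b]
  refine Finset.sum_congr rfl fun m _ => Finset.sum_congr rfl fun n _ => ?_
  module

theorem weylOf_antisymm_right (E B : Fin 3 → Fin 3 → M) (a b c d : Fin 4) :
    weylOf E B a b d c = -weylOf E B a b c d := by
  simp only [weylOf, ← Finset.sum_neg_distrib, ← neg_smul, neg_add, elForm_antisymm _ c d,
    mgForm_antisymm _ c d]
  refine Finset.sum_congr rfl fun m _ => Finset.sum_congr rfl fun n _ => ?_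
  module

theorem weylOf_components (E B : Fin 3 → Fin 3 → M) :
    (weylOf E B 0 1 0 1 = E 0 0 ∧ weylOf E B 0 1 0 2 = E 0 1 ∧ weylOf E B 0 1 0 3 = E 0 2 ∧
      weylOf E B 0 2 0 1 = E 1 0 ∧ weylOf E B 0 2 0 2 = E 1 1 ∧ weylOf E B 0 2 0 3 = E 1 2 ∧
      weylOf E B 0 3 0 1 = E 2 0 ∧ weylOf E B 0 3 0 2 = E 2 1 ∧ weylOf E B 0 3 0 3 = E 2 2) ∧
    (weylOf E B 0 1 2 3 = B 0 0 ∧ weylOf E B 0 1 1 3 = -B 0 1 ∧ weylOf E B 0 1 1 2 = B 0 2 ∧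
      weylOf E B 0 2 2 3 = B 1 0 ∧ weylOf E B 0 2 1 3 = -B 1 1 ∧ weylOf E B 0 2 1 2 = B 1 2 ∧
      weylOf E B 0 3 2 3 = B 2 0 ∧ weylOf E B 0 3 1 3 = -B 2 1 ∧ weylOf E B 0 3 1 2 = B 2 2) ∧
    (weylOf E B 2 3 0 1 = B 0 0 ∧ weylOf E B 2 3 0 2 = B 0 1 ∧ weylOf E B 2 3 0 3 = B 0 2 ∧
      weylOf E B 1 3 0 1 = -B 1 0 ∧ weylOf E B 1 3 0 2 = -B 1 1 ∧ weylOf E B 1 3 0 3 = -B 1 2 ∧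
      weylOf E B 1 2 0 1 = B 2 0 ∧ weylOf E B 1 2 0 2 = B 2 1 ∧ weylOf E B 1 2 0 3 = B 2 2) ∧
    (weylOf E B 2 3 2 3 = -E 0 0 ∧ weylOf E B 2 3 1 3 = E 0 1 ∧ weylOf E B 2 3 1 2 = -E 0 2 ∧
      weylOf E B 1 3 2 3 = E 1 0 ∧ weylOf E B 1 3 1 3 = -E 1 1 ∧ weylOf E B 1 3 1 2 = E 1 2 ∧
      weylOf E B 1 2 2 3 = -E 2 0 ∧ weylOf E B 1 2 1 3 = E 2 1 ∧ weylOf E B 1 2 1 2 = -E 2 2) := by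
  refine ⟨?_, ?_, ?_, ?_⟩ <;> and_intros <;>
  simp [weylOf, Fin.sum_univ_three, elForm, mgForm]

theorem isWeyl_weylOf {E B : Fin 3 → Fin 3 → M} (hE : IsSymTraceless E) (hB : IsSymTraceless B) :
    IsWeyl (weylOf E B) where
  antisymm_left := weylOf_antisymm_left E B
  antisymm_right := weylOf_antisymm_right E B
  cyclic a b c d := by
    have hl := fun c d => antisymm_rules fun a b => weylOf_antisymm_left E B a b c d
    have hr := fun a b => antisymm_rules fun c d => weylOf_antisymm_right E B a b c d
    have hc := weylOf_components E B
    obtain ⟨h1, h2⟩ := hE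
    obtain ⟨h3, h4⟩ := hB
    fin_cases a <;> fin_cases b <;> simp only [Fin.reduceFinMk, Fin.zero_eta, Fin.mk_one] <;>
      fin_cases c <;> fin_cases d <;>
      simp [hl, hr, hc, h1, h2, h3, h4] <;> abel
  traceless b d := by
    have hl := fun c d => antisymm_rules fun a b => weylOf_antisymm_left E B a b c d
    have hr := fun a b => antisymm_rules fun c d => weylOf_antisymm_right E B a b c d
    have hc := weylOf_components E B
    obtain ⟨h1, h2⟩ := hE
    obtain ⟨h3, h4⟩ := hB
    fin_cases b <;> fin_cases d <;>
      simp [Fin.sum_univ_four, eta, hl, hr, hc, h1, h2, h3, h4] <;> module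

end

/-! ### The components along `ρ` of a vector in the kernel -/

section
variable {R : Type u} [Ring R] [Algebra ℝ R] [SuperAlgebra R] {ψ : Coord → R}

/-- The vanishing of the contraction on the Weyl tensor with electric part `E` and magnetic part
`B`. -/
theorem rho_relation (hψ : IsPoint ψ) {ρ : Fin 4 → Fin 4 → R} (hρ : ∀ a b, ρ b a = -ρ a b)
    (hW : IsWeylNull ψ ρ) {E B : Fin 3 → Fin 3 → ℝ} (hE : IsSymTraceless E) (hB : IsSymTraceless
      B) :
    ∑ m, ∑ n, (E m n • (![ρ 0 1, ρ 0 2, ρ 0 3] m * ![ψ (.xi 2) * ψ (.xi 3),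
      -(ψ (.xi 1) * ψ (.xi 3)),
          ψ (.xi 1) * ψ (.xi 2)] n + ![ρ 2 3, -ρ 1 3, ρ 1 2] m * (ψ (.xi 0) * ψ (.xi n.succ)))
      + B m n • (![ρ 0 1, ρ 0 2, ρ 0 3] m * (ψ (.xi 0) * ψ (.xi n.succ)) -
        ![ρ 2 3, -ρ 1 3, ρ 1 2] m *
          ![ψ (.xi 2) * ψ (.xi 3), -(ψ (.xi 1) * ψ (.xi 3)), ψ (.xi 1) * ψ (.xi 2)] n)) = 0 := by
  have hl : IsWeyl fun a b c d => weylOf E B a b c d • (1 : R) :=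
    (isWeyl_weylOf hE hB).map (LinearMap.toSpanSingleton ℝ R 1).toAddMonoidHom
  have h := hW _ (isWeyl_weylOf hE hB)
  simp only [Algebra.algebraMap_eq_smul_one] at h
  rw [sum_antisymm hρ (hodge_antisymm hl)] at h
  simp only [xiHodge_eq hψ (hl.antisymm_right _ _)] at h
  simp [weylOf_components, mul_add, mul_sub] at h
  simp [Fin.sum_univ_three, mul_add, mul_sub]
  linear_combination (norm := module) (-1 / 8 : ℝ) • h
end

section
variable {Λ : Type u} [Ring Λ] [Algebra ℝ Λ] [SuperAlgebra Λ]

theorem antisymm_ext {M : Type*} [AddCommGroup M] [Module ℝ M] {T U : Fin 4 → Fin 4 → M}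
    (hT : ∀ a b, T b a = -T a b) (hU : ∀ a b, U b a = -U a b)
    (h : T 0 1 = U 0 1 ∧ T 0 2 = U 0 2 ∧ T 0 3 = U 0 3 ∧ T 1 2 = U 1 2 ∧ T 1 3 = U 1 3 ∧
      T 2 3 = U 2 3) (a b : Fin 4) : T a b = U a b := by
  fin_cases a <;> fin_cases b <;> simp [antisymm_rules hT, antisymm_rules hU, h]

set_option maxHeartbeats 4000000 in
/-- If `ξ_a = θ_a`, components along `ρ` whose contraction with `ω` vanishes on the constant vectors
along `W` are those of a combination of the fields `Yant` and `Ytrace`. -/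
theorem exists_rho_coefficients {ψ : Coord → ThetaExt Λ} (hψ : IsPoint ψ)
    (hθ : ∀ a, ψ (.xi a) = theta a) {ρ : Fin 4 → Fin 4 → ThetaExt Λ} (hρ : ∀ a b, ρ b a = -ρ a b)
    (hW : IsWeylNull ψ ρ) :
    ∃ α β : Fin 4 → ThetaExt Λ, ∀ a b, ρ a b = ∑ d, (α d * ∑ c, epsLow a b c d • xiUp ψ c
      + β d * (etaMat b d • theta a - etaMat a d • theta b)) := by
  -- A basis of the symmetric traceless matrices, as electric and as magnetic parts.
  have z : IsSymTraceless (0 : Fin 3 → Fin 3 → ℝ) := by simp [IsSymTraceless]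
  have m1 : IsSymTraceless (![![0, 1, 0], ![1, 0, 0], ![0, 0, 0]] : Fin 3 → Fin 3 → ℝ) := by
    simp [IsSymTraceless]
  have m2 : IsSymTraceless (![![0, 0, 1], ![0, 0, 0], ![1, 0, 0]] : Fin 3 → Fin 3 → ℝ) := by
    simp [IsSymTraceless]
  have m3 : IsSymTraceless (![![0, 0, 0], ![0, 0, 1], ![0, 1, 0]] : Fin 3 → Fin 3 → ℝ) := by
    simp [IsSymTraceless]
  have m4 : IsSymTraceless (![![1, 0, 0], ![0, -1, 0], ![0, 0, 0]] : Fin 3 → Fin 3 → ℝ) := by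
    simp [IsSymTraceless]
  have m5 : IsSymTraceless (![![0, 0, 0], ![0, 1, 0], ![0, 0, -1]] : Fin 3 → Fin 3 → ℝ) := by
    simp [IsSymTraceless]
  have h1 := rho_relation hψ hρ hW m1 z
  have h2 := rho_relation hψ hρ hW z m1
  have h3 := rho_relation hψ hρ hW m2 z
  have h4 := rho_relation hψ hρ hW z m2
  have h5 := rho_relation hψ hρ hW m3 z
  have h6 := rho_relation hψ hρ hW z m3
  have h7 := rho_relation hψ hρ hW m4 z
  have h8 := rho_relation hψ hρ hW z m4
  have h9 := rho_relation hψ hρ hW m5 z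
  have h10 := rho_relation hψ hρ hW z m5
  clear hW m1 m2 m3 m4 m5 z
  simp [Fin.sum_univ_three, hθ, thetaExt_ext_iff, theta,
    sub_eq_add_neg] at h1 h2 h3 h4 h5 h6 h7 h8 h9 h10
  -- The solution of the linear equations for the coefficients of the monomials in `θ`.
  have e1 : (ρ 2 3).1.1.1.1 = 0 := by grind
  have e2 : (ρ 1 3).1.1.1.1 = 0 := by grind
  have e3 : (ρ 1 2).1.1.1.1 = 0 := by grind
  have e4 : (ρ 0 3).1.1.1.1 = 0 := by grind
  have e5 : (ρ 0 2).1.1.1.1 = 0 := by grind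
  have e6 : (ρ 0 1).1.1.1.1 = 0 := by grind
  have e7 : (ρ 2 3).2.1.1.1 = -(ρ 0 2).1.1.1.2 := by grind
  have e8 : (ρ 2 3).1.2.1.1 = (ρ 0 3).1.1.1.2 := by grind
  have e9 : (ρ 2 3).1.1.2.1 = (ρ 1 2).2.1.1.1 := by grind
  have e10 : (ρ 2 3).1.1.1.2 = -(ρ 0 2).2.1.1.1 := by grind
  have e11 : (ρ 1 3).2.1.1.1 = -(ρ 0 1).1.1.1.2 := by grind
  have e12 : (ρ 1 3).1.2.1.1 = -(ρ 1 2).2.1.1.1 := by grind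
  have e13 : (ρ 1 3).1.1.2.1 = (ρ 0 3).1.1.1.2 := by grind
  have e14 : (ρ 1 3).1.1.1.2 = -(ρ 0 1).2.1.1.1 := by grind
  have e15 : (ρ 1 2).1.2.1.1 = -(ρ 0 1).1.1.1.2 := by grind
  have e16 : (ρ 1 2).1.1.2.1 = (ρ 0 2).1.1.1.2 := by grind
  have e17 : (ρ 1 2).1.1.1.2 = -(ρ 0 1).1.2.1.1 := by grind
  have e18 : (ρ 0 3).2.1.1.1 = (ρ 0 1).1.1.2.1 := by grind
  have e19 : (ρ 0 3).1.2.1.1 = -(ρ 0 2).2.1.1.1 := by grind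
  have e20 : (ρ 0 3).1.1.2.1 = -(ρ 0 1).2.1.1.1 := by grind
  have e21 : (ρ 0 2).1.2.1.1 = (ρ 0 1).1.1.2.1 := by grind
  have e22 : (ρ 0 2).1.1.2.1 = -(ρ 0 1).1.2.1.1 := by grind
  have e23 : (ρ 2 3).2.2.1.1 = -(ρ 0 1).1.1.2.2 + (ρ 0 3).2.1.1.2 + (ρ 1 2).1.2.2.1 := by grind
  have e24 : (ρ 2 3).2.1.2.1 = (ρ 0 1).1.2.1.2 + (ρ 0 2).1.1.2.2 - (ρ 1 3).2.2.1.1 := by grind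
  have e25 : (ρ 2 3).1.2.2.1 = -(ρ 0 1).2.1.1.2 - (ρ 0 3).1.1.2.2 - (ρ 1 2).2.2.1.1 := by grind
  have e26 : (ρ 2 3).2.1.1.2 = (ρ 0 1).1.2.2.1 + (ρ 0 3).2.2.1.1 - (ρ 1 2).1.1.2.2 := by grind
  have e27 : (ρ 2 3).1.2.1.2 = -(ρ 0 1).2.1.2.1 + (ρ 0 2).2.2.1.1 + (ρ 1 3).1.1.2.2 := by grind
  have e28 : (ρ 2 3).1.1.2.2 = (ρ 0 1).2.2.1.1 - (ρ 0 3).1.2.2.1 + (ρ 1 2).2.1.1.2 := by grind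
  have e29 : (ρ 1 3).2.1.2.1 = -(ρ 0 2).1.2.1.2 + (ρ 0 3).2.1.1.2 + (ρ 1 2).1.2.2.1 := by grind
  have e30 : (ρ 1 3).1.2.2.1 = (ρ 0 2).2.1.1.2 + (ρ 0 3).1.2.1.2 - (ρ 1 2).2.1.2.1 := by grind
  have e31 : (ρ 1 3).2.1.1.2 = -(ρ 0 2).1.2.2.1 + (ρ 0 3).2.1.2.1 + (ρ 1 2).1.2.1.2 := by grind
  have e32 : (ρ 1 3).1.2.1.2 = (ρ 0 2).2.1.2.1 + (ρ 0 3).1.2.2.1 - (ρ 1 2).2.1.1.2 := by grind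
  clear h1 h2 h3 h4 h5 h6 h7 h8 h9 h10
  -- One of the choices of `α` and `β`; they are unique only up to relations between the fields.
  obtain ⟨α, hα⟩ : ∃ α : Fin 4 → ThetaExt Λ, α =
    ![.mk (.mk (.mk (.mk ((ρ 1 2).2.1.1.1) ((1/2 : ℝ) • (ρ 0 1).2.2.1.1 -
    (1/2 : ℝ) • (ρ 0 2).2.1.2.1 - (1/2 : ℝ) • (ρ 0 3).1.2.2.1 +
    (ρ 1 2).2.1.1.2)) (.mk (-(ρ 1 3).1.2.2.1) ((-1/2 : ℝ) • (ρ 0 1).2.2.2.1 +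
    (1/2 : ℝ) • (ρ 1 2).2.1.2.2 - (1/2 : ℝ) • (ρ 1 3).1.2.2.2))) (.mk (.mk ((ρ 0 1).2.1.1.2 +
    (ρ 0 3).1.1.2.2 + (ρ 1 2).2.2.1.1) ((-1/2 : ℝ) • (ρ 0 2).2.2.2.1 + (1/2 : ℝ) • (ρ 1 2).2.2.1.2 -
    (1/2 : ℝ) • (ρ 2 3).1.2.2.2)) (.mk ((ρ 1 2).2.2.2.1) ((ρ 1 2).2.2.2.2))))
    (.mk (.mk (.mk (-(ρ 0 1).1.2.1.2 - (ρ 0 2).1.1.2.2 +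
    (ρ 1 3).2.2.1.1) ((-1/2 : ℝ) • (ρ 0 3).2.2.2.1 + (1/2 : ℝ) • (ρ 1 3).2.2.1.2 -
    (1/2 : ℝ) • (ρ 2 3).2.1.2.2)) (.mk ((ρ 1 3).2.2.2.1) ((ρ 1 3).2.2.2.2)))
    (.mk (.mk ((ρ 2 3).2.2.2.1) ((ρ 2 3).2.2.2.2)) 0)),
    .mk (.mk (.mk (.mk (-(ρ 0 2).2.1.1.1) (-(ρ 0 2).2.1.1.2 + (ρ 1 2).2.1.2.1 +
      (ρ 1 3).1.2.2.1)) (.mk ((-1/2 : ℝ) • (ρ 0 1).2.2.1.1 - (1/2 : ℝ) • (ρ 0 2).2.1.2.1 +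
      (1/2 : ℝ) • (ρ 0 3).1.2.2.1) ((-1/2 : ℝ) • (ρ 0 1).2.2.1.2 - (1/2 : ℝ) • (ρ 0 2).2.1.2.2 +
      (1/2 : ℝ) • (ρ 0 3).1.2.2.2))) (.mk (.mk ((ρ 0 1).2.1.2.1 - (ρ 0 2).2.2.1.1 -
      (ρ 1 3).1.1.2.2) (-(ρ 0 2).2.2.1.2)) (.mk ((-1/2 : ℝ) • (ρ 0 2).2.2.2.1 +
      (1/2 : ℝ) • (ρ 1 2).2.2.1.2 + (1/2 : ℝ) • (ρ 2 3).1.2.2.2) (-(ρ 0 2).2.2.2.2))))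
      (.mk (.mk (.mk (-(ρ 0 1).1.2.2.1 - (ρ 0 3).2.2.1.1 +
      (ρ 1 2).1.1.2.2) (-(ρ 0 3).2.2.1.2)) (.mk ((-1/2 : ℝ) • (ρ 0 3).2.2.2.1 +
      (1/2 : ℝ) • (ρ 1 3).2.2.1.2 + (1/2 : ℝ) • (ρ 2 3).2.1.2.2) (-(ρ 0 3).2.2.2.2)))
      (.mk (.mk ((ρ 2 3).2.2.1.2) 0) 0)),
    .mk (.mk (.mk (.mk ((ρ 0 1).2.1.1.1) (-(ρ 0 3).1.1.2.2)) (.mk ((ρ 1 3).1.1.2.2)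
      ((ρ 0 1).2.1.2.2))) (.mk (.mk ((1/2 : ℝ) • (ρ 0 1).2.2.1.1 + (1/2 : ℝ) • (ρ 0 2).2.1.2.1 +
      (1/2 : ℝ) • (ρ 0 3).1.2.2.1) ((1/2 : ℝ) • (ρ 0 1).2.2.1.2 + (1/2 : ℝ) • (ρ 0 2).2.1.2.2 +
      (1/2 : ℝ) • (ρ 0 3).1.2.2.2)) (.mk ((1/2 : ℝ) • (ρ 0 1).2.2.2.1 -
      (1/2 : ℝ) • (ρ 1 2).2.1.2.2 - (1/2 : ℝ) • (ρ 1 3).1.2.2.2) ((ρ 0 1).2.2.2.2))))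
      (.mk (.mk (.mk (-(ρ 0 2).1.2.2.1 + (ρ 0 3).2.1.2.1 +
      (ρ 1 2).1.2.1.2) ((ρ 0 3).2.1.2.2)) (.mk (-(ρ 1 3).2.1.2.2) 0))
      (.mk (.mk ((-1/2 : ℝ) • (ρ 0 3).2.2.2.1 - (1/2 : ℝ) • (ρ 1 3).2.2.1.2 -
      (1/2 : ℝ) • (ρ 2 3).2.1.2.2) 0) 0)),
    .mk (.mk (.mk (.mk (-(ρ 0 1).1.2.1.1) ((ρ 0 2).1.1.2.2)) (.mk (-(ρ 1 2).1.1.2.2)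
      (-(ρ 0 1).1.2.2.2))) (.mk (.mk (-(ρ 1 2).1.2.1.2) (-(ρ 0 2).1.2.2.2)) (.mk ((ρ 1 2).1.2.2.2)
      0))) (.mk (.mk (.mk ((1/2 : ℝ) • (ρ 0 1).2.2.1.1 - (1/2 : ℝ) • (ρ 0 2).2.1.2.1 -
      (1/2 : ℝ) • (ρ 0 3).1.2.2.1) ((1/2 : ℝ) • (ρ 0 1).2.2.1.2 - (1/2 : ℝ) • (ρ 0 2).2.1.2.2 -
      (1/2 : ℝ) • (ρ 0 3).1.2.2.2)) (.mk ((1/2 : ℝ) • (ρ 0 1).2.2.2.1 +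
      (1/2 : ℝ) • (ρ 1 2).2.1.2.2 + (1/2 : ℝ) • (ρ 1 3).1.2.2.2) 0))
      (.mk (.mk ((1/2 : ℝ) • (ρ 0 2).2.2.2.1 + (1/2 : ℝ) • (ρ 1 2).2.2.1.2 +
      (1/2 : ℝ) • (ρ 2 3).1.2.2.2) 0) 0))] := ⟨_, rfl⟩
  obtain ⟨β, hβ⟩ : ∃ β : Fin 4 → ThetaExt Λ, β =
    ![.mk (.mk (.mk (.mk ((ρ 0 2).1.2.1.1) ((1/2 : ℝ) • (ρ 0 1).1.1.2.2 +
    (1/2 : ℝ) • (ρ 0 2).1.2.1.2 - (1/2 : ℝ) • (ρ 1 2).1.2.2.1)) (.mk ((ρ 0 2).1.2.2.1 -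
    (ρ 1 2).1.2.1.2) 0)) (.mk (.mk (-(ρ 0 1).1.2.2.1 + (ρ 1 2).1.1.2.2) 0) 0))
    (.mk (.mk (.mk (-(ρ 0 1).2.1.2.1 + (ρ 1 3).1.1.2.2) 0) 0) 0),
    .mk (.mk (.mk (.mk (-(ρ 1 2).1.2.1.1) 0) (.mk ((-1/2 : ℝ) • (ρ 0 1).1.1.2.2 +
      (1/2 : ℝ) • (ρ 0 2).1.2.1.2 - (1/2 : ℝ) • (ρ 1 2).1.2.2.1) 0)) (.mk (.mk (-(ρ 0 1).1.2.1.2 -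
      (ρ 0 2).1.1.2.2) 0) 0)) (.mk (.mk (.mk (-(ρ 0 1).2.1.1.2 - (ρ 0 3).1.1.2.2) 0) 0) 0),
    .mk (.mk (.mk (.mk ((ρ 0 2).1.1.1.2) 0) 0) (.mk (.mk ((1/2 : ℝ) • (ρ 0 1).1.1.2.2 -
      (1/2 : ℝ) • (ρ 0 2).1.2.1.2 - (1/2 : ℝ) • (ρ 1 2).1.2.2.1) 0) 0))
      (.mk (.mk (.mk (-(ρ 1 2).2.1.2.1 - (ρ 1 3).1.2.2.1) 0) 0) 0),
    .mk (.mk (.mk (.mk ((ρ 0 3).1.1.1.2) 0) 0) 0) (.mk (.mk (.mk ((1/2 : ℝ) • (ρ 0 1).1.1.2.2 +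
      (1/2 : ℝ) • (ρ 0 2).1.2.1.2 - (ρ 0 3).2.1.1.2 - (1/2 : ℝ) • (ρ 1 2).1.2.2.1) 0) 0) 0)] :=
      ⟨_, rfl⟩
  refine ⟨α, β, antisymm_ext hρ (fun a b => ?_) ?_⟩
  · rw [← Finset.sum_neg_distrib]
    refine Finset.sum_congr rfl fun d _ => ?_
    rw [sum_epsLow_antisymm ψ a b d]
    simp only [mul_neg, mul_sub]
    abel
  · have hE := sum_epsLow_xiUp ψ
    simp only [hθ] at hE
    rw [hα, hβ]
    simp only [Fin.sum_univ_four (f := fun d => _ * _ + _), hE]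
    and_intros <;>
    simp [thetaExt_ext_iff, theta, etaMat, eta, e1, e2, e3, e4, e5, e6, e7, e8, e9, e10, e11, e12,
      e13, e14, e15, e16, e17, e18, e19, e20, e21, e22, e23, e24, e25, e26, e27, e28, e29, e30, e31,
      e32] <;> and_intros <;> module

end

/-! ### Tensor-valued functions on the odd four-space annihilated by the symbol of `ω` -/

/-- The supermap with `ξ_a = θ_a` whose other components vanish. -/
def flatPoint (Λ : Type u) [Ring Λ] [Algebra ℝ Λ] [SuperAlgebra Λ] : Coord → ThetaExt Λ :=
  vec theta 0 0 0

theorem isPoint_flatPoint (Λ : Type u) [Ring Λ] [Algebra ℝ Λ] [SuperAlgebra Λ] :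
    IsPoint (flatPoint Λ) := by
  refine ⟨isTensor_vec (by simp) IsWeyl.zero IsCotton.zero, fun i => ?_⟩
  cases i <;> simp [flatPoint, vec, Coord.ghost, par_theta]

theorem xiHodge_mul_left {R : Type u} [Ring R] [Algebra ℝ R] [SuperAlgebra R] {ψ : Coord → R}
    (h : IsPoint ψ) (g : R) (T : Fin 4 → Fin 4 → R) :
    xiHodge ψ (fun n m => g * T n m) = g * xiHodge ψ T := by
  simp only [xiHodge, Finset.mul_sum, mul_smul_comm, ← mul_assoc, ← h.xi_xi_comm]

theorem xiHodge_add {R : Type u} [Ring R] (ψ : Coord → R) (T U : Fin 4 → Fin 4 → R) :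
    xiHodge ψ (fun n m => T n m + U n m) = xiHodge ψ T + xiHodge ψ U := by
  simp only [xiHodge, mul_add, smul_add, Finset.sum_add_distrib]

section Symbol
variable {ι : Type*}

/-- Families of two-forms on Minkowski space with values in `M`. -/
abbrev TwoForms (ι : Type*) (M : Type*) : Type _ := ι → Fin 4 → Fin 4 → M

/-- The product of a family of real two-forms with a function on the odd four-space. -/
def tens (v : TwoForms ι ℝ) (g : ThetaExt ℝ) : TwoForms ι (ThetaExt ℝ) := fun i n m => v i n m • g

theorem smul_tens (g g' : ThetaExt ℝ) (v : TwoForms ι ℝ) : g • tens v g' = tens v (g * g') := by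
  funext i n m; simp [tens]

theorem tens_zero (v : TwoForms ι ℝ) : tens v 0 = 0 := by funext i n m; simp [tens]
theorem tens_neg (v : TwoForms ι ℝ) (g) : tens v (-g) = -tens v g := by funext i n m; simp [tens]
theorem zero_tens (g) : tens (0 : TwoForms ι ℝ) g = 0 := by funext i n m; simp [tens]
theorem sub_tens (v w : TwoForms ι ℝ) (g) : tens (v - w) g = tens v g - tens w g := by
  funext i n m; simp [tens, sub_smul]

/-- The kernel of the symbol of `ω`: families `w` with `w_{nm} ε^{nmpk} θ_p θ_k = 0`. -/
def symbolKer (ι : Type*) : Submodule (ThetaExt ℝ) (TwoForms ι (ThetaExt ℝ)) where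
  carrier := {w | ∀ i, xiHodge (flatPoint ℝ) (w i) = 0}
  add_mem' {v w} hv hw i := by
    refine (xiHodge_add (flatPoint ℝ) (v i) (w i)).trans ?_
    rw [hv i, hw i, add_zero]
  zero_mem' i := xiHodge_zero _
  smul_mem' g w hw i := by
    refine (xiHodge_mul_left (isPoint_flatPoint ℝ) g (w i)).trans ?_
    rw [hw i, mul_zero]

/-- Divergence-free families `S_{…nm|e}` with values in `V`. -/
def IsDivFree (V : Submodule ℝ (TwoForms ι ℝ)) (S : Fin 4 → TwoForms ι ℝ) : Prop :=
  (∀ e, S e ∈ V) ∧ ∀ i b, ∑ e, eta e • S e i b e = 0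

/-- `S_{…nm|e} θ^e`. -/
def divFreeForm (S : Fin 4 → TwoForms ι ℝ) : TwoForms ι (ThetaExt ℝ) :=
  fun i n m => ∑ e, S e i n m • xiUp (flatPoint ℝ) e

/-- The module generated by the forms `S_{…nm|e} θ^e` with divergence-free `S`. -/
def divFreeSpan (V : Submodule ℝ (TwoForms ι ℝ)) :
    Submodule (ThetaExt ℝ) (TwoForms ι (ThetaExt ℝ)) :=
  Submodule.span _ {w | ∃ S, IsDivFree V S ∧ w = divFreeForm S}

variable {V : Submodule ℝ (TwoForms ι ℝ)}

theorem divFreeForm_eq (S : Fin 4 → TwoForms ι ℝ) : divFreeForm S =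
    tens (S 1) (theta 1) + tens (S 2) (theta 2) + tens (S 3) (theta 3) - tens (S 0) (theta 0) := by
  funext i n m
  simp [divFreeForm, tens, Fin.sum_univ_four, xiUp, flatPoint, vec, eta]
  abel

theorem divFreeSpan_le (hV : ∀ v ∈ V, ∀ i n m, v i m n = -v i n m) :
    divFreeSpan V ≤ symbolKer ι := by
  refine Submodule.span_le.mpr ?_
  rintro _ ⟨S, hS, rfl⟩ i
  refine xiHodge_divFree (isPoint_flatPoint ℝ) (fun n m e => hV _ (hS.1 e) i n m) fun b => ?_
  rw [← neg_eq_zero, ← hS.2 i b, ← Finset.sum_neg_distrib]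
  exact Finset.sum_congr rfl fun e _ => by rw [hV _ (hS.1 e) i e b, smul_neg]

/-- The spatial components of a divergence-free family can be prescribed, subject to the part of the
divergence which does not involve the remaining component. -/
def HasCompletion (V : Submodule ℝ (TwoForms ι ℝ)) : Prop :=
  ∀ t₁ ∈ V, ∀ t₂ ∈ V, ∀ t₃ ∈ V, (∀ i, t₁ i 0 1 + t₂ i 0 2 + t₃ i 0 3 = 0) →
    ∃ r ∈ V, ∀ i b, r i b 0 = t₁ i b 1 + t₂ i b 2 + t₃ i b 3

/-- A single spatial component of a divergence-free family can be prescribed freely, with only one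
further spatial component different from zero. -/
def HasPartner (V : Submodule ℝ (TwoForms ι ℝ)) : Prop :=
  ∀ q ∈ V, ∀ e l : Fin 4, e ≠ 0 → l ≠ 0 → e ≠ l → ∃ q' ∈ V, ∀ i, q i 0 e + q' i 0 l = 0

theorem HasCompletion.exists_mem (hA : HasCompletion V) {t₁ t₂ t₃ : TwoForms ι ℝ} (h₁ : t₁ ∈ V)
    (h₂ : t₂ ∈ V) (h₃ : t₃ ∈ V) (h : ∀ i, t₁ i 0 1 + t₂ i 0 2 + t₃ i 0 3 = 0) :
    ∃ r ∈ V, tens t₁ (theta 1) + tens t₂ (theta 2) + tens t₃ (theta 3) - tens r (theta 0)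
      ∈ divFreeSpan V := by
  obtain ⟨r, hr, hr'⟩ := hA _ h₁ _ h₂ _ h₃ h
  refine ⟨r, hr, Submodule.subset_span ⟨![r, t₁, t₂, t₃], ⟨fun e => ?_, fun i b => ?_⟩, ?_⟩⟩
  · fin_cases e <;> assumption
  · simp [Fin.sum_univ_four, eta, hr']; ring
  · rw [divFreeForm_eq]; rfl

theorem HasPartner.exists_mem (hA : HasCompletion V) (hB : HasPartner V) {q : TwoForms ι ℝ}
    (hq : q ∈ V) {e l : Fin 4} (he : e ≠ 0) (hl : l ≠ 0) (hel : e ≠ l) :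
    ∃ q' ∈ V, ∃ r ∈ V, tens q (theta e) + tens q' (theta l) + tens r (theta 0)
      ∈ divFreeSpan V := by
  obtain ⟨q', hq', h⟩ := hB q hq e l he hl hel
  let t : Fin 4 → TwoForms ι ℝ := fun k => if k = e then q else if k = l then q' else 0
  have ht : ∀ k, t k ∈ V := fun k => by
    simp only [t]; split_ifs; exacts [hq, hq', V.zero_mem]
  obtain ⟨r, hr, hr'⟩ := hA.exists_mem (ht 1) (ht 2) (ht 3) fun i => by
    have := h i
    fin_cases e <;> fin_cases l <;> simp [t] at he hl hel this ⊢ <;> linarith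
  refine ⟨q', hq', -r, V.neg_mem hr, ?_⟩
  have : tens (-r) (theta 0) = -tens r (theta 0) := by funext i n m; simp [tens]
  rw [this, ← sub_eq_add_neg]
  convert hr' using 2
  fin_cases e <;> fin_cases l <;> simp [t, zero_tens, add_comm] at he hl hel ⊢

/-- The rules `IsPoint.xi_rules` at the flat point, where `ξ_a = θ_a`. -/
theorem theta_rules :
    (∀ a, (theta a * theta a : ThetaExt ℝ) = 0 ∧ ∀ y : ThetaExt ℝ, theta a * (theta a * y) = 0) ∧
    ((theta 1 * theta 0 : ThetaExt ℝ) = -(theta 0 * theta 1) ∧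
      (theta 2 * theta 0 : ThetaExt ℝ) = -(theta 0 * theta 2) ∧
      (theta 3 * theta 0 : ThetaExt ℝ) = -(theta 0 * theta 3) ∧
      (theta 2 * theta 1 : ThetaExt ℝ) = -(theta 1 * theta 2) ∧
      (theta 3 * theta 1 : ThetaExt ℝ) = -(theta 1 * theta 3) ∧
      (theta 3 * theta 2 : ThetaExt ℝ) = -(theta 2 * theta 3)) ∧
    ∀ y : ThetaExt ℝ, theta 1 * (theta 0 * y) = -(theta 0 * (theta 1 * y)) ∧
      theta 2 * (theta 0 * y) = -(theta 0 * (theta 2 * y)) ∧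
      theta 3 * (theta 0 * y) = -(theta 0 * (theta 3 * y)) ∧
      theta 2 * (theta 1 * y) = -(theta 1 * (theta 2 * y)) ∧
      theta 3 * (theta 1 * y) = -(theta 1 * (theta 3 * y)) ∧
      theta 3 * (theta 2 * y) = -(theta 2 * (theta 3 * y)) :=
  (isPoint_flatPoint ℝ).xi_rules

/-- Terms of degree three or more: multiplying the generators supplied by `HasPartner` by `θ^0 θ^l`
leaves a single term, and multiplying them by `θ^1 θ^2` one term without `θ^0`. -/
theorem tens_three_mem (hA : HasCompletion V) (hB : HasPartner V) {q : TwoForms ι ℝ}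
    (hq : q ∈ V) (g : ThetaExt ℝ) :
    tens q (g * (theta 0 * (theta 1 * theta 2))) ∈ divFreeSpan V ∧
    tens q (g * (theta 0 * (theta 1 * theta 3))) ∈ divFreeSpan V ∧
    tens q (g * (theta 0 * (theta 2 * theta 3))) ∈ divFreeSpan V ∧
    tens q (g * (theta 1 * (theta 2 * theta 3))) ∈ divFreeSpan V := by
  have key : ∀ q ∈ V, ∀ (g : ThetaExt ℝ) (e l : Fin 4), e ≠ 0 → l ≠ 0 → e ≠ l →
      tens q (g * (theta 0 * (theta l * theta e))) ∈ divFreeSpan V := by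
    intro q hq g e l he hl hel
    obtain ⟨q', hq', r, hr, h⟩ := hB.exists_mem hA hq he hl hel
    have h1 := (divFreeSpan V).smul_mem (g * (theta 0 * theta l)) h
    have e1 : theta 0 * (theta l * theta 0) = (0 : ThetaExt ℝ) := by
      fin_cases l <;> simp [theta_rules]
    simpa [smul_tens, mul_assoc, theta_rules, e1, tens_zero] using h1
  refine ⟨key q hq g 2 1 (by decide) (by decide) (by decide),
    key q hq g 3 1 (by decide) (by decide) (by decide),
    key q hq g 3 2 (by decide) (by decide) (by decide), ?_⟩
  obtain ⟨q', hq', r, hr, h⟩ := hB.exists_mem hA hq (e := 3) (l := 2) (by decide) (by decide)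
    (by decide)
  have h1 := (divFreeSpan V).smul_mem (g * (theta 1 * theta 2)) h
  have h2 := key r hr g 2 1 (by decide) (by decide) (by decide)
  simp only [smul_add, smul_tens, mul_assoc, theta_rules, mul_zero, mul_neg, neg_neg, tens_zero,
    add_zero] at h1
  exact (add_mem_cancel_right h2).mp h1

/-- Modulo the generated submodule, `θ^e` may be replaced by `θ^0` in terms of degree two. -/
theorem tens_two_mem (hA : HasCompletion V) (hB : HasPartner V) {q : TwoForms ι ℝ}
    (hq : q ∈ V) {e l : Fin 4} (he : e ≠ 0) (hl : l ≠ 0) (hel : e ≠ l) :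
    ∃ r ∈ V, tens q (theta e * theta l) + tens r (theta 0 * theta l) ∈ divFreeSpan V := by
  obtain ⟨q', hq', r, hr, h⟩ := hB.exists_mem hA hq he hl hel
  refine ⟨r, hr, ?_⟩
  have h1 := (divFreeSpan V).neg_mem ((divFreeSpan V).smul_mem (theta l) h)
  have e1 : ∀ a b, (theta b * theta a : ThetaExt ℝ) = -(theta a * theta b) :=
    (isPoint_flatPoint ℝ).xi_mul_xi
  rw [smul_add, smul_add, smul_tens, smul_tens, smul_tens, (theta_rules.1 l).1, e1 e l, e1 0 l,
    tens_zero, tens_neg, tens_neg] at h1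
  convert h1 using 1
  abel

/-- The expansion of a family of forms in monomials in `θ`. -/
theorem eq_sum_tens (w : TwoForms ι (ThetaExt ℝ)) : w =
    tens (fun i n m => (w i n m).1.1.1.1) (1) +
    tens (fun i n m => (w i n m).1.1.1.2) (theta 0) +
    tens (fun i n m => (w i n m).1.1.2.1) (theta 1) +
    tens (fun i n m => (w i n m).1.2.1.1) (theta 2) +
    tens (fun i n m => (w i n m).2.1.1.1) (theta 3) +
    tens (fun i n m => (w i n m).1.1.2.2) (theta 0 * theta 1) +
    tens (fun i n m => (w i n m).1.2.1.2) (theta 0 * theta 2) +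
    tens (fun i n m => (w i n m).2.1.1.2) (theta 0 * theta 3) +
    tens (fun i n m => (w i n m).1.2.2.1) (theta 1 * theta 2) +
    tens (fun i n m => (w i n m).2.1.2.1) (theta 1 * theta 3) +
    tens (fun i n m => (w i n m).2.2.1.1) (theta 2 * theta 3) +
    tens (fun i n m => (w i n m).1.2.2.2) (theta 0 * (theta 1 * theta 2)) +
    tens (fun i n m => (w i n m).2.1.2.2) (theta 0 * (theta 1 * theta 3)) +
    tens (fun i n m => (w i n m).2.2.1.2) (theta 0 * (theta 2 * theta 3)) +
    tens (fun i n m => (w i n m).2.2.2.1) (theta 1 * (theta 2 * theta 3)) +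
    tens (fun i n m => (w i n m).2.2.2.2) (theta 0 * (theta 1 * (theta 2 * theta 3))) := by
  funext i n m
  simp [thetaExt_ext_iff, tens, theta]

/-- The symbol vanishes only on the module generated by the divergence-free families.  By
`HasPartner` the terms of degree three and four lie in that module, and those of degree two can be
brought to the form `∑ u_k θ^0 θ^k`, which is then handled by `HasCompletion`. -/
theorem mem_divFreeSpan (hV : ∀ v ∈ V, ∀ i n m, v i m n = -v i n m) (hA : HasCompletion V)
    (hB : HasPartner V) {w : TwoForms ι (ThetaExt ℝ)}
    (hw : ∀ φ : ThetaExt ℝ →ₗ[ℝ] ℝ, (fun i n m => φ (w i n m)) ∈ V) (h : w ∈ symbolKer ι) :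
    w ∈ divFreeSpan V := by
  obtain ⟨we, hwe⟩ : ∃ v : TwoForms ι ℝ, v = fun i n m => (w i n m).1.1.1.1 := ⟨_, rfl⟩
  obtain ⟨w0, hw0⟩ : ∃ v : TwoForms ι ℝ, v = fun i n m => (w i n m).1.1.1.2 := ⟨_, rfl⟩
  obtain ⟨w1, hw1⟩ : ∃ v : TwoForms ι ℝ, v = fun i n m => (w i n m).1.1.2.1 := ⟨_, rfl⟩
  obtain ⟨w2, hw2⟩ : ∃ v : TwoForms ι ℝ, v = fun i n m => (w i n m).1.2.1.1 := ⟨_, rfl⟩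
  obtain ⟨w3, hw3⟩ : ∃ v : TwoForms ι ℝ, v = fun i n m => (w i n m).2.1.1.1 := ⟨_, rfl⟩
  obtain ⟨w01, hw01⟩ : ∃ v : TwoForms ι ℝ, v = fun i n m => (w i n m).1.1.2.2 := ⟨_, rfl⟩
  obtain ⟨w02, hw02⟩ : ∃ v : TwoForms ι ℝ, v = fun i n m => (w i n m).1.2.1.2 := ⟨_, rfl⟩
  obtain ⟨w03, hw03⟩ : ∃ v : TwoForms ι ℝ, v = fun i n m => (w i n m).2.1.1.2 := ⟨_, rfl⟩
  obtain ⟨w12, hw12⟩ : ∃ v : TwoForms ι ℝ, v = fun i n m => (w i n m).1.2.2.1 := ⟨_, rfl⟩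
  obtain ⟨w13, hw13⟩ : ∃ v : TwoForms ι ℝ, v = fun i n m => (w i n m).2.1.2.1 := ⟨_, rfl⟩
  obtain ⟨w23, hw23⟩ : ∃ v : TwoForms ι ℝ, v = fun i n m => (w i n m).2.2.1.1 := ⟨_, rfl⟩
  obtain ⟨w012, hw012⟩ : ∃ v : TwoForms ι ℝ, v = fun i n m => (w i n m).1.2.2.2 := ⟨_, rfl⟩
  obtain ⟨w013, hw013⟩ : ∃ v : TwoForms ι ℝ, v = fun i n m => (w i n m).2.1.2.2 := ⟨_, rfl⟩
  obtain ⟨w023, hw023⟩ : ∃ v : TwoForms ι ℝ, v = fun i n m => (w i n m).2.2.1.2 := ⟨_, rfl⟩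
  obtain ⟨w123, hw123⟩ : ∃ v : TwoForms ι ℝ, v = fun i n m => (w i n m).2.2.2.1 := ⟨_, rfl⟩
  obtain ⟨w0123, hw0123⟩ : ∃ v : TwoForms ι ℝ, v = fun i n m => (w i n m).2.2.2.2 := ⟨_, rfl⟩
  have mwe : we ∈ V := hwe ▸ hw ⟨⟨fun x => x.1.1.1.1, fun _ _ => rfl⟩, fun _ _ => rfl⟩
  have mw0 : w0 ∈ V := hw0 ▸ hw ⟨⟨fun x => x.1.1.1.2, fun _ _ => rfl⟩, fun _ _ => rfl⟩
  have mw1 : w1 ∈ V := hw1 ▸ hw ⟨⟨fun x => x.1.1.2.1, fun _ _ => rfl⟩, fun _ _ => rfl⟩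
  have mw2 : w2 ∈ V := hw2 ▸ hw ⟨⟨fun x => x.1.2.1.1, fun _ _ => rfl⟩, fun _ _ => rfl⟩
  have mw3 : w3 ∈ V := hw3 ▸ hw ⟨⟨fun x => x.2.1.1.1, fun _ _ => rfl⟩, fun _ _ => rfl⟩
  have mw01 : w01 ∈ V := hw01 ▸ hw ⟨⟨fun x => x.1.1.2.2, fun _ _ => rfl⟩, fun _ _ => rfl⟩
  have mw02 : w02 ∈ V := hw02 ▸ hw ⟨⟨fun x => x.1.2.1.2, fun _ _ => rfl⟩, fun _ _ => rfl⟩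
  have mw03 : w03 ∈ V := hw03 ▸ hw ⟨⟨fun x => x.2.1.1.2, fun _ _ => rfl⟩, fun _ _ => rfl⟩
  have mw12 : w12 ∈ V := hw12 ▸ hw ⟨⟨fun x => x.1.2.2.1, fun _ _ => rfl⟩, fun _ _ => rfl⟩
  have mw13 : w13 ∈ V := hw13 ▸ hw ⟨⟨fun x => x.2.1.2.1, fun _ _ => rfl⟩, fun _ _ => rfl⟩
  have mw23 : w23 ∈ V := hw23 ▸ hw ⟨⟨fun x => x.2.2.1.1, fun _ _ => rfl⟩, fun _ _ => rfl⟩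
  have mw012 : w012 ∈ V := hw012 ▸ hw ⟨⟨fun x => x.1.2.2.2, fun _ _ => rfl⟩, fun _ _ => rfl⟩
  have mw013 : w013 ∈ V := hw013 ▸ hw ⟨⟨fun x => x.2.1.2.2, fun _ _ => rfl⟩, fun _ _ => rfl⟩
  have mw023 : w023 ∈ V := hw023 ▸ hw ⟨⟨fun x => x.2.2.1.2, fun _ _ => rfl⟩, fun _ _ => rfl⟩
  have mw123 : w123 ∈ V := hw123 ▸ hw ⟨⟨fun x => x.2.2.2.1, fun _ _ => rfl⟩, fun _ _ => rfl⟩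
  have mw0123 : w0123 ∈ V := hw0123 ▸ hw ⟨⟨fun x => x.2.2.2.2, fun _ _ => rfl⟩, fun _ _ => rfl⟩
  have hw' := eq_sum_tens w
  simp only [← hwe, ← hw0, ← hw1, ← hw2, ← hw3, ← hw01, ← hw02, ← hw03, ← hw12, ← hw13, ← hw23,
    ← hw012, ← hw013, ← hw023, ← hw123, ← hw0123] at hw'
  have hflat : ∀ a, flatPoint ℝ (.xi a) = theta a := fun _ => rfl
  -- The symbol of a family of forms, term by term.
  have hs : ∀ i, xiHodge (flatPoint ℝ) (w i) = 0 := h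
  have hanti : ∀ i n m, w i m n = - w i n m := by
    intro i n m
    rw [hw']
    simp only [Pi.add_apply, tens, hV _ mwe i n m, hV _ mw0 i n m, hV _ mw1 i n m, hV _ mw2 i n m,
      hV _ mw3 i n m, hV _ mw01 i n m, hV _ mw02 i n m, hV _ mw03 i n m, hV _ mw12 i n m,
      hV _ mw13 i n m, hV _ mw23 i n m, hV _ mw012 i n m, hV _ mw013 i n m, hV _ mw023 i n m,
      hV _ mw123 i n m, hV _ mw0123 i n m, neg_smul, neg_add]
  have hcomp : ∀ i, (we i 0 1 = 0 ∧ we i 0 2 = 0 ∧ we i 0 3 = 0 ∧ we i 1 2 = 0 ∧ we i 1 3 = 0 ∧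
      we i 2 3 = 0) ∧ (w1 i 0 1 + w2 i 0 2 + w3 i 0 3 = 0 ∧ w0 i 0 1 = w2 i 1 2 + w3 i 1 3 ∧
      w0 i 0 2 + w1 i 1 2 = w3 i 2 3 ∧ w0 i 0 3 + w1 i 1 3 + w2 i 2 3 = 0) := by
    intro i
    have := hs i
    rw [xiHodge_eq (isPoint_flatPoint ℝ) (hanti i)] at this
    simp [thetaExt_ext_iff, theta, hflat, sub_eq_add_neg] at this
    subst hwe hw0 hw1 hw2 hw3
    beta_reduce
    simp only [and_assoc] at this
    obtain ⟨h1, h2, h3, h4, h5, h6, h7, h8, h9, h10, h11⟩ := this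
    refine ⟨⟨?_, ?_, ?_, ?_, ?_, ?_⟩, ?_, ?_, ?_, ?_⟩ <;> linarith
  -- The terms of degree zero vanish, and those of degree one are a single generator.
  have he : we = 0 := by
    funext i n m
    obtain ⟨⟨h1, h2, h3, h4, h5, h6⟩, -⟩ := hcomp i
    have := hV _ mwe i
    fin_cases n <;> fin_cases m <;> simp only [Fin.reduceFinMk, Fin.zero_eta, Fin.mk_one,
      Pi.zero_apply] <;> first | assumption | linarith [this 0 0, this 1 1, this 2 2, this 3 3] |
        linarith [this 0 1, this 0 2, this 0 3, this 1 2, this 1 3, this 2 3]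
  have hone : tens w0 (theta 0) + tens w1 (theta 1) + tens w2 (theta 2) + tens w3 (theta 3) ∈
      divFreeSpan V := by
    refine Submodule.subset_span ⟨![-w0, w1, w2, w3], ⟨fun e => ?_, fun i b => ?_⟩, ?_⟩
    · fin_cases e
      exacts [V.neg_mem mw0, mw1, mw2, mw3]
    · obtain ⟨-, h1, h2, h3, h4⟩ := hcomp i
      have a0 := hV _ mw0 i
      have a1 := hV _ mw1 i
      have a2 := hV _ mw2 i
      have a3 := hV _ mw3 i
      fin_cases b <;> simp [Fin.sum_univ_four, eta]
      · linarith [a0 0 0]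
      · linarith [a0 0 1, a1 1 1]
      · linarith [a0 0 2, a1 1 2, a2 2 2]
      · linarith [a0 0 3, a1 1 3, a2 2 3, a3 3 3]
    · rw [divFreeForm_eq]
      have : tens (-w0) (theta 0) = -tens w0 (theta 0) := by funext i n m; simp [tens]
      simp [this]
      abel
  obtain ⟨r12, k12, l12⟩ := tens_two_mem hA hB mw12 (e := 1) (l := 2) (by decide) (by decide)
    (by decide)
  obtain ⟨r13, k13, l13⟩ := tens_two_mem hA hB mw13 (e := 1) (l := 3) (by decide) (by decide)
    (by decide)
  obtain ⟨r23, k23, l23⟩ := tens_two_mem hA hB mw23 (e := 2) (l := 3) (by decide) (by decide)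
    (by decide)
  have h3 := fun q (hq : q ∈ V) => tens_three_mem hA hB hq 1
  simp only [one_mul] at h3
  have l0123 := (tens_three_mem hA hB mw0123 (theta 0)).2.2.2
  -- What remains is of the form `∑ u_k θ^0 θ^k`.
  have hrest : w - (tens w01 (theta 0 * theta 1) + tens (w02 - r12) (theta 0 * theta 2) +
      tens (w03 - r13 - r23) (theta 0 * theta 3)) ∈ divFreeSpan V := by
    have := add_mem (add_mem (add_mem (add_mem (add_mem (add_mem (add_mem (add_mem hone l12) l13)
      l23) (h3 _ mw012).1) (h3 _ mw013).2.1) (h3 _ mw023).2.2.1) (h3 _ mw123).2.2.2) l0123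
    convert this using 1
    rw [hw', he, zero_tens, sub_tens, sub_tens, sub_tens]
    abel
  have k2 := V.sub_mem mw02 k12
  have k3 := V.sub_mem (V.sub_mem mw03 k13) k23
  revert hrest k2 k3
  generalize w02 - r12 = u2
  generalize w03 - r13 - r23 = u3
  intro hrest k2 k3
  have hu : ∀ i, w01 i 0 1 + u2 i 0 2 + u3 i 0 3 = 0 := by
    intro i
    have h1 := (symbolKer ι).sub_mem h (divFreeSpan_le hV hrest)
    rw [sub_sub_cancel] at h1
    have h2 := h1 i
    rw [xiHodge_eq (isPoint_flatPoint ℝ) (fun n m => by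
      simp only [Pi.add_apply, tens, hV _ mw01 i n m, hV _ k2 i n m, hV _ k3 i n m, neg_smul,
        neg_add])] at h2
    have h3 := (thetaExt_ext_iff _ _).mp h2
    simp [theta, hflat, sub_eq_add_neg, tens] at h3
    linarith
  obtain ⟨r, hr, h4⟩ := hA.exists_mem mw01 k2 k3 hu
  have h5 := (divFreeSpan V).smul_mem (theta 0) h4
  simp only [smul_sub, smul_add, smul_tens, theta_rules, tens_zero, sub_zero] at h5
  have := (divFreeSpan V).add_mem hrest h5
  rwa [sub_add_cancel] at this

end Symbol

/-! ### Completion of divergence-free families of Weyl and Cotton tensors -/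

/-- Real tensors with the symmetries of the Weyl tensor, as families of two-forms. -/
def weylForms : Submodule ℝ (TwoForms (Fin 4 × Fin 4) ℝ) where
  carrier := {v | IsWeyl fun a b n m => v (a, b) n m}
  add_mem' hv hw := hv.add hw
  zero_mem' := IsWeyl.zero
  smul_mem' c _ hv := hv.smul c

/-- Real tensors with the symmetries of the Cotton tensor, as families of two-forms. -/
def cottonForms : Submodule ℝ (TwoForms (Fin 4) ℝ) where
  carrier := {v | IsCotton v}
  add_mem' hv hw := hv.add hw
  zero_mem' := IsCotton.zero
  smul_mem' c _ hv := hv.map (c • LinearMap.id (R := ℝ) (M := ℝ)).toAddMonoidHom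

/-- The tensor with the symmetries of the Cotton tensor with components `T_{i0j} = A_{ij}` and
`T_{ijk} = ε_{jkl} D_{il}` in space. -/
def cottonOf {M : Type*} [AddCommGroup M] (A D : Fin 3 → Fin 3 → M) (a b c : Fin 4) : M :=
  ∑ m, ∑ n, (((if a = m.succ then elForm n b c else 0) + (if a = 0 then
      (if b = m.succ ∧ c = n.succ then 1 else 0) - (if c = m.succ ∧ b = n.succ then 1 else 0)
      else 0)) • A m n
    + ((if a = m.succ then mgForm n b c else 0) + (if a = 0 then
      (if b = 0 then mgForm n m.succ c else 0) - (if c = 0 then mgForm n m.succ b else 0)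
      else 0)) • D m n)

section
variable {M : Type*} [AddCommGroup M] [Module ℝ M]

theorem cottonOf_antisymm (A D : Fin 3 → Fin 3 → M) (a b c : Fin 4) :
    cottonOf A D a c b = -cottonOf A D a b c := by
  simp only [cottonOf, ← Finset.sum_neg_distrib, elForm_antisymm _ b c,
    mgForm_antisymm _ b c]
  refine Finset.sum_congr rfl fun m _ => Finset.sum_congr rfl fun n _ => ?_
  split_ifs <;> module

theorem cottonOf_components (A D : Fin 3 → Fin 3 → M) :
    (cottonOf A D 1 0 1 = A 0 0 ∧ cottonOf A D 1 0 2 = A 0 1 ∧ cottonOf A D 1 0 3 = A 0 2 ∧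
      cottonOf A D 2 0 1 = A 1 0 ∧ cottonOf A D 2 0 2 = A 1 1 ∧ cottonOf A D 2 0 3 = A 1 2 ∧
      cottonOf A D 3 0 1 = A 2 0 ∧ cottonOf A D 3 0 2 = A 2 1 ∧ cottonOf A D 3 0 3 = A 2 2) ∧
    (cottonOf A D 1 2 3 = D 0 0 ∧ cottonOf A D 1 1 3 = -D 0 1 ∧ cottonOf A D 1 1 2 = D 0 2 ∧
      cottonOf A D 2 2 3 = D 1 0 ∧ cottonOf A D 2 1 3 = -D 1 1 ∧ cottonOf A D 2 1 2 = D 1 2 ∧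
      cottonOf A D 3 2 3 = D 2 0 ∧ cottonOf A D 3 1 3 = -D 2 1 ∧ cottonOf A D 3 1 2 = D 2 2) ∧
    (cottonOf A D 0 2 3 = A 1 2 - A 2 1 ∧ cottonOf A D 0 1 3 = A 0 2 - A 2 0 ∧
      cottonOf A D 0 1 2 = A 0 1 - A 1 0) ∧
    cottonOf A D 0 0 1 = D 2 1 - D 1 2 ∧ cottonOf A D 0 0 2 = D 0 2 - D 2 0 ∧
      cottonOf A D 0 0 3 = D 1 0 - D 0 1 := by
  refine ⟨?_, ?_, ?_, ?_⟩ <;> and_intros <;>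
  simp [cottonOf, Fin.sum_univ_three, elForm, mgForm] <;> module

theorem isCotton_cottonOf {A D : Fin 3 → Fin 3 → M} (hA : A 2 2 = -A 0 0 - A 1 1)
    (hD : D 2 2 = -D 0 0 - D 1 1) : IsCotton (cottonOf A D) where
  antisymm := cottonOf_antisymm A D
  cyclic a b c := by
    have hr := fun a => antisymm_rules fun c d => cottonOf_antisymm A D a c d
    have hc := cottonOf_components A D
    fin_cases a <;> fin_cases b <;> fin_cases c <;> simp [hr, hc, hA, hD] <;> abel
  traceless b := by
    have hr := fun a => antisymm_rules fun c d => cottonOf_antisymm A D a c d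
    have hc := cottonOf_components A D
    fin_cases b <;> simp [Fin.sum_univ_four, eta, hr, hc, hA, hD] <;> abel

end

/-- The ten components `r_{abb'0}` of a Weyl tensor are its electric and magnetic parts, and can be
prescribed. -/
theorem hasCompletion_weylForms : HasCompletion weylForms := by
  intro t₁ h₁ t₂ h₂ t₃ h₃ h
  have r₁ := IsWeyl.rules h₁
  have r₂ := IsWeyl.rules h₂
  have r₃ := IsWeyl.rules h₃
  have g := fun a b => h (a, b)
  let s : Fin 4 → Fin 4 → Fin 3 → ℝ := fun a b n =>
    t₁ (a, b) n.succ 1 + t₂ (a, b) n.succ 2 + t₃ (a, b) n.succ 3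
  -- The matrices to be prescribed are symmetric and traceless because the `t_k` are Weyl tensors
  -- and satisfy the condition on the divergence.
  have hE : IsSymTraceless fun m n => -s 0 m.succ n := by
    have g1 := g 1 2; have g2 := g 1 3; have g3 := g 2 3; have g4 := g 0 1; have g5 := g 0 2
    have g6 := g 0 3
    simp only [r₁, r₂, r₃] at g1 g2 g3 g4 g5 g6
    simp [IsSymTraceless, s, r₁, r₂, r₃]
    and_intros <;> linarith
  have hB : IsSymTraceless fun m n => ![-s 2 3 n, s 1 3 n, -s 1 2 n] m := by
    have g1 := g 1 2; have g2 := g 1 3; have g3 := g 2 3; have g4 := g 0 1; have g5 := g 0 2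
    have g6 := g 0 3
    simp only [r₁, r₂, r₃] at g1 g2 g3 g4 g5 g6
    simp [IsSymTraceless, s, r₁, r₂, r₃]
    and_intros <;> linarith
  refine ⟨fun i n m => weylOf _ _ i.1 i.2 n m, isWeyl_weylOf hE hB, fun i b => ?_⟩
  refine antisymm_ext (T := fun a c => weylOf _ _ a c b 0)
    (U := fun a c => t₁ (a, c) b 1 + t₂ (a, c) b 2 + t₃ (a, c) b 3)
    (fun a c => weylOf_antisymm_left _ _ a c b 0) (fun a c => ?_) ?_ i.1 i.2
  · linarith [h₁.antisymm_left a c b 1, h₂.antisymm_left a c b 2, h₃.antisymm_left a c b 3]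
  · have hr := fun E B a b => antisymm_rules fun c d => weylOf_antisymm_right (M := ℝ) E B a b c d
    have hc := weylOf_components (M := ℝ)
    fin_cases b
    · simp [hr, g]
    all_goals simp [hr, hc, s]

/-- The components `r_{ab0}` of a Cotton tensor can be prescribed subject to one trace condition. -/
theorem hasCompletion_cottonForms : HasCompletion cottonForms := by
  intro t₁ h₁ t₂ h₂ t₃ h₃ h
  have r₁ := IsCotton.rules h₁
  have r₂ := IsCotton.rules h₂
  have r₃ := IsCotton.rules h₃
  let s : Fin 4 → Fin 3 → ℝ := fun a n => t₁ a n.succ 1 + t₂ a n.succ 2 + t₃ a n.succ 3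
  have hA : -s 3 2 = -(-s 1 0) - (-s 2 1) := by
    have g0 := h 0
    simp [s, r₁, r₂, r₃]
    linarith
  -- Only the antisymmetric part of `D` enters the components `r_{0b0}`.
  refine ⟨cottonOf (fun m n => -s m.succ n) (fun m n => (1 / 2 : ℝ) * ∑ j : Fin 3,
    -((mgForm n m.succ j.succ : ℤ) : ℝ) * s 0 j), isCotton_cottonOf hA
      (by simp [mgForm, Fin.sum_univ_three]), fun i b => ?_⟩
  have g := h i
  have hr := fun A D a => antisymm_rules fun c d => cottonOf_antisymm (M := ℝ) A D a c d
  fin_cases i <;> fin_cases b <;> simp [cottonOf_components, hr, s, Fin.sum_univ_three, mgForm, r₁,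
    r₂, r₃] at g ⊢ <;> linarith

theorem hasPartner_weylForms : HasPartner weylForms := by
  intro q hq e l he hl hel
  obtain ⟨e, rfl⟩ := Fin.exists_succ_eq.mpr he
  obtain ⟨l, rfl⟩ := Fin.exists_succ_eq.mpr hl
  replace hel : e ≠ l := fun h => hel (h ▸ rfl)
  have r := IsWeyl.rules hq
  let s : (Fin 3 → ℝ) → Fin 3 → Fin 3 → ℝ := fun x m n =>
    if n = l then -x m else if m = l then -x n else if m = e ∧ n = e then x l else 0
  -- A symmetric matrix with column `l` equal to `-x`, made traceless by its entry at `(e, e)`.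
  have hs : ∀ x, IsSymTraceless (s x) := by
    intro x
    clear r
    revert hel
    clear he hl
    fin_cases e <;> fin_cases l <;> simp [IsSymTraceless, s]
  refine ⟨fun i n m => weylOf (s fun m => q (0, m.succ) 0 e.succ)
    (s ![q (2, 3) 0 e.succ, -q (1, 3) 0 e.succ, q (1, 2) 0 e.succ]) i.1 i.2 n m,
    isWeyl_weylOf (hs _) (hs _), fun i => ?_⟩
  have h1 := antisymm_ext (T := fun a c => weylOf (s fun m => q (0, m.succ) 0 e.succ)
      (s ![q (2, 3) 0 e.succ, -q (1, 3) 0 e.succ, q (1, 2) 0 e.succ]) a c 0 l.succ)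
    (U := fun a c => -q (a, c) 0 e.succ) (fun a c => weylOf_antisymm_left _ _ a c 0 l.succ)
    (fun a c => by rw [hq.antisymm_left a c 0 e.succ]) ?_ i.1 i.2
  · beta_reduce at h1 ⊢
    rw [h1, add_neg_cancel]
  · have hc := weylOf_components (M := ℝ)
    clear hs r he hl
    revert hel
    fin_cases l <;> simp [hc, s]

theorem hasPartner_cottonForms : HasPartner cottonForms := by
  intro q hq e l he hl hel
  obtain ⟨e, rfl⟩ := Fin.exists_succ_eq.mpr he
  obtain ⟨l, rfl⟩ := Fin.exists_succ_eq.mpr hl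
  replace hel : e ≠ l := fun h => hel (h ▸ rfl)
  have r := IsCotton.rules hq
  -- The column `l` of `A` is prescribed, its trace compensated at `(e, e)`, and `D` is
  -- antisymmetric.
  refine ⟨cottonOf (fun m n => if n = l then -q m.succ 0 e.succ else
    if m = e ∧ n = e then q l.succ 0 e.succ else 0) (fun m n => -(1 / 2 : ℝ) *
    mgForm n m.succ l.succ * q 0 0 e.succ), isCotton_cottonOf ?_ ?_, fun i => ?_⟩
  · revert hel
    clear r he hl
    fin_cases e <;> fin_cases l <;> simp
  · fin_cases l <;> simp [mgForm]
  · revert hel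
    clear he hl
    fin_cases e <;> fin_cases l <;> simp <;> fin_cases i <;> simp [cottonOf_components, mgForm] <;>
      ring

/-! ### The span of the prolonged kernel vector fields -/

section
variable {Λ : Type u} [Ring Λ] [Algebra ℝ Λ] [SuperAlgebra Λ] {ψ : Coord → ThetaExt Λ}

/-- `Λ[θ]` is generated by `Λ` and the `θ^μ`. -/
theorem thetaExt_induction {P : ThetaExt Λ → Prop} (hadd : ∀ x y, P x → P y → P (x + y))
    (hmul : ∀ x y, P x → P y → P (x * y)) (h0 : ∀ c, P (coeffs c)) (h : ∀ μ, P (theta μ))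
    (x : ThetaExt Λ) : P x := by
  have g0 := h 0
  have g1 := h 1
  have g2 := h 2
  have g3 := h 3
  simp only [theta, coeffs, AlgHom.comp_apply] at h0 g0 g1 g2 g3
  have k1 : ∀ x : OddExt Λ, P (OddExt.incl (OddExt.incl (OddExt.incl x))) := fun x => by
    rw [OddExt.eq_incl_add x]
    simp only [map_add, map_mul]
    exact hadd _ _ (h0 _) (hmul _ _ (h0 _) g0)
  have k2 : ∀ x : OddExt (OddExt Λ), P (OddExt.incl (OddExt.incl x)) := fun x => by
    rw [OddExt.eq_incl_add x]
    simp only [map_add, map_mul]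
    exact hadd _ _ (k1 _) (hmul _ _ (k1 _) g1)
  have k3 : ∀ x : OddExt (OddExt (OddExt Λ)), P (OddExt.incl x) := fun x => by
    rw [OddExt.eq_incl_add x]
    simp only [map_add, map_mul]
    exact hadd _ _ (k2 _) (hmul _ _ (k2 _) g2)
  rw [OddExt.eq_incl_add x]
  exact hadd _ _ (k3 _) (hmul _ _ (k3 _) g3)

/-- The span of the prolongations of the kernel vector fields multiplied by monomials in `ξ`. -/
def kernelSpan (ψ : Coord → ThetaExt Λ) : Submodule Λ (Coord → ThetaExt Λ) :=
  Submodule.span Λ {δ | ∃ (s : List (Fin 4)) (α : KernelLabel),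
    δ = ((kernelField α).xiMul s).prolong ψ}

theorem kernelField_mem_kernelSpan (α : KernelLabel) :
    kernelField α (ThetaExt Λ) ψ ∈ kernelSpan ψ :=
  Submodule.subset_span ⟨[], α, by funext i; simp [VectorField.prolong, VectorField.xiMul]⟩

theorem xi_smul_mem_kernelSpan (h : IsPoint ψ) (a : Fin 4) {δ : Coord → ThetaExt Λ}
    (hδ : δ ∈ kernelSpan ψ) : ψ (.xi a) • δ ∈ kernelSpan ψ := by
  induction hδ using Submodule.span_induction with
  | mem x hx =>
    obtain ⟨s, α, rfl⟩ := hx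
    refine Submodule.subset_span ⟨a :: s, α, ?_⟩
    funext i
    simp [VectorField.prolong, VectorField.xiMul, mul_assoc]
  | zero => simp
  | add x y _ _ hx hy => rw [smul_add]; exact add_mem hx hy
  | smul c x _ hx =>
    have e : ψ (.xi a) • c • x = par c • ψ (.xi a) • x := by
      funext i
      have := odd_mul_eq (h.par_xi a) (coeffs c)
      rw [isSuperHom_coeffs] at this
      simp only [Pi.smul_apply, smul_eq_coeffs_mul, smul_eq_mul, ← mul_assoc, this]
    rw [e]
    exact Submodule.smul_mem _ _ hx

/-- If `ξ_a = θ_a`, then the span of the kernel vector fields is closed under multiplication by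
functions on the odd four-space. -/
theorem smul_mem_kernelSpan (h : IsPoint ψ) (hθ : ∀ a, ψ (.xi a) = theta a) (g : ThetaExt Λ) :
    ∀ δ ∈ kernelSpan ψ, g • δ ∈ kernelSpan ψ := by
  induction g using thetaExt_induction with
  | hadd x y hx hy => intro δ hδ; rw [add_smul]; exact add_mem (hx δ hδ) (hy δ hδ)
  | hmul x y hx hy => intro δ hδ; rw [mul_smul]; exact hx _ (hy δ hδ)
  | h0 c =>
    intro δ hδ
    have e : coeffs c • δ = c • δ := by
      funext i; simp only [Pi.smul_apply, smul_eq_coeffs_mul, smul_eq_mul]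
    rw [e]
    exact Submodule.smul_mem _ _ hδ
  | h μ => intro δ hδ; rw [← hθ]; exact xi_smul_mem_kernelSpan h μ hδ

/-- A submodule contains a finite family in `Λ[θ]` if it contains the real families obtained from it
by applying real functionals to the coefficients. -/
theorem sum_smul_ofReal_mem {ι : Type*} [Finite ι] {N : Submodule Λ (ι → ThetaExt Λ)}
    {x : ι → ThetaExt Λ} (h : ∀ φ : Λ →ₗ[ℝ] ℝ, (fun i => ofReal (mapCoef φ (x i))) ∈ N) : x ∈ N :=
      by
  obtain ⟨n, b, φ, hx⟩ := exists_real_expansion x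
  have : x = ∑ k, b k • fun i => ofReal (mapCoef (φ k) (x i)) := by
    funext i
    rw [Finset.sum_apply]
    exact hx i
  rw [this]
  exact Submodule.sum_mem _ fun k _ => Submodule.smul_mem _ _ (h _)

theorem mapCoef_xiHodge (h : IsPoint ψ) (hθ : ∀ a, ψ (.xi a) = theta a) (φ : Λ →ₗ[ℝ] ℝ)
    (T : Fin 4 → Fin 4 → ThetaExt Λ) :
    xiHodge (flatPoint ℝ) (fun n m => mapCoef φ (T n m)) = mapCoef φ (xiHodge ψ T) := by
  have h1 : ∀ p, ψ (.xi p) = ofReal (flatPoint ℝ (.xi p)) := fun p => by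
    rw [hθ]; exact (ofReal_theta p).symm
  simp only [xiHodge, ← h.xi_xi_comm, ← (isPoint_flatPoint ℝ).xi_xi_comm, map_sum, map_zsmul]
  simp only [h1, mapCoef_mul_ofReal]

theorem ofReal_xiUp (hθ : ∀ a, ψ (.xi a) = theta a) (a : Fin 4) :
    ofReal (xiUp (flatPoint ℝ) a) = xiUp ψ a := by
  simp only [xiUp, map_zsmul, hθ]
  exact congrArg _ (ofReal_theta a)

/-- The vectors along `W` annihilated by `ω`. -/
theorem weyl_mem_kernelSpan (h : IsPoint ψ) (hθ : ∀ a, ψ (.xi a) = theta a)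
    {w : Fin 4 → Fin 4 → Fin 4 → Fin 4 → ThetaExt Λ} (hw : IsWeyl w)
    (hk : ∀ a b, xiHodge ψ (w a b) = 0) : vec 0 0 w 0 ∈ kernelSpan ψ := by
  let L : ((Fin 4 × Fin 4) × Fin 4 × Fin 4 → ThetaExt Λ) →ₗ[Λ] (Coord → ThetaExt Λ) :=
    { toFun := fun v => vec 0 0 (fun a b n m => v ((a, b), n, m)) 0
      map_add' := fun v v' => by funext i; cases i <;> simp [vec]
      map_smul' := fun c v => by funext i; cases i <;> simp [vec] }
  refine sum_smul_ofReal_mem (N := (kernelSpan ψ).comap L)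
    (x := fun i => w i.1.1 i.1.2 i.2.1 i.2.2) fun φ => ?_
  have key : ∀ v ∈ divFreeSpan weylForms,
      L (fun i => ofReal (v i.1 i.2.1 i.2.2)) ∈ kernelSpan ψ := by
    intro v hv
    induction hv using Submodule.span_induction with
    | mem v hv =>
      obtain ⟨S, ⟨hS, hd⟩, rfl⟩ := hv
      convert kernelField_mem_kernelSpan (ψ := ψ) (.ZW ⟨fun a b c d e => S e (a, b) c d, hS,
        fun b c d => ?_⟩) using 1
      · funext i
        cases i <;> simp [L, vec, kernelField, divFreeForm, ofReal_xiUp hθ]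
      · rw [← neg_eq_zero, ← hd (c, d) b, ← Finset.sum_neg_distrib]
        refine Finset.sum_congr rfl fun e _ => ?_
        have h1 := (hS e).pair_symm e b c d
        have h2 := (hS e).antisymm_right c d b e
        beta_reduce at h1 h2 ⊢
        rw [← h1, h2, smul_neg, neg_neg]
    | zero => convert (kernelSpan ψ).zero_mem using 1; funext i; cases i <;> simp [L, vec]
    | add v v' _ _ hv hv' =>
      convert add_mem hv hv' using 1
      rw [← map_add]
      congr 1
      funext i
      simp
    | smul g v _ hv =>
      convert smul_mem_kernelSpan h hθ (ofReal g) _ hv using 1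
      funext i
      cases i <;> simp [L, vec]
  have hv := key _ (mem_divFreeSpan (V := weylForms) (fun v hv i n m => hv.antisymm_right _ _ _ _)
    hasCompletion_weylForms hasPartner_weylForms (w := fun i n m => mapCoef φ (w i.1 i.2 n m))
    (fun f => hw.map (f ∘ₗ mapCoef φ).toAddMonoidHom)
    fun i => (mapCoef_xiHodge h hθ φ _).trans (by rw [hk, map_zero]))
  exact Submodule.mem_comap.mpr hv

/-- The vectors along `C` annihilated by `ω`. -/
theorem cotton_mem_kernelSpan (h : IsPoint ψ) (hθ : ∀ a, ψ (.xi a) = theta a)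
    {c : Fin 4 → Fin 4 → Fin 4 → ThetaExt Λ} (hc : IsCotton c)
    (hk : ∀ a, xiHodge ψ (c a) = 0) : vec 0 0 0 c ∈ kernelSpan ψ := by
  let L : (Fin 4 × Fin 4 × Fin 4 → ThetaExt Λ) →ₗ[Λ] (Coord → ThetaExt Λ) :=
    { toFun := fun v => vec 0 0 0 (fun a n m => v (a, n, m))
      map_add' := fun v v' => by funext i; cases i <;> simp [vec]
      map_smul' := fun c v => by funext i; cases i <;> simp [vec] }
  refine sum_smul_ofReal_mem (N := (kernelSpan ψ).comap L)
    (x := fun i => c i.1 i.2.1 i.2.2) fun φ => ?_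
  have key : ∀ v ∈ divFreeSpan cottonForms,
      L (fun i => ofReal (v i.1 i.2.1 i.2.2)) ∈ kernelSpan ψ := by
    intro v hv
    induction hv using Submodule.span_induction with
    | mem v hv =>
      obtain ⟨S, ⟨hS, hd⟩, rfl⟩ := hv
      convert kernelField_mem_kernelSpan (ψ := ψ) (.ZC ⟨fun a c d e => S e a c d, hS, hd⟩) using 1
      funext i
      cases i <;> simp [L, vec, kernelField, divFreeForm, ofReal_xiUp hθ]
    | zero => convert (kernelSpan ψ).zero_mem using 1; funext i; cases i <;> simp [L, vec]
    | add v v' _ _ hv hv' =>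
      convert add_mem hv hv' using 1
      rw [← map_add]
      congr 1
      funext i
      simp
    | smul g v _ hv =>
      convert smul_mem_kernelSpan h hθ (ofReal g) _ hv using 1
      funext i
      cases i <;> simp [L, vec]
  have hv := key _ (mem_divFreeSpan (V := cottonForms) (fun v hv i n m => hv.antisymm _ _ _)
    hasCompletion_cottonForms hasPartner_cottonForms (w := fun i n m => mapCoef φ (c i n m))
    (fun f => hc.map (f ∘ₗ mapCoef φ).toAddMonoidHom)
    fun i => (mapCoef_xiHodge h hθ φ _).trans (by rw [hk, map_zero]))
  exact Submodule.mem_comap.mpr hv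

end

/-! ### Generation of the kernel -/

section
variable {R : Type u} [Ring R] [Algebra ℝ R] [SuperAlgebra R] {ψ : Coord → R}

/-- The contraction of `ω` with a vector along the even coordinates only. -/
theorem omegaF_even (h : IsPoint ψ) {δ : Coord → R} (hx : ∀ a, δ (.xi a) = 0)
    (hr : ∀ a b, δ (.rho a b) = 0) (δ' : Coord → R) : omegaF ψ δ δ' =
      ∑ a, ∑ b, (eta a * eta b) • (xiHodge ψ (fun n m => δ (.W a b n m)) * δ' (.rho a b))
      - (2 : ℕ) • ∑ a, eta a • (xiHodge ψ (fun n m => δ (.C a n m)) * δ' (.xi a)) := by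
  simp only [omegaF, betaL_eq h, gammaL_eq h, hx, hr, zero_mul, Finset.sum_const_zero, zero_add,
    add_zero]

theorem xiHodge_eq_zero_of_mem_kerOmega (h : IsPoint ψ) {δ : Coord → R} (hδ : δ ∈ kerOmega ψ)
    (hx : ∀ a, δ (.xi a) = 0) (hr : ∀ a b, δ (.rho a b) = 0) :
    (∀ a b, xiHodge ψ (fun n m => δ (.W a b n m)) = 0) ∧
      ∀ a, xiHodge ψ (fun n m => δ (.C a n m)) = 0 := by
  have hη : ∀ a, eta a = 1 ∨ eta a = -1 := by decide
  constructor
  · intro a b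
    have h1 := hδ.2 (vec 0 (fun x y => (if x = a then if y = b then 1 else 0 else 0)
      - (if x = b then if y = a then 1 else 0 else 0)) 0 0) (isTensor_vec
        (fun x y => by split_ifs <;> simp) IsWeyl.zero IsCotton.zero)
    have h2 : xiHodge ψ (fun n m => δ (.W b a n m)) = -xiHodge ψ (fun n m => δ (.W a b n m)) := by
      simp only [xiHodge, hδ.1.weyl.antisymm_left a b, mul_neg, smul_neg, Finset.sum_neg_distrib]
    rw [omegaF_even h hx hr] at h1
    simp [vec, mul_sub, smul_sub, h2, -zsmul_eq_mul] at h1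
    have h3 : (2 : ℝ) • xiHodge ψ (fun n m => δ (.W a b n m)) = 0 := by
      rcases hη a with ha | ha <;> rcases hη b with hb | hb <;> simp only [ha, hb] at h1 <;>
      first
      | linear_combination (norm := module) h1
      | linear_combination (norm := module) (-1 : ℝ) • h1
    simpa using h3
  · intro a
    have h1 := hδ.2 (vec (fun x => if x = a then 1 else 0) 0 0 0) (isTensor_vec
        (by simp) IsWeyl.zero IsCotton.zero)
    rw [omegaF_even h hx hr] at h1
    simp [vec, -zsmul_eq_mul, -nsmul_eq_mul] at h1
    have h3 : (2 : ℝ) • xiHodge ψ (fun n m => δ (.C a n m)) = 0 := by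
      rcases hη a with ha | ha <;> simp only [ha] at h1 <;>
      first
      | linear_combination (norm := module) h1
      | linear_combination (norm := module) (-1 : ℝ) • h1
    simpa using h3

theorem mem_kerOmega_of_xiHodge (h : IsPoint ψ) {δ : Coord → R} (ht : IsTensor δ)
    (hx : ∀ a, δ (.xi a) = 0) (hr : ∀ a b, δ (.rho a b) = 0)
    (hW : ∀ a b, xiHodge ψ (fun n m => δ (.W a b n m)) = 0)
    (hC : ∀ a, xiHodge ψ (fun n m => δ (.C a n m)) = 0) : δ ∈ kerOmega ψ :=
  ⟨ht, fun δ' _ => by rw [omegaF_even h hx hr]; simp [hW, hC]⟩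

end

section
variable {Λ : Type u} [Ring Λ] [Algebra ℝ Λ] [SuperAlgebra Λ] {ψ : Coord → ThetaExt Λ}

/-- A vector whose contraction with `ω` has no components along `W` and `C` differs by a
combination of kernel fields from a vector without components along `ξ` and `ρ`. -/
theorem exists_sub_mem_kernelSpan (h : IsPoint ψ) (hθ : ∀ a, ψ (.xi a) = theta a)
    {δ : Coord → ThetaExt Λ} (ht : IsTensor δ)
    (hC : IsCottonNull ψ fun a => δ (.xi a)) (hW : IsWeylNull ψ fun a b => δ (.rho a b)) :
    ∃ κ ∈ kernelSpan ψ, κ ∈ kerOmega ψ ∧ (∀ a, δ (.xi a) = κ (.xi a)) ∧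
      ∀ a b, δ (.rho a b) = κ (.rho a b) := by
  obtain ⟨t, p, hx⟩ := exists_xi_coefficients h hθ hC
  obtain ⟨α, β, hr⟩ := exists_rho_coefficients h hθ ht.rho_antisymm hW
  let F := fun α : KernelLabel => kernelField α (ThetaExt Λ) ψ
  let κ : Coord → ThetaExt Λ := t • F .Xtrace + ∑ d, (p d • F (.X2ant d) + α d • F (.Yant d)
    + β d • F (.Ytrace d))
  have key : ∀ N : AddSubgroup (Coord → ThetaExt Λ),
      (∀ (g : ThetaExt Λ) (α : KernelLabel), g • F α ∈ N) → κ ∈ N := fun N hN =>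
    add_mem (hN _ _) (sum_mem fun d _ => add_mem (add_mem (hN _ _) (hN _ _)) (hN _ _))
  refine ⟨κ, key (kernelSpan ψ).toAddSubgroup fun g α =>
      smul_mem_kernelSpan h hθ g _ (kernelField_mem_kernelSpan α),
    key (kerOmegaModule ψ).toAddSubgroup fun g α =>
      (kerOmegaModule ψ).smul_mem g (kernelField_mem α h), fun a => ?_, fun a b => ?_⟩
  · simp [κ, F, kernelField, fieldXtrace, fieldX2ant, fieldYant, fieldYtrace, vec, hx, hθ]
  · simp [κ, F, kernelField, fieldXtrace, fieldX2ant, fieldYant, fieldYtrace, vec, hr, hθ]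

/-- If `ξ_a = θ_a`, the kernel of `ω` is generated by the kernel fields and the directions along the
higher derivatives. -/
theorem kerOmega_le_of_theta (h : IsPoint ψ) (hθ : ∀ a, ψ (.xi a) = theta a)
    {δ : Coord → ThetaExt Λ} (hδ : δ ∈ kerOmega ψ) : δ ∈ kernelSpan ψ ⊔ higherTangent Λ := by
  obtain ⟨κ, hκ, hκ', hx, hr⟩ := exists_sub_mem_kernelSpan h hθ hδ.1
    (isCottonNull_of_omegaF fun c hc => hδ.2 _ (isTensor_vec (by simp) IsWeyl.zero
      (hc.map (algebraMap ℝ (ThetaExt Λ) : ℝ →+ ThetaExt Λ))))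
    (isWeylNull_of_omegaF fun w hw => hδ.2 _ (isTensor_vec (by simp)
      (hw.map (algebraMap ℝ (ThetaExt Λ) : ℝ →+ ThetaExt Λ)) IsCotton.zero))
  have h1 : δ - κ ∈ kerOmega ψ := (kerOmegaModule ψ).sub_mem hδ hκ'
  have h2 : ∀ a, (δ - κ) (.xi a) = 0 := fun a => by simp [hx]
  have h3 : ∀ a b, (δ - κ) (.rho a b) = 0 := fun a b => by simp [hr]
  rw [← sub_add_cancel δ κ]
  refine add_mem ?_ (Submodule.mem_sup_left hκ)
  generalize δ - κ = δ at *
  obtain ⟨h4, h5⟩ := xiHodge_eq_zero_of_mem_kerOmega h h1 h2 h3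
  have m1 := weyl_mem_kernelSpan h hθ h1.1.weyl h4
  have m2 := cotton_mem_kernelSpan h hθ h1.1.cotton h5
  have m3 : ∀ α, δ (.kappa α) • kernelField (.K α) (ThetaExt Λ) ψ ∈ kernelSpan ψ := fun α =>
    smul_mem_kernelSpan h hθ _ _ (kernelField_mem_kernelSpan _)
  have m4 : δ .lam • kernelField .L (ThetaExt Λ) ψ ∈ kernelSpan ψ :=
    smul_mem_kernelSpan h hθ _ _ (kernelField_mem_kernelSpan _)
  have m5 := add_mem (add_mem (add_mem m1 m2) (sum_mem fun α (_ : α ∈ Finset.univ) => m3 α)) m4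
  refine (sub_add_cancel δ _).symm ▸ add_mem (Submodule.mem_sup_right ?_) (Submodule.mem_sup_left
    m5)
  refine ⟨?_, fun i hi => ?_⟩
  · have hK : ∀ α, IsTensor (kernelField α (ThetaExt Λ) ψ) := fun α => (kernelField_mem α h).1
    refine (tangent Λ).sub_mem h1.1 (add_mem (add_mem (add_mem ?_ ?_) (sum_mem fun a _ => ?_)) ?_)
    · exact isTensor_vec (by simp) h1.1.weyl IsCotton.zero
    · exact isTensor_vec (by simp) IsWeyl.zero h1.1.cotton
    · exact IsTensor.smul _ (hK _)
    · exact IsTensor.smul _ (hK _)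
  · cases i <;> simp [vec, kernelField, h2, h3, Coord.IsHigher] at hi ⊢

end

/-! ### The kernel of the induced form -/

section
variable {Λ : Type u} [Ring Λ] [Algebra ℝ Λ] [SuperAlgebra Λ] {ψ : Coord → ThetaExt Λ}

/-- The action on tangent vectors of a change of coordinates on the odd four-space. -/
def substTangent (s : ThetaExt Λ →ₐ[ℝ] ThetaExt Λ) (hs : ∀ c, s (coeffs c) = coeffs c) :
    (Coord → ThetaExt Λ) →ₗ[Λ] (Coord → ThetaExt Λ) where
  toFun δ i := s (δ i)
  map_add' δ δ' := by funext i; simp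
  map_smul' c δ := by funext i; simp [smul_eq_coeffs_mul, hs]

/-- Every supermap with nondegenerate frame arises from one with `ξ_a = θ_a` by a change of
coordinates on the odd four-space. -/
theorem exists_theta_gauge (hψ : ψ ∈ FBar Λ) :
    ∃ (s : ThetaExt Λ ≃ₐ[ℝ] ThetaExt Λ) (ψ' : Coord → ThetaExt Λ),
      (∀ x, par (s x) = s (par x)) ∧ (∀ c, s (coeffs c) = coeffs c) ∧ IsPoint ψ' ∧
      (∀ a, ψ' (.xi a) = theta a) ∧ ψ = fun i => s (ψ' i) := by
  obtain ⟨h, hf⟩ := hψ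
  obtain ⟨s, hp, hc, ht⟩ := exists_frame_equiv (fun a => ψ (.xi a)) h.par_xi hf
  refine ⟨s, fun i => s.symm (ψ i), hp, hc, h.map (s.symm : ThetaExt Λ →ₐ[ℝ] ThetaExt Λ) fun x =>
    ?_,
    fun a => ?_, ?_⟩
  · apply s.injective
    simp [← hp]
  · beta_reduce
    rw [← ht, AlgEquiv.symm_apply_apply]
  · simp

theorem kerOmegaBar_eq (hψ : ψ ∈ FBar Λ) :
    kerOmegaBar ψ = kernelSpan ψ ⊔ higherTangent Λ := by
  refine le_antisymm (fun δ hδ => ?_) (sup_le (Submodule.span_le.mpr ?_) fun δ hδ => ?_)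
  · obtain ⟨s, ψ', -, hc, h', hθ, rfl⟩ := exists_theta_gauge hψ
    have h1 := mem_kerOmega_equiv s.symm (mem_kerOmegaBar_iff.mp hδ)
    simp only [AlgEquiv.symm_apply_apply] at h1
    have h2 := Submodule.mem_map_of_mem (f := substTangent (s : ThetaExt Λ →ₐ[ℝ] ThetaExt Λ) hc)
      (kerOmega_le_of_theta h' hθ h1)
    have h3 : substTangent (s : ThetaExt Λ →ₐ[ℝ] ThetaExt Λ) hc (fun i => s.symm (δ i)) = δ := by
      funext i; simp [substTangent]
    rw [h3, Submodule.map_sup] at h2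
    refine SetLike.le_def.mp (sup_le_sup ?_ ?_) h2
    · refine Submodule.map_le_iff_le_comap.mpr (Submodule.span_le.mpr ?_)
      rintro _ ⟨l, α, rfl⟩
      refine Submodule.subset_span ⟨l, α, ?_⟩
      have := kernelField_map (s : ThetaExt Λ →ₐ[ℝ] ThetaExt Λ) α ψ'
      simp only [AlgEquiv.coe_toAlgHom] at this
      funext i
      simp [substTangent, VectorField.prolong, VectorField.xiMul, this, map_list_prod,
        Function.comp_def]
    · rintro _ ⟨δ, hδ, rfl⟩
      refine ⟨hδ.1.map (s : ThetaExt Λ →+ ThetaExt Λ), fun i hi => ?_⟩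
      simp [substTangent, hδ.2 i hi]
  · rintro _ ⟨l, α, rfl⟩
    refine mem_kerOmegaBar_iff.mpr ?_
    exact (kerOmegaModule ψ).smul_mem _ (kernelField_mem α hψ.1)
  · refine mem_kerOmegaBar_iff.mpr (mem_kerOmega_of_xiHodge hψ.1 hδ.1 ?_ ?_ ?_ ?_) <;>
      intros <;> simp [hδ.2 (.xi _) not_false, hδ.2 (.rho _ _) not_false,
        hδ.2 (.W _ _ _ _) not_false, hδ.2 (.C _ _ _) not_false, xiHodge]

end

/-! ### Dual families for an invariant pairing -/

section
variable {A B : Type*} [AddCommGroup A] [Module ℝ A] [AddCommGroup B] [Module ℝ B]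
  (σ : A →ₗ[ℝ] A) (τ : B →ₗ[ℝ] B) (P : A →ₗ[ℝ] B →ₗ[ℝ] ℝ)

/-- Dual families of eigenvectors of the involutions `σ` and `τ`. -/
structure IsDualFamily {n : ℕ} (e : Fin n → ℤ) (a : Fin n → A) (b : Fin n → B) : Prop where
  sign : ∀ i, e i = 1 ∨ e i = -1
  left : ∀ i, σ (a i) = e i • a i
  right : ∀ i, τ (b i) = e i • b i
  dual : ∀ i j, P (a i) (b j) = if i = j then 1 else 0

variable {σ τ P}

theorem IsDualFamily.le_finrank [FiniteDimensional ℝ A] {n : ℕ} {e : Fin n → ℤ} {a : Fin n → A}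
    {b : Fin n → B} (h : IsDualFamily σ τ P e a b) : n ≤ Module.finrank ℝ A := by
  have hl : LinearIndependent ℝ a := by
    refine Fintype.linearIndependent_iff.mpr fun g hg j => ?_
    have := congrArg (fun x => P x (b j)) hg
    simpa [h.dual] using this
  simpa using hl.fintype_card_le_finrank

/-- A dual family can be enlarged as long as `P` does not vanish on its orthogonal complements: of
the components of the two vectors with equal signs, one pair is not orthogonal. -/
theorem IsDualFamily.extend (hσ : ∀ a, σ (σ a) = a) (hτ : ∀ b, τ (τ b) = b)
    (hP : ∀ a b, P (σ a) (τ b) = P a b) {n : ℕ} {e : Fin n → ℤ} {a : Fin n → A}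
    {b : Fin n → B} (h : IsDualFamily σ τ P e a b) {x : A} {y : B} (hx : ∀ j, P x (b j) = 0)
    (hy : ∀ i, P (a i) y = 0) (hxy : P x y ≠ 0) :
    ∃ (e' : Fin (n + 1) → ℤ) (a' : Fin (n + 1) → A) (b' : Fin (n + 1) → B),
      IsDualFamily σ τ P e' a' b' := by
  have hx' : ∀ j, P (σ x) (b j) = 0 := fun j => by
    rw [← hP, hσ, h.right, map_zsmul, hx, smul_zero]
  have hy' : ∀ i, P (a i) (τ y) = 0 := fun i => by
    rw [← hP, hτ, h.left, map_zsmul, LinearMap.smul_apply, hy, smul_zero]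
  have hsum : P (x + σ x) (y + τ y) + P (x - σ x) (y - τ y) = 4 * P x y := by
    have h1 := hP x y
    simp only [map_add, map_sub, LinearMap.add_apply, LinearMap.sub_apply]
    linarith
  -- The case of components of a given sign `s`.
  have key : ∀ s : ℤ, s = 1 ∨ s = -1 → P (x + s • σ x) (y + s • τ y) ≠ 0 →
      ∃ (e' : Fin (n + 1) → ℤ) (a' : Fin (n + 1) → A) (b' : Fin (n + 1) → B),
        IsDualFamily σ τ P e' a' b' := by
    intro s hs hne
    have hss : s * s = 1 := by rcases hs with rfl | rfl <;> rfl
    obtain ⟨c, hc⟩ : ∃ c, c * P (x + s • σ x) (y + s • τ y) = 1 := ⟨_, inv_mul_cancel₀ hne⟩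
    refine ⟨Fin.cons s e, Fin.cons (c • (x + s • σ x)) a,
      Fin.cons (y + s • τ y) b, ?_, ?_, ?_, ?_⟩
    · intro i
      refine Fin.cases ?_ (fun i => ?_) i
      · exact hs
      · exact h.sign i
    · intro i
      refine Fin.cases ?_ (fun i => ?_) i
      · simp only [Fin.cons_zero, map_smul, map_add, map_zsmul, hσ]
        rw [smul_comm s, smul_add s, smul_smul, hss, one_smul, add_comm (σ x)]
      · simpa using h.left i
    · intro i
      refine Fin.cases ?_ (fun i => ?_) i
      · simp only [Fin.cons_zero, map_add, map_zsmul, hτ]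
        rw [smul_add, smul_smul, hss, one_smul, add_comm (τ y)]
      · simpa using h.right i
    · intro i j
      refine Fin.cases ?_ (fun i => ?_) i <;> refine Fin.cases ?_ (fun j => ?_) j
      · simp only [Fin.cons_zero, map_smul, LinearMap.smul_apply, smul_eq_mul]
        exact hc.trans (if_pos trivial).symm
      · simp only [Fin.cons_zero, Fin.cons_succ, map_smul, LinearMap.smul_apply, map_add,
          LinearMap.add_apply, map_zsmul, hx, hx', smul_zero, add_zero]
        rw [if_neg (Fin.succ_ne_zero j).symm]
      · simp only [Fin.cons_zero, Fin.cons_succ, map_add, map_zsmul, hy, hy', smul_zero, add_zero]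
        rw [if_neg (Fin.succ_ne_zero i)]
      · simp [h.dual]
  by_cases h1 : P (x + σ x) (y + τ y) = 0
  · refine key (-1) (Or.inr rfl) fun h2 => hxy ?_
    simp only [neg_smul, one_smul, ← sub_eq_add_neg] at h2
    linarith
  · exact key 1 (Or.inl rfl) (by simpa using h1)

variable (σ τ P)

/-- An invariant pairing has dual families of eigenvectors which span complements of its null
spaces. -/
theorem exists_isDualFamily [FiniteDimensional ℝ A] (hσ : ∀ a, σ (σ a) = a)
    (hτ : ∀ b, τ (τ b) = b) (hP : ∀ a b, P (σ a) (τ b) = P a b) :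
    ∃ (n : ℕ) (e : Fin n → ℤ) (a : Fin n → A) (b : Fin n → B), IsDualFamily σ τ P e a b ∧
      (∀ x, (∀ j, P x (b j) = 0) → ∀ y, P x y = 0) ∧
      ∀ y, (∀ i, P (a i) y = 0) → ∀ x, P x y = 0 := by
  classical
  let Q : ℕ → Prop := fun n => ∃ (e : Fin n → ℤ) (a : Fin n → A) (b : Fin n → B),
    IsDualFamily σ τ P e a b
  have h0 : Q 0 := ⟨fun i => i.elim0, fun i => i.elim0, fun i => i.elim0, fun i => i.elim0,
    fun i => i.elim0, fun i => i.elim0, fun i => i.elim0⟩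
  have hle : ∀ n, Q n → n ≤ Module.finrank ℝ A := fun n ⟨_, _, _, h⟩ => h.le_finrank
  obtain ⟨e, a, b, h⟩ : Q (Nat.findGreatest Q (Module.finrank ℝ A)) :=
    Nat.findGreatest_spec (Nat.zero_le _) h0
  have hmax : ¬Q (Nat.findGreatest Q (Module.finrank ℝ A) + 1) := fun hq =>
    absurd (Nat.le_findGreatest (hle _ hq) hq) (Nat.not_succ_le_self _)
  refine ⟨_, e, a, b, h, fun x hx y => ?_, fun y hy x => ?_⟩ <;> by_contra hne
  · refine hmax (h.extend hσ hτ hP (x := x) (y := y - ∑ i, P (a i) y • b i) hx (fun j => ?_) ?_)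
    · simp [h.dual]
    · simpa [hx] using hne
  · refine hmax (h.extend hσ hτ hP (x := x - ∑ i, P x (b i) • a i) (y := y) (fun j => ?_) hy ?_)
    · simp [h.dual]
    · simpa [hy] using hne

end

/-! ### Real dual families of tangent vectors -/

section
variable {R : Type u} [Ring R] [Algebra ℝ R] [SuperAlgebra R] {ψ : Coord → R}

/-- The contraction of `ω` with a vector along the even coordinates in the second argument. -/
theorem omegaF_even_right {δ' : Coord → R} (hx : ∀ a, δ' (.xi a) = 0)
    (hr : ∀ a b, δ' (.rho a b) = 0) (δ : Coord → R) : omegaF ψ δ δ' =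
      ∑ a, ∑ b, (eta a * eta b) • (δ (.rho a b) * xiHodge ψ (fun n m => δ' (.W a b n m)))
      - (2 : ℕ) • ∑ a, eta a • (δ (.xi a) * xiHodge ψ (fun n m => δ' (.C a n m))) := by
  simp only [omegaF, betaR_eq, gammaR_eq, hx, hr, mul_zero, Finset.sum_const_zero, add_zero]

end

instance {Λ : Type*} [AddCommGroup Λ] [Module ℝ Λ] [FiniteDimensional ℝ Λ] :
    FiniteDimensional ℝ (OddExt Λ) := inferInstanceAs (FiniteDimensional ℝ (Λ × Λ))

/-- Values of tangent vectors along `ξ` and `ρ`, before antisymmetrization. -/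
abbrev OddPart : Type := (Fin 4 → ThetaExt ℝ) × (Fin 4 → Fin 4 → ThetaExt ℝ)

/-- The tangent vector with given components along `ξ` and `ρ`. -/
def oddVec : OddPart →ₗ[ℝ] (Coord → ThetaExt ℝ) where
  toFun a := vec a.1 (fun p q => a.2 p q - a.2 q p) 0 0
  map_add' a b := by funext i; cases i <;> simp [vec]; abel
  map_smul' c a := by funext i; cases i <;> simp [vec, smul_sub]

theorem isTensor_oddVec (a : OddPart) : IsTensor (oddVec a) :=
  isTensor_vec (fun _ _ => (neg_sub _ _).symm) IsWeyl.zero IsCotton.zero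

/-- Tangent vectors along the even coordinates. -/
def evenTangent : Submodule ℝ (Coord → ThetaExt ℝ) where
  carrier := {δ | IsTensor δ ∧ ∀ i : Coord, i.ghost = 1 → δ i = 0}
  add_mem' hx hy := ⟨hx.1.add hy.1, fun i hi => by simp [hx.2 i hi, hy.2 i hi]⟩
  zero_mem' := ⟨IsTensor.zero, fun _ _ => rfl⟩
  smul_mem' c x hx := ⟨IsTensor.smul c hx.1, fun i hi => by simp [hx.2 i hi]⟩

theorem omegaF_add_right {R : Type*} [Ring R] (ψ δ δ₁ δ₂ : Coord → R) :
    omegaF ψ δ (δ₁ + δ₂) = omegaF ψ δ δ₁ + omegaF ψ δ δ₂ := by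
  simp only [omegaF, betaR, gammaR, Pi.add_apply, mul_add, smul_add, Finset.sum_add_distrib]
  abel

theorem omegaF_smul_right {R : Type*} [Ring R] [Algebra ℝ R] (r : ℝ) (ψ δ δ' : Coord → R) :
    omegaF ψ δ (r • δ') = r • omegaF ψ δ δ' := by
  have h := omegaF_mul_right ψ δ δ' (algebraMap ℝ R r)
  simp only [← Algebra.commutes, ← Algebra.smul_def] at h
  exact h

/-- The form `ω̄` at the flat point, paired between vectors along the odd and the even
coordinates. -/
def flatPairing : OddPart →ₗ[ℝ] evenTangent →ₗ[ℝ] ℝ :=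
  LinearMap.mk₂ ℝ (fun a b => omegaBar (flatPoint ℝ) (oddVec a) b)
    (fun a a' b => by
      simp only [omegaBar, map_add, omegaF_add, berezin_add])
    (fun c a b => by
      simp only [omegaBar, map_smul, omegaF_smul, berezin_smul, smul_eq_mul])
    (fun a b b' => by
      simp only [omegaBar, Submodule.coe_add, omegaF_add_right, berezin_add])
    (fun c a b => by
      simp only [omegaBar, Submodule.coe_smul, omegaF_smul_right, berezin_smul, smul_eq_mul])

theorem flatPairing_apply (a : OddPart) (b : evenTangent) :
    flatPairing a b = omegaBar (flatPoint ℝ) (oddVec a) b := rfl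

/-- Graded symmetry under the Berezin integral over an even number of variables. -/
theorem berezin_mul_comm {s : ℤ} (hs : s = 1 ∨ s = -1) {z : ThetaExt ℝ} (hz : par z = s • z)
    (x : ThetaExt ℝ) : berezin (x * z) = s • berezin (z * x) := by
  rcases hs with rfl | rfl
  · rw [one_smul] at hz
    rw [one_smul, even_mul _ _ hz]
  · rw [neg_one_smul] at hz
    rw [← OddExt.odd_mul_any hz x, neg_one_smul]
    calc berezin (z * par x) = berezin (par (z * par x)) := (berezin_par (z * par x)).symm
      _ = -berezin (z * x) := by rw [map_mul, par_par, hz, neg_mul]; rfl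

/-- Parity of tangent vectors. -/
def parOdd : OddPart →ₗ[ℝ] OddPart where
  toFun a := (fun p => par (a.1 p), fun p q => par (a.2 p q))
  map_add' a b := by ext <;> simp
  map_smul' c a := by ext <;> simp

/-- Parity of tangent vectors along the even coordinates. -/
def parEven : evenTangent →ₗ[ℝ] evenTangent where
  toFun b := ⟨fun i => par (b.1 i),
    b.2.1.map (par (Λ := ThetaExt ℝ) : ThetaExt ℝ →+ ThetaExt ℝ),
    fun i hi => (congrArg _ (b.2.2 i hi)).trans (map_zero _)⟩
  map_add' a b := by ext; simp
  map_smul' c a := by ext; simp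

theorem xiHodge_par {R : Type u} [Ring R] [Algebra ℝ R] [SuperAlgebra R] {ψ : Coord → R}
    (h : IsPoint ψ) (T : Fin 4 → Fin 4 → R) :
    xiHodge (fun i => par (ψ i)) T = xiHodge ψ T := by
  simp only [xiHodge, h.par_xi, neg_mul_neg]

theorem flatPairing_par (a : OddPart) (b : evenTangent) :
    flatPairing (parOdd a) (parEven b) = flatPairing a b := by
  rw [flatPairing_apply, flatPairing_apply]
  have h1 : oddVec (parOdd a) = fun i => par (oddVec a i) := by
    funext i; cases i <;> simp [oddVec, vec, parOdd]
  have h2 : ∀ δ, omegaF (flatPoint ℝ) δ (parEven b) =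
      omegaF (fun i => par (flatPoint ℝ i)) δ (parEven b) := fun δ => by
    rw [omegaF_even_right (fun a => (parEven b).2.2 _ rfl) (fun a c => (parEven b).2.2 _ rfl),
      omegaF_even_right (fun a => (parEven b).2.2 _ rfl) (fun a c => (parEven b).2.2 _ rfl)]
    simp only [xiHodge_par (isPoint_flatPoint ℝ)]
  have h3 := omegaF_map (par (Λ :=
    ThetaExt ℝ) : ThetaExt ℝ →+* ThetaExt ℝ) (flatPoint ℝ) (oddVec a) b
  calc omegaBar (flatPoint ℝ) (oddVec (parOdd a)) (parEven b)
      = berezin (par (omegaF (flatPoint ℝ) (oddVec a) b)) := by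
        refine (congrArg berezin ((h2 _).trans ?_))
        rw [h1]
        exact h3
    _ = omegaBar (flatPoint ℝ) (oddVec a) b := berezin_par _

/-- The contractions of `ω` with vectors along odd and along even coordinates agree up to the order
of the factors. -/
theorem berezin_omegaF_swap {s : ℤ} (hs : s = 1 ∨ s = -1) {a b : Coord → ThetaExt ℝ}
    (ha : ∀ i : Coord, par (a i) = s • a i) (hb : ∀ i : Coord, i.ghost = 1 → b i = 0) :
    berezin (omegaF (flatPoint ℝ) b a) = s • berezin (omegaF (flatPoint ℝ) a b) := by
  rw [omegaF_even_right (fun a => hb _ rfl) (fun a c => hb _ rfl),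
    omegaF_even (isPoint_flatPoint ℝ) (fun a => hb _ rfl) (fun a c => hb _ rfl)]
  have hz : ∀ (n : ℤ) (x : ThetaExt ℝ), berezin (n • x) = n • berezin x := fun _ _ => rfl
  have hn : ∀ (n : ℕ) (x : ThetaExt ℝ), berezin (n • x) = n • berezin x := fun _ _ => rfl
  simp only [berezin_sub, berezin_sum, hz, hn, berezin_mul_comm hs (ha _), smul_sub,
    Finset.smul_sum, smul_comm s]

theorem omegaF_eq_oddVec {x y : Coord → ThetaExt ℝ} (hx : IsTensor x)
    (hy : ∀ k : Coord, k.ghost = 1 → y k = 0) : omegaF (flatPoint ℝ) x y = omegaF (flatPoint ℝ)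
      (oddVec (fun p => x (.xi p), fun p q => (1 / 2 : ℝ) • x (.rho p q))) y := by
  rw [omegaF_even_right (fun a => hy _ rfl) (fun a c => hy _ rfl),
    omegaF_even_right (fun a => hy _ rfl) (fun a c => hy _ rfl)]
  congr 1
  refine Finset.sum_congr rfl fun p _ => Finset.sum_congr rfl fun q _ => ?_
  congr 2
  simp only [oddVec, vec, LinearMap.coe_mk, AddHom.coe_mk, hx.rho_antisymm p q]
  module

/-- Families of real tangent vectors at the flat point, along the odd and along the even
coordinates, which are homogeneous and dual with respect to `ω̄`, and span complements of the null
spaces. -/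
theorem exists_flat_dual :
    ∃ (n : ℕ) (e : Fin n → ℤ) (a b : Fin n → Coord → ThetaExt ℝ),
      (∀ i, e i = 1 ∨ e i = -1) ∧
      (∀ i, IsTensor (a i) ∧ (∀ k : Coord, k.ghost = 0 → a i k = 0) ∧
        ∀ k, par (a i k) = e i • a i k) ∧
      (∀ i, IsTensor (b i) ∧ (∀ k : Coord, k.ghost = 1 → b i k = 0) ∧
        ∀ k, par (b i k) = e i • b i k) ∧
      (∀ i j, omegaBar (flatPoint ℝ) (a i) (b j) = if i = j then 1 else 0) ∧
      (∀ i j, omegaBar (flatPoint ℝ) (b i) (a j) = if i = j then (e i : ℝ) else 0) ∧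
      (∀ x, IsTensor x → (∀ j, omegaBar (flatPoint ℝ) x (b j) = 0) →
        ∀ y, IsTensor y → (∀ k : Coord, k.ghost = 1 → y k = 0) → omegaF (flatPoint ℝ) x y = 0) ∧
      (∀ y, IsTensor y → (∀ k : Coord, k.ghost = 1 → y k = 0) →
        (∀ i, omegaBar (flatPoint ℝ) y (a i) = 0) → y ∈ kerOmega (flatPoint ℝ)) := by
  obtain ⟨n, e, a, b, h, hA, hB⟩ := exists_isDualFamily parOdd parEven flatPairing
    (fun a => by ext <;> simp [parOdd, par_par]) (fun b => by ext; simp [parEven, par_par])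
    flatPairing_par
  simp only [flatPairing_apply] at hA hB
  have hd := h.dual
  simp only [flatPairing_apply] at hd
  have ha : ∀ i k, par (oddVec (a i) k) = e i • oddVec (a i) k := by
    intro i k
    have h1 := h.left i
    have h2 : ∀ p, par ((a i).1 p) = e i • (a i).1 p := fun p =>
      congrFun (congrArg Prod.fst h1) p
    have h3 : ∀ p q, par ((a i).2 p q) = e i • (a i).2 p q := fun p q =>
      congrFun (congrFun (congrArg Prod.snd h1) p) q
    cases k <;> simp [oddVec, vec, h2, h3, smul_sub, -zsmul_eq_mul]
  have hb : ∀ i k, par ((b i).1 k) = e i • (b i).1 k := fun i k =>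
    congrFun (congrArg Subtype.val (h.right i)) k
  refine ⟨n, e, fun i => oddVec (a i), fun i => (b i).1, h.sign, fun i => ⟨isTensor_oddVec _,
    fun k hk => ?_, ha i⟩, fun i => ⟨(b i).2.1, (b i).2.2, hb i⟩, hd, fun i j => ?_,
    fun x hx hxb y hy hyo => ?_, fun y hy hyo hya => ?_⟩
  · cases k <;> simp [Coord.ghost, oddVec, vec] at hk ⊢
  · refine (berezin_omegaF_swap (h.sign j) (ha j) (b i).2.2).trans ?_
    refine (congrArg _ (hd j i)).trans ?_
    by_cases hij : i = j
    · subst hij; simp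
    · simp [hij, Ne.symm hij]
  · refine eq_zero_of_berezin_mul_right _ fun g => ?_
    rw [← omegaF_mul_right, omegaF_eq_oddVec hx fun k hk => by rw [hyo k hk, zero_mul]]
    refine hA _ (fun j => ?_) ⟨fun i => y i * g, hy.map (AddMonoidHom.mulRight g),
      fun k hk => by simp [hyo k hk]⟩
    exact (congrArg berezin (omegaF_eq_oddVec hx (b j).2.2)).symm.trans (hxb j)
  · have key : ∀ x, IsTensor x → omegaBar (flatPoint ℝ) x y = 0 := fun x hx => by
      rw [omegaBar, omegaF_eq_oddVec hx hyo]
      refine hB ⟨y, hy, hyo⟩ (fun i => ?_) _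
      have h2 := (berezin_omegaF_swap (h.sign i) (ha i) hyo).symm.trans (hya i)
      rcases h.sign i with hi | hi <;> simpa [hi, omegaBar] using h2
    refine mem_kerOmegaBar_iff.mp ⟨hy, fun x hx => ?_⟩
    -- The homogeneous parts of `x` can be moved to the first argument.
    have hx' : IsTensor fun i => par (x i) :=
      hx.map (par (Λ := ThetaExt ℝ) : ThetaExt ℝ →+ ThetaExt ℝ)
    let p : Coord → ThetaExt ℝ := x + fun i => par (x i)
    let m : Coord → ThetaExt ℝ := x + (-1 : ℝ) • fun i => par (x i)
    have hp := key p (hx.add hx')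
    have hm := key m (hx.add (hx'.smul (-1 : ℝ)))
    have h1 := berezin_omegaF_swap (s := 1) (Or.inl rfl) (a := p) (fun i => by
      simp [p, par_par, add_comm]) hyo
    have h2 := berezin_omegaF_swap (s := -1) (Or.inr rfl) (a := m) (fun i => by
      simp [m, par_par, add_comm]) hyo
    rw [omegaBar] at hp hm
    rw [hp, smul_zero, omegaF_add_right, berezin_add] at h1
    rw [hm, smul_zero, omegaF_add_right, omegaF_smul_right, berezin_add, berezin_smul] at h2
    rw [omegaBar]
    linarith

/-! ### Complements of the kernel -/

section
variable {Λ : Type u} [Ring Λ] [Algebra ℝ Λ] [SuperAlgebra Λ] {ψ : Coord → ThetaExt Λ}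

theorem eq_zero_of_mapCoef {x : ThetaExt Λ} (h : ∀ φ : Λ →ₗ[ℝ] ℝ, mapCoef φ x = 0) : x = 0 := by
  obtain ⟨n, b, φ, hx⟩ := exists_real_expansion (fun _ : Unit => x)
  rw [hx ()]
  simp [h]

theorem berezin_mapCoef (φ : Λ →ₗ[ℝ] ℝ) (x : ThetaExt Λ) :
    berezin (mapCoef φ x) = φ (berezin x) := rfl

theorem xiHodge_ofReal (hθ : ∀ a, ψ (.xi a) = theta a) (T : Fin 4 → Fin 4 → ThetaExt ℝ) :
    xiHodge ψ (fun n m => ofReal (T n m)) = ofReal (xiHodge (flatPoint ℝ) T) := by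
  have h1 : ∀ p, ψ (.xi p) = ofReal (flatPoint ℝ (.xi p)) := fun p => by
    rw [hθ]; exact (ofReal_theta p).symm
  simp only [xiHodge, map_sum, map_zsmul, map_mul, h1]

/-- If `ξ_a = θ_a`, pairing with a real vector along the even coordinates commutes with real
functionals of the coefficients. -/
theorem mapCoef_omegaF_right (hθ : ∀ a, ψ (.xi a) = theta a) (φ : Λ →ₗ[ℝ] ℝ)
    (δ : Coord → ThetaExt Λ) {b : Coord → ThetaExt ℝ} (hb : ∀ k : Coord, k.ghost = 1 → b k = 0) :
    mapCoef φ (omegaF ψ δ fun i => ofReal (b i)) =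
      omegaF (flatPoint ℝ) (fun i => mapCoef φ (δ i)) b := by
  rw [omegaF_even_right (fun a => by rw [hb _ rfl, map_zero])
      (fun a c => by rw [hb _ rfl, map_zero]),
    omegaF_even_right (fun a => hb _ rfl) (fun a c => hb _ rfl)]
  simp only [xiHodge_ofReal hθ, map_sub, map_sum, map_zsmul, map_nsmul, mapCoef_mul_ofReal]

/-- If `ξ_a = θ_a`, pairing a vector along the even coordinates with a real vector commutes with real
functionals of the coefficients. -/
theorem mapCoef_omegaF_left (h : IsPoint ψ) (hθ : ∀ a, ψ (.xi a) = theta a) (φ : Λ →ₗ[ℝ] ℝ)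
    {δ : Coord → ThetaExt Λ} (hδ : ∀ k : Coord, k.ghost = 1 → δ k = 0) (a : Coord → ThetaExt ℝ) :
    mapCoef φ (omegaF ψ δ fun i => ofReal (a i)) =
      omegaF (flatPoint ℝ) (fun i => mapCoef φ (δ i)) a := by
  rw [omegaF_even h (fun a => hδ _ rfl) (fun a c => hδ _ rfl),
    omegaF_even (isPoint_flatPoint ℝ) (fun a => by rw [hδ _ rfl, map_zero])
      (fun a c => by rw [hδ _ rfl, map_zero])]
  simp only [mapCoef_xiHodge h hθ, map_sub, map_sum, map_zsmul, map_nsmul, mapCoef_mul_ofReal]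

theorem omegaF_ofReal_right (hθ : ∀ a, ψ (.xi a) = theta a) (a : Coord → ThetaExt ℝ)
    {b : Coord → ThetaExt ℝ} (hb : ∀ k : Coord, k.ghost = 1 → b k = 0) :
    omegaF ψ (fun i => ofReal (a i)) (fun i => ofReal (b i)) =
      ofReal (omegaF (flatPoint ℝ) a b) := by
  rw [omegaF_even_right (fun a => by rw [hb _ rfl, map_zero])
      (fun a c => by rw [hb _ rfl, map_zero]),
    omegaF_even_right (fun a => hb _ rfl) (fun a c => hb _ rfl)]
  simp only [xiHodge_ofReal hθ, map_sub, map_sum, map_zsmul, map_nsmul, map_mul]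

theorem omegaF_ofReal_left (h : IsPoint ψ) (hθ : ∀ a, ψ (.xi a) = theta a)
    {b : Coord → ThetaExt ℝ} (hb : ∀ k : Coord, k.ghost = 1 → b k = 0) (a : Coord → ThetaExt ℝ) :
    omegaF ψ (fun i => ofReal (b i)) (fun i => ofReal (a i)) =
      ofReal (omegaF (flatPoint ℝ) b a) := by
  rw [omegaF_even h (fun a => by rw [hb _ rfl, map_zero]) (fun a c => by rw [hb _ rfl, map_zero]),
    omegaF_even (isPoint_flatPoint ℝ) (fun a => hb _ rfl) (fun a c => hb _ rfl)]
  simp only [xiHodge_ofReal hθ, map_sub, map_sum, map_zsmul, map_nsmul, map_mul]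

theorem isTensor_ofReal {a : Coord → ThetaExt ℝ} (ha : IsTensor a) :
    IsTensor fun i => (ofReal (a i) : ThetaExt Λ) :=
  ha.map (ofReal : ThetaExt ℝ →ₐ[ℝ] ThetaExt Λ).toRingHom.toAddMonoidHom

/-- A vector orthogonal to the family `b` differs by an element of the kernel from a vector along
the even coordinates. -/
theorem exists_even_sub_mem (h : IsPoint ψ) (hθ : ∀ a, ψ (.xi a) = theta a) {n : ℕ}
    {b : Fin n → Coord → ThetaExt ℝ} (hbe : ∀ i, ∀ k : Coord, k.ghost = 1 → b i k = 0)
    (hb : ∀ x, IsTensor x → (∀ j, omegaBar (flatPoint ℝ) x (b j) = 0) →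
        ∀ y, IsTensor y → (∀ k : Coord, k.ghost = 1 → y k = 0) → omegaF (flatPoint ℝ) x y = 0)
    {δ : Coord → ThetaExt Λ} (hδ : IsTensor δ)
    (hδb : ∀ j, omegaBar ψ δ (fun i => ofReal (b j i)) = 0) :
    ∃ δ', IsTensor δ' ∧ (∀ k : Coord, k.ghost = 1 → δ' k = 0) ∧ δ - δ' ∈ kerOmega ψ := by
  have key : ∀ y : Coord → ThetaExt ℝ, IsTensor y → (∀ k : Coord, k.ghost = 1 → y k = 0) →
      omegaF ψ δ (fun i => ofReal (y i)) = 0 := fun y hy hyo => by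
    refine eq_zero_of_mapCoef fun φ => ?_
    rw [mapCoef_omegaF_right hθ φ δ hyo]
    refine hb _ (hδ.map (mapCoef φ).toAddMonoidHom) (fun j => ?_) y hy hyo
    have h1 := mapCoef_omegaF_right hθ φ δ (hbe j)
    refine (congrArg berezin h1).symm.trans ?_
    rw [berezin_mapCoef]
    exact (congrArg φ (hδb j)).trans (map_zero φ)
  have hreal : ∀ r : ℝ, (ofReal (algebraMap ℝ (ThetaExt ℝ) r) : ThetaExt Λ) =
      algebraMap ℝ (ThetaExt Λ) r := fun r => AlgHom.commutes _ r
  have hc : ∀ c : Fin 4 → Fin 4 → Fin 4 → ℝ, IsCotton c →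
      omegaF ψ δ (vec 0 0 0 fun a n m => algebraMap ℝ (ThetaExt Λ) (c a n m)) = 0 := fun c hc => by
    have h1 := key (vec 0 0 0 fun a n m => algebraMap ℝ (ThetaExt ℝ) (c a n m))
      (isTensor_vec (by simp) IsWeyl.zero (hc.map (algebraMap ℝ (ThetaExt ℝ) : ℝ →+ ThetaExt ℝ)))
      (fun k hk => by cases k <;> simp [vec, Coord.ghost] at hk ⊢)
    convert h1 using 2
    funext k
    cases k <;> simp [vec, hreal]
  have hw : ∀ w : Fin 4 → Fin 4 → Fin 4 → Fin 4 → ℝ, IsWeyl w → omegaF ψ δ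
      (vec 0 0 (fun a b n m => algebraMap ℝ (ThetaExt Λ) (w a b n m)) 0) = 0 := fun w hw => by
    have h1 := key (vec 0 0 (fun a b n m => algebraMap ℝ (ThetaExt ℝ) (w a b n m)) 0)
      (isTensor_vec (by simp) (hw.map (algebraMap ℝ (ThetaExt ℝ) : ℝ →+ ThetaExt ℝ)) IsCotton.zero)
      (fun k hk => by cases k <;> simp [vec, Coord.ghost] at hk ⊢)
    convert h1 using 2
    funext k
    cases k <;> simp [vec, hreal]
  obtain ⟨κ, -, hκ, hx, hr⟩ := exists_sub_mem_kernelSpan h hθ hδ (isCottonNull_of_omegaF hc)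
    (isWeylNull_of_omegaF hw)
  have ht : IsTensor (δ - κ) := (tangent Λ).sub_mem hδ hκ.1
  let δ' : Coord → ThetaExt Λ := vec 0 0 (fun a b n m => (δ - κ) (.W a b n m))
    (fun a n m => (δ - κ) (.C a n m))
  have ht' : IsTensor δ' := isTensor_vec (by simp) ht.weyl ht.cotton
  refine ⟨δ', ht', fun k hk => by cases k <;> simp [δ', vec, Coord.ghost] at hk ⊢, ?_⟩
  have e : δ - δ' = κ + (δ - κ - δ') := by abel
  rw [e]
  refine (kerOmegaModule ψ).add_mem hκ (mem_kerOmega_of_xiHodge h ((tangent Λ).sub_mem ht ht')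
    (fun a => ?_) (fun a b => ?_) (fun a b => ?_) (fun a => ?_))
  · simp [δ', vec, hx]
  · simp [δ', vec, hr]
  · simpa [δ', vec] using xiHodge_zero ψ
  · simpa [δ', vec] using xiHodge_zero ψ

/-- A vector along the even coordinates, orthogonal to the family `a`, lies in the kernel. -/
theorem mem_kerOmega_of_even (h : IsPoint ψ) (hθ : ∀ a, ψ (.xi a) = theta a) {n : ℕ}
    {a : Fin n → Coord → ThetaExt ℝ}
    (ha : ∀ y, IsTensor y → (∀ k : Coord, k.ghost = 1 → y k = 0) →
        (∀ i, omegaBar (flatPoint ℝ) y (a i) = 0) → y ∈ kerOmega (flatPoint ℝ))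
    {δ : Coord → ThetaExt Λ} (hδ : IsTensor δ) (hδe : ∀ k : Coord, k.ghost = 1 → δ k = 0)
    (hδa : ∀ j, omegaBar ψ δ (fun i => ofReal (a j i)) = 0) : δ ∈ kerOmega ψ := by
  have key : ∀ φ : Λ →ₗ[ℝ] ℝ, (fun i => mapCoef φ (δ i)) ∈ kerOmega (flatPoint ℝ) := fun φ => by
    refine ha _ (hδ.map (mapCoef φ).toAddMonoidHom) (fun k hk => by rw [hδe k hk, map_zero])
      fun j => ?_
    have h1 := mapCoef_omegaF_left h hθ φ hδe (a j)
    refine (congrArg berezin h1).symm.trans ?_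
    rw [berezin_mapCoef]
    exact (congrArg φ (hδa j)).trans (map_zero φ)
  have key' := fun φ => xiHodge_eq_zero_of_mem_kerOmega (isPoint_flatPoint ℝ) (key φ)
    (fun a => by rw [hδe _ rfl, map_zero]) (fun a b => by rw [hδe _ rfl, map_zero])
  refine mem_kerOmega_of_xiHodge h hδ (fun a => hδe _ rfl) (fun a b => hδe _ rfl)
    (fun a b => eq_zero_of_mapCoef fun φ => ?_) (fun a => eq_zero_of_mapCoef fun φ => ?_)
  · rw [← mapCoef_xiHodge h hθ]
    exact (key' φ).1 a b
  · rw [← mapCoef_xiHodge h hθ]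
    exact (key' φ).2 a

/-- A Gram matrix of two dual families, the second of which is isotropic, is invertible. -/
theorem isUnit_gram {n : ℕ} (M : Matrix (Fin n) (Fin n) Λ) (e : Fin n → Λ)
    (he : ∀ i, e i * e i = 1) :
    IsUnit (Matrix.fromBlocks M 1 (Matrix.diagonal e) 0 :
      Matrix (Fin n ⊕ Fin n) (Fin n ⊕ Fin n) Λ) := by
  have h1 : Matrix.diagonal e * Matrix.diagonal e = 1 := by
    rw [Matrix.diagonal_mul_diagonal]
    simp [he]
  refine ⟨⟨Matrix.fromBlocks M 1 (Matrix.diagonal e) 0,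
    Matrix.fromBlocks 0 (Matrix.diagonal e) 1 (-(M * Matrix.diagonal e)), ?_, ?_⟩, rfl⟩
  · rw [Matrix.fromBlocks_multiply]
    simp [h1]
  · rw [Matrix.fromBlocks_multiply]
    simp [h1, Matrix.mul_assoc]

theorem isUnit_submatrix {ι κ : Type*} [Fintype ι] [DecidableEq ι] [Fintype κ] [DecidableEq κ]
    {M : Matrix ι ι Λ} (hM : IsUnit M) (τ : κ ≃ ι) : IsUnit (M.submatrix τ τ) := by
  obtain ⟨⟨M, N, h1, h2⟩, rfl⟩ := hM
  refine ⟨⟨M.submatrix τ τ, N.submatrix τ τ, ?_, ?_⟩, rfl⟩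
  · rw [Matrix.submatrix_mul_equiv, h1, Matrix.submatrix_one_equiv]
  · rw [Matrix.submatrix_mul_equiv, h2, Matrix.submatrix_one_equiv]

end

/-! ### The rank of the induced form -/

/-- The exchange of the two copies of `i` for the indices `i` with `P i`. -/
def swapAt {n : ℕ} (P : Fin n → Prop) [DecidablePred P] : Equiv.Perm (Fin n ⊕ Fin n) :=
  Function.Involutive.toPerm (Sum.elim (fun i => if P i then .inr i else .inl i)
    (fun i => if P i then .inl i else .inr i)) fun x => by
      rcases x with i | i <;> by_cases h : P i <;> simp [h]

theorem swapAt_inl {n : ℕ} (P : Fin n → Prop) [DecidablePred P] (i : Fin n) :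
    swapAt P (.inl i) = if P i then .inr i else .inl i := rfl

theorem swapAt_inr {n : ℕ} (P : Fin n → Prop) [DecidablePred P] (i : Fin n) :
    swapAt P (.inr i) = if P i then .inl i else .inr i := rfl

section
variable {Λ : Type u} [Ring Λ] [Algebra ℝ Λ] [SuperAlgebra Λ]

/-- Two dual families of homogeneous vectors, the second of them isotropic, which span a complement
of the kernel: as dual vectors have opposite parities, one of each pair is even. -/
theorem hasRank_of_dual {ψ : Coord → ThetaExt Λ} {n : ℕ} {e : Fin n → ℤ}
    (he : ∀ i, e i = 1 ∨ e i = -1) {A B : Fin n → Coord → ThetaExt Λ}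
    (hA : ∀ i, IsTensor (A i)) (hB : ∀ i, IsTensor (B i))
    (hAp : ∀ i t, e i = (-1 : ℤ) ^ (1 + t) → HasParity t (A i))
    (hBp : ∀ i t, e i = (-1 : ℤ) ^ (0 + t) → HasParity t (B i))
    (hAB : ∀ i j, omegaBar ψ (A i) (B j) = if i = j then 1 else 0)
    (hBA : ∀ i j, omegaBar ψ (B i) (A j) = if i = j then (e i : Λ) else 0)
    (hBB : ∀ i j, omegaBar ψ (B i) (B j) = 0)
    (hspan : ∀ δ, IsTensor δ →
      δ ∈ Submodule.span Λ (Set.range (Sum.elim A B)) ⊔ kerOmegaBar ψ) : HasRank ψ n n := by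
  have hη : ∀ i, (e i : Λ) * e i = 1 := fun i => by
    rcases he i with h | h <;> simp [h]
  have hu : ∀ i, IsTensor (Sum.elim A B i) := fun i => by
    rcases i with i | i
    exacts [hA i, hB i]
  have hgram : IsUnit (Matrix.of fun i j => omegaBar ψ (Sum.elim A B i) (Sum.elim A B j)) := by
    have : (Matrix.of fun i j => omegaBar ψ (Sum.elim A B i) (Sum.elim A B j)) =
        Matrix.fromBlocks (Matrix.of fun i j => omegaBar ψ (A i) (A j)) 1
          (Matrix.diagonal fun i => (e i : Λ)) 0 := by
      ext i j
      rcases i with i | i <;> rcases j with j | j <;>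
        simp [hAB, hBA, hBB, Matrix.one_apply, Matrix.diagonal_apply]
    rw [this]
    exact isUnit_gram _ _ hη
  obtain ⟨τ, hτ⟩ : ∃ τ, τ = swapAt fun i => e i = 1 := ⟨_, rfl⟩
  refine ⟨fun i => Sum.elim A B (τ i), fun i => hu _, fun i => ?_, fun i => ?_,
    ?_, ?_⟩
  · rcases he i with hi | hi
    · simpa [hτ, swapAt_inl, hi] using hBp i 0 (by simp [hi])
    · simpa [hτ, swapAt_inl, hi] using hAp i 0 (by simp [hi])
  · rcases he i with hi | hi
    · simpa [hτ, swapAt_inr, hi] using hAp i 1 (by simp [hi])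
    · simpa [hτ, swapAt_inr, hi] using hBp i 1 (by simp [hi])
  · have h1 := isUnit_submatrix hgram τ
    have e : (Matrix.of fun i j => omegaBar ψ (Sum.elim A B (τ i)) (Sum.elim A B (τ j))) =
        (Matrix.of fun i j => omegaBar ψ (Sum.elim A B i) (Sum.elim A B j)).submatrix τ τ := by
      ext i j
      rw [Matrix.submatrix_apply, Matrix.of_apply, Matrix.of_apply]
    rw [e]
    exact h1
  · have hr : Set.range (fun i => Sum.elim A B (τ i)) = Set.range (Sum.elim A B) :=
      τ.surjective.range_comp _
    rw [hr]
    refine le_antisymm (sup_le (Submodule.span_le.mpr ?_) fun δ hδ => hδ.1) hspan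
    rintro _ ⟨i, rfl⟩
    exact hu i

/-- If `ξ_a = θ_a`, then the tangent vectors are spanned by the families `a` and `b` and the
kernel.  The density `J` accounts for the change of coordinates of the Berezin integral. -/
theorem exists_decomposition {ψ : Coord → ThetaExt Λ} (h : IsPoint ψ)
    (hθ : ∀ a, ψ (.xi a) = theta a) {J J' : ThetaExt Λ} (hJJ : J' * J = 1) (hJ : par J = J)
    {n : ℕ} {e : Fin n → ℤ} (he : ∀ i, e i = 1 ∨ e i = -1)
    {a b : Fin n → Coord → ThetaExt ℝ}
    (hat : ∀ i, IsTensor (a i)) (hbt : ∀ i, IsTensor (b i))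
    (hbo : ∀ i, ∀ k : Coord, k.ghost = 1 → b i k = 0)
    (hB : ∀ x, IsTensor x → (∀ j, omegaBar (flatPoint ℝ) x (b j) = 0) →
        ∀ y, IsTensor y → (∀ k : Coord, k.ghost = 1 → y k = 0) → omegaF (flatPoint ℝ) x y = 0)
    (hA : ∀ y, IsTensor y → (∀ k : Coord, k.ghost = 1 → y k = 0) →
        (∀ i, omegaBar (flatPoint ℝ) y (a i) = 0) → y ∈ kerOmega (flatPoint ℝ))
    {A B : Fin n → Coord → ThetaExt Λ} (hAa : ∀ i k, A i k = ofReal (a i k))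
    (hBb : ∀ i k, B i k = ofReal (b i k))
    (hAB : ∀ i j, omegaBar ψ (A i) (B j) = if i = j then 1 else 0)
    (hBA : ∀ i j, omegaBar ψ (B i) (A j) = if i = j then (e i : Λ) else 0)
    {δ : Coord → ThetaExt Λ} (hδ : IsTensor δ) :
    ∃ (c d : Fin n → Λ), ∃ κ ∈ kerOmega ψ, δ = ∑ i, c i • A i + ∑ i, d i • J' • B i + κ := by
  have hη : ∀ i, (e i : Λ) * e i = 1 := fun i => by
    rcases he i with h | h <;> simp [h]
  have eA : ∀ i, (fun k => (ofReal (a i k) : ThetaExt Λ)) = A i := fun i =>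
    funext fun k => (hAa i k).symm
  have eB : ∀ i, (fun k => (ofReal (b i k) : ThetaExt Λ)) = B i := fun i =>
    funext fun k => (hBb i k).symm
  have hAt : ∀ i, IsTensor (A i) := fun i => eA i ▸ isTensor_ofReal (hat i)
  have hBt : ∀ i, IsTensor (B i) := fun i => eB i ▸ isTensor_ofReal (hbt i)
  have hBo : ∀ i, ∀ k : Coord, k.ghost = 1 → B i k = 0 := fun i k hk => by
    rw [hBb, hbo i k hk, map_zero]
  obtain ⟨Ω, hΩ⟩ : ∃ Ω : (Coord → ThetaExt Λ) → (Coord → ThetaExt Λ) →ₗ[Λ] Λ,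
      ∀ δ δ', omegaBar ψ δ δ' = Ω δ' δ :=
    ⟨fun δ' =>
      { toFun := fun δ => omegaBar ψ δ δ'
        map_add' := fun _ _ => by simp only [omegaBar, omegaF_add, berezin_add]
        map_smul' := fun _ _ => by simp only [omegaBar, omegaF_smul, berezin_smul]; rfl },
      fun _ _ => rfl⟩
  simp only [hΩ] at hAB hBA
  -- Subtraction of vectors along the odd coordinates.
  obtain ⟨δ₁, hδ₁, he₁, hk₁⟩ := exists_even_sub_mem h hθ hbo hB
    (δ := δ - ∑ i, Ω (B i) δ • A i)
    ((tangent Λ).sub_mem hδ (sum_mem fun i _ => (tangent Λ).smul_mem _ (hAt i))) fun j => by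
      rw [eB, hΩ]
      simp [hAB]
  -- Subtraction of vectors along the even coordinates.
  obtain ⟨d, hd⟩ : ∃ d : Fin n → Λ, ∀ i, d i * e i = Ω (A i) (J • δ₁) :=
    ⟨fun i => Ω (A i) (J • δ₁) * e i, fun i => by rw [mul_assoc, hη, mul_one]⟩
  have hswap : ∀ (c : Λ) (v : Coord → ThetaExt Λ), J • c • v = c • J • v := fun c v => by
    funext k
    simp only [Pi.smul_apply, smul_eq_mul, smul_eq_coeffs_mul]
    rw [← mul_assoc, even_mul _ _ hJ, mul_assoc]
  have hJd : J • (δ₁ - ∑ i, d i • J' • B i) = J • δ₁ - ∑ i, d i • B i := by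
    rw [smul_sub, Finset.smul_sum]
    simp only [hswap, smul_smul, even_mul _ J' hJ, hJJ, one_smul]
  have ht : IsTensor (J • δ₁ - ∑ i, d i • B i) := (tangent Λ).sub_mem (hδ₁.smul J)
    (sum_mem fun i _ => (tangent Λ).smul_mem _ (hBt i))
  have hk₂ : J • δ₁ - ∑ i, d i • B i ∈ kerOmega ψ := by
    refine mem_kerOmega_of_even h hθ hA ht (fun k hk => ?_) fun j => ?_
    · simp [he₁ k hk, hBo _ k hk]
    · rw [eA, hΩ]
      simp [hBA, hd]
  have hk₃ := (kerOmegaModule ψ).smul_mem J' hk₂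
  rw [← hJd, smul_smul, hJJ, one_smul] at hk₃
  refine ⟨fun i => Ω (B i) δ, d, _, (kerOmegaModule ψ).add_mem hk₁ hk₃, ?_⟩
  abel

/-- The rank of `ω̄` is the same at all supermaps with nondegenerate frame. -/
theorem exists_hasRank : ∃ n : ℕ, ∀ (Λ : Type u) [Ring Λ] [Algebra ℝ Λ] [SuperAlgebra Λ],
    ∀ ψ ∈ FBar Λ, HasRank ψ n n := by
  obtain ⟨n, e, a, b, he, ha, hb, hab, hba, hB, hA⟩ := exists_flat_dual
  refine ⟨n, fun Λ _ _ _ ψ hψ => ?_⟩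
  obtain ⟨s, ψ', hs, hc, h, hθ, rfl⟩ := exists_theta_gauge hψ
  obtain ⟨J, J', hJJ', hJ'J, hJ, hJ', hint⟩ := exists_berezinian s hs hc
  have hghost : ∀ k : Coord, k.ghost = 0 ∨ k.ghost = 1 := fun k => by
    cases k <;> simp [Coord.ghost]
  obtain ⟨A, hAa⟩ : ∃ A : Fin n → Coord → ThetaExt Λ, ∀ i k, A i k = ofReal (a i k) :=
    ⟨_, fun _ _ => rfl⟩
  obtain ⟨B, hBb⟩ : ∃ B : Fin n → Coord → ThetaExt Λ, ∀ i k, B i k = ofReal (b i k) :=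
    ⟨_, fun _ _ => rfl⟩
  obtain ⟨S, hS⟩ : ∃ S : (Coord → ThetaExt Λ) →ₗ[Λ] (Coord → ThetaExt Λ),
      ∀ δ k, S δ k = s (δ k) :=
    ⟨substTangent (s : ThetaExt Λ →ₐ[ℝ] ThetaExt Λ) hc, fun _ _ => rfl⟩
  have eA : ∀ i, A i = fun k => ofReal (a i k) := fun i => funext (hAa i)
  have eB : ∀ i, B i = fun k => ofReal (b i k) := fun i => funext (hBb i)
  have eS : ∀ δ, S δ = fun k => s (δ k) := fun δ => funext (hS δ)
  have hSΩ : ∀ δ δ', omegaBar (fun i => s (ψ' i)) (S δ) (S δ') =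
      berezin (omegaF ψ' δ δ' * J) := fun δ δ' => by
    have h1 := omegaF_map (s : ThetaExt Λ →+* ThetaExt Λ) ψ' δ δ'
    rw [eS, eS, ← hint]
    exact congrArg berezin h1
  have hBr : ∀ j, J' • B j = fun k => B j k * J' := fun j => funext fun k => even_mul _ _ hJ'
  have hBo : ∀ j, ∀ k : Coord, k.ghost = 1 → B j k = 0 := fun j k hk => by
    rw [hBb, (hb j).2.1 k hk, map_zero]
  have hAt : ∀ i, IsTensor (A i) := fun i => eA i ▸ isTensor_ofReal (ha i).1
  have hBt : ∀ i, IsTensor (B i) := fun i => eB i ▸ isTensor_ofReal (hb i).1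
  have hSt : ∀ δ, IsTensor δ → IsTensor (S δ) := fun δ hδ => by
    rw [eS]; exact hδ.map (s : ThetaExt Λ →+ ThetaExt Λ)
  have hAB : ∀ i j, omegaBar ψ' (A i) (B j) = if i = j then 1 else 0 := fun i j => by
    have h1 := hab i j
    rw [omegaBar] at h1
    rw [omegaBar, eA, eB, omegaF_ofReal_right hθ (a i) (hb j).2.1, berezin_ofReal, h1]
    split_ifs <;> simp
  have hBA : ∀ i j, omegaBar ψ' (B i) (A j) = if i = j then (e i : Λ) else 0 := fun i j => by
    have h1 := hba i j
    rw [omegaBar] at h1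
    rw [omegaBar, eA, eB, omegaF_ofReal_left h hθ (hb i).2.1 (a j), berezin_ofReal, h1]
    split_ifs <;> simp
  -- The density of the Berezin integral is compensated by the factor in the second family.
  refine hasRank_of_dual (A := fun i => S (A i)) (B := fun i => S (J' • B i)) he
    (fun i => hSt _ (hAt i)) (fun i => hSt _ ((hBt i).smul J')) (fun i t hi k => ?_)
    (fun i t hi k => ?_) (fun i j => ?_) (fun i j => ?_) (fun i j => ?_) fun δ hδ => ?_
  · rcases hghost k with hk | hk
    · simp [hS, hAa, (ha i).2.1 k hk]
    · rw [hk, ← hi, hS, hAa, hs, isSuperHom_ofReal, (ha i).2.2, map_zsmul, map_zsmul]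
  · rcases hghost k with hk | hk
    · rw [hk, ← hi, hS, Pi.smul_apply, smul_eq_mul, hBb, hs, map_mul, hJ', isSuperHom_ofReal,
        (hb i).2.2, map_zsmul, mul_smul_comm, map_zsmul]
    · simp [hS, hBo i k hk]
  · rw [hSΩ, hBr, omegaF_mul_right, mul_assoc, hJJ', mul_one]
    exact hAB i j
  · rw [hSΩ, omegaF_smul, smul_eq_mul, even_mul _ _ hJ', mul_assoc, hJJ', mul_one]
    exact hBA i j
  · rw [hSΩ, hBr j, omegaF_mul_right, omegaF_even_right (fun a => hBo j _ rfl)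
      (fun a c => hBo j _ rfl)]
    simp [hBo i (.xi _) rfl, hBo i (.rho _ _) rfl]
  · obtain ⟨c, d, κ, hκ, e1⟩ := exists_decomposition h hθ hJJ' hJ he (fun i => (ha i).1)
      (fun i => (hb i).1) (fun i => (hb i).2.1) hB hA hAa hBb hAB hBA
      (hδ.map (s.symm : ThetaExt Λ →+ ThetaExt Λ))
    have e2 : δ = S fun i => s.symm (δ i) := by funext i; simp [hS]
    replace e1 : (fun i => s.symm (δ i)) = _ := e1
    rw [e2, e1, map_add, map_add, map_sum, map_sum]
    simp only [map_smul]
    refine add_mem (Submodule.mem_sup_left (add_mem ?_ ?_)) (Submodule.mem_sup_right ?_)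
    · exact sum_mem fun i _ => Submodule.smul_mem _ _ (Submodule.subset_span ⟨.inl i, rfl⟩)
    · exact sum_mem fun i _ => Submodule.smul_mem _ _ (Submodule.subset_span ⟨.inr i, rfl⟩)
    · rw [eS]
      exact mem_kerOmegaBar_iff.mpr (mem_kerOmega_equiv s hκ)

end

end ConformalGravity

end

theorem mainTheorem2 :
    (∀ (α : KernelLabel) (R : Type u) [Ring R] [Algebra ℝ R] [SuperAlgebra R] (φ : Coord → R),
      IsPoint φ → kernelField α R φ ∈ kerOmega φ) ∧
    (∃ p q : ℕ, ∀ (Λ : Type u) [Ring Λ] [Algebra ℝ Λ] [SuperAlgebra Λ],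
      ∀ ψ ∈ FBar Λ, HasRank ψ p q) ∧
    (∀ (Λ : Type u) [Ring Λ] [Algebra ℝ Λ] [SuperAlgebra Λ], ∀ ψ ∈ FBar Λ,
      kerOmegaBar ψ =
        Submodule.span Λ {δ | ∃ (s : List (Fin 4)) (α : KernelLabel),
          δ = ((kernelField α).xiMul s).prolong ψ} ⊔ higherTangent Λ) := by
  refine ⟨fun α R _ _ _ φ h => kernelField_mem α h, ?_, fun Λ _ _ _ ψ hψ => kerOmegaBar_eq hψ⟩
  obtain ⟨n, hn⟩ := exists_hasRank
  exact ⟨n, n, hn⟩
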